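/- Setting. Let $R,V\subset\mathbb{R}^d$ be compact embedded $C^1$ manifolds, possibly with boundary and corners, with surface measures $\sigma,\sigma'$ and surface gradients $\nabla$; their dimensions may differ, and every connected component of $R$ has a boundary point. Let $H^1_0(R)$ be the closure in $H^1(R)$ of the $C^1$ functions with compact support in the interior of $R$, with inner product $\langle\phi,\psi\rangle=\int_R\nabla\phi\cdot\nabla\psi\,d\sigma$ and norm $\|\phi\|=(\int_R|\nabla\phi|^2d\sigma)^{1/2}$; for $\psi\in L^2(V)$ let $\|\psi\|=(\int_V|\psi|^2d\sigma')^{1/2}$. Let $B\subset\mathbb{R}^p$ be compact, $B'\supset B$ open, and for $m\in B'$ let $H_m:V\times R\to\mathbb{R}$ be a kernel such that * $(m,x,y)\mapsto H_m(x,y)$ and $\nabla_xH_m(x,y)$ exist and are continuous on $B\times V\times R$; * $\partial_{m_i}H_m(x,y)$, $\partial_{m_i}\nabla_xH_m(x,y)$ and $\partial_{m_i}\partial_{m_j}H_m(x,y)$ exist and are continuous on $B'\times V\times R$ for $1\le i,j\le p$. For $u\in H^1_0(R)$ put $\mathcal{A}_mu(x)=\int_RH_m(x,y)u(y)\,d\sigma(y)$,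 $x\in V$, and let $\partial_q\mathcal{A}_m$ be its derivative in $m$ in the direction $q$. Assume: * if $m_1,m_2\in B$, $u,v\in H^1_0(R)$, $\mathcal{A}_{m_1}u=\mathcal{A}_{m_2}v$ in $L^2(V)$, and $u\ne0$ or $v\ne0$, then $m_1=m_2$ and $u=v$; * if $q\in\mathbb{R}^p$ is a unit vector, $m\in B$, $u,v\in H^1_0(R)$ and $\partial_q\mathcal{A}_mu=\mathcal{A}_mv$ in $L^2(V)$, then $u=v=0$. For each $k\in\mathbb{N}$ let $P_{1,k},\dots,P_{M_k,k}\in V$ be points and $C'(1,k),\dots,C'(M_k,k)\in\mathbb{R}$ be weights such that, for some sequence $h_k\to0$, $$\Big|\sum_{j=1}^{M_k}C'(j,k)\,\phi(P_{j,k})-\int_V\phi\,d\sigma'\Big|\le h_k\,\sup_V|\nabla\phi|\qquad\text{for all }k\in\mathbb{N},\ \phi\in C^1(V)$$ (for example $M_k$ strictly increasing and $h_k=O(1/M_k)$). Write $|f|_k^2=\sum_{j=1}^{M_k}C'(j,k)|f(P_{j,k})|^2$. Fix $A_1,A_2,\beta>0$. For $m\in B$ let $\mathcal{A}_m^*:L^2(V)\to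 H^1_0(R)$ be the adjoint of $\mathcal{A}_m:H^1_0(R)\to L^2(V)$, and let $E_m$ be the span of the eigenvectors of $\mathcal{A}_m^*\mathcal{A}_m$ with eigenvalues strictly greater than $\beta^2$. Say that $C>0$ is admissible if $\|\mathcal{A}_mu-\mathcal{A}_{m'}v\|\ge C|m-m'|$ for all $m,m'\in B$, $u\in E_m$ and $v\in E_{m'}$ with $\|\mathcal{A}_{m'}v\|\ge A_1$ and $\|v\|\le A_2$. Theorem. 1. There are an admissible $C>0$ and an integer $N$ such that for every $k>N$, all $m,m'\in B$, all $u\in E_m$, and all $v\in E_{m'}$ with $\|v\|\le A_2$ and $|\mathcal{A}_{m'}v|_k^2\ge A_1^2$, one has $|\mathcal{A}_mu-\mathcal{A}_{m'}v|_k^2\ge0$ and $$\Big(\sum_{j=1}^{M_k}C'(j,k)\,|(\mathcal{A}_mu-\mathcal{A}_{m'}v)(P_{j,k})|^2\Big)^{1/2}\ \ge\ \frac C2\,|m-m'| .\qquad(*)$$ In particular, if $\mathcal{A}_mu(P_{j,k})=\mathcal{A}_{m'}v(P_{j,k})$ for $j=1,\dots,M_k$, then $m=m'$: finitely many point measurements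 determine $m$ uniquely and, by $(*)$, Lipschitz-stably. 2. For every admissible $C>0$ there is an integer $N$ such that for all $m,m'\in B$, all $u\in E_m$, and all $v\in E_{m'}$ with $\|v\|\le A_2$ and $|\mathcal{A}_{m'}v|_k^2\ge A_1^2$ for every $k>N$, one has $|\mathcal{A}_mu-\mathcal{A}_{m'}v|_k^2\ge0$ and $(*)$ for every $k>N$. -/

import Mathlib

open MeasureTheory Filter Topology Set

noncomputable section

namespace ParamInverse

/-- `ℝᵈ` with its Euclidean norm. -/
abbrev Euc (d : ℕ) : Type := EuclideanSpace ℝ (Fin d)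

/-! ### Compact manifolds embedded in `ℝᵈ` -/

/-- The model piece `[0,∞)ˢ × {0}ᵈ⁻ˢ` of `ℝᵈ`. -/
def corner (d s : ℕ) : Set (Euc d) :=
  {z | ∀ i : Fin d, ((i : ℕ) < s → 0 ≤ z i) ∧ (s ≤ (i : ℕ) → z i = 0)}

/-- `Φ` is a `C¹` diffeomorphism between open subsets of `ℝᵈ` that takes the part of `R` in its
source onto the part of `[0,∞)ˢ × {0}ᵈ⁻ˢ` in its target. -/
structure IsStraightening {d : ℕ} (s : ℕ) (R : Set (Euc d))
    (Φ : OpenPartialHomeomorph (Euc d) (Euc d)) : Prop where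
  contDiffOn : ContDiffOn ℝ 1 Φ Φ.source
  contDiffOn_symm : ContDiffOn ℝ 1 Φ.symm Φ.target
  mem_iff : ∀ x ∈ Φ.source, (x ∈ R ↔ Φ x ∈ corner d s)

/-- `R` is a compact `s`-dimensional `C¹` submanifold of `ℝᵈ`, possibly with boundary and
corners. -/
structure IsCompactManifold {d : ℕ} (s : ℕ) (R : Set (Euc d)) : Prop where
  dim_le : s ≤ d
  isCompact : IsCompact R
  exists_chart : ∀ x ∈ R, ∃ Φ, IsStraightening s R Φ ∧ x ∈ Φ.source

/-- The interior points of the manifold `R`: those that a chart takes to a point whose first `s`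
coordinates are all positive. The other points of `R` form its boundary. -/
def manifoldInterior {d : ℕ} (s : ℕ) (R : Set (Euc d)) : Set (Euc d) :=
  {x | x ∈ R ∧ ∃ Φ, IsStraightening s R Φ ∧ x ∈ Φ.source ∧ ∀ i : Fin d, (i : ℕ) < s → 0 < Φ x i}

/-- Every connected component of `R` has a boundary point. This is the situation in which
`‖∇φ‖_{L²}` is a norm on `H¹₀(R)`. -/
def ComponentsHaveBoundary {d : ℕ} (s : ℕ) (R : Set (Euc d)) : Prop :=
  ∀ x ∈ R, ∃ y ∈ connectedComponentIn R x, y ∉ manifoldInterior s R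

/-- The surface measure of an `s`-dimensional submanifold `R`, as a measure on `ℝᵈ`:
the Hausdorff measure, normalized to agree with Lebesgue measure on `ℝˢ`. -/
def surfaceMeasure {d : ℕ} (s : ℕ) (R : Set (Euc d)) : Measure (Euc d) :=
  (Measure.euclideanHausdorffMeasure s).restrict R

/-- The tangent space of `R` at `x`. -/
def tangentSpan {d : ℕ} (R : Set (Euc d)) (x : Euc d) : Submodule ℝ (Euc d) :=
  Submodule.span ℝ (tangentConeAt ℝ R x)

/-- The surface gradient at `x` of a function on `R` (only the values of `f` on `R` matter):
the vector of the tangent space that represents the derivative of `f` within `R`. The derivative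
within `R` is determined on tangent vectors only, hence the projection. -/
def surfGrad {d : ℕ} (R : Set (Euc d)) (f : Euc d → ℝ) (x : Euc d) : Euc d :=
  (tangentSpan R x).starProjection ((InnerProductSpace.toDual ℝ (Euc d)).symm (fderivWithin ℝ f R x))

/-- `f` is of class `C¹` on `R`. -/
def IsC1On {d : ℕ} (R : Set (Euc d)) (f : Euc d → ℝ) : Prop :=
  (∀ x ∈ R, DifferentiableWithinAt ℝ f R x) ∧ ContinuousOn (surfGrad R f) R

/-! ### The space `H¹₀(R)` -/

/-- `C¹` functions with compact support in the interior of the manifold `R`, given as restrictions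
of `C¹` functions on `ℝᵈ`. -/
def IsTestFunction {d : ℕ} (s : ℕ) (R : Set (Euc d)) (φ : Euc d → ℝ) : Prop :=
  ContDiff ℝ 1 φ ∧ HasCompactSupport φ ∧ tsupport φ ∩ R ⊆ manifoldInterior s R

/-- `H¹₀(R)`: the closure of the test functions in the `H¹` norm. An element is the pair
`(u, ∇u) ∈ L²(R) × L²(R; ℝᵈ)`. -/
def H10 {d : ℕ} (s : ℕ) (R : Set (Euc d)) :
    Submodule ℝ (Lp ℝ 2 (surfaceMeasure s R) × Lp (Euc d) 2 (surfaceMeasure s R)) :=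
  (Submodule.span ℝ {w | ∃ φ : Euc d → ℝ, IsTestFunction s R φ ∧
    w.1 =ᵐ[surfaceMeasure s R] φ ∧ w.2 =ᵐ[surfaceMeasure s R] surfGrad R φ}).topologicalClosure

/-- The (weak) gradient of an element of `H¹₀(R)`. -/
def grad {d s : ℕ} {R : Set (Euc d)} (u : H10 s R) : Lp (Euc d) 2 (surfaceMeasure s R) :=
  u.1.2

/-- The norm `(∫_R |∇u|² dσ)^{1/2}` of `H¹₀(R)`. -/
def gradNorm {d s : ℕ} {R : Set (Euc d)} (u : H10 s R) : ℝ := ‖grad u‖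

/-- The inner product `∫_R ∇u · ∇w dσ` of `H¹₀(R)`. -/
def gradInner {d s : ℕ} {R : Set (Euc d)} (u w : H10 s R) : ℝ := inner ℝ (grad u) (grad w)

/-- The norm `(∫_V |f|² dσ')^{1/2}` of `L²(V)`. -/
def normV {d : ℕ} (t : ℕ) (V : Set (Euc d)) (f : Euc d → ℝ) : ℝ :=
  √(∫ x, (f x) ^ 2 ∂(surfaceMeasure t V))

/-! ### The integral operators -/

/-- Regularity of the kernel `H m x y`, for `m` in `B` or in its neighborhood `B'`, `x` in `V` and
`y` in `R`. The gradient in `x` is the surface gradient on `V`. The derivatives in `m` are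
taken as total derivatives: on the open set `B'` the partial derivatives exist and are jointly
continuous if and only if the total derivatives do and are. -/
structure KernelRegularity {d p : ℕ} (V R : Set (Euc d)) (B B' : Set (Euc p))
    (H : Euc p → Euc d → Euc d → ℝ) : Prop where
  isOpen : IsOpen B'
  subset : B ⊆ B'
  /-- `H` is continuous -/
  cont : ContinuousOn (fun z : Euc p × Euc d × Euc d => H z.1 z.2.1 z.2.2) (B ×ˢ V ×ˢ R)
  /-- `∇ₓ H` exists -/
  diff_x : ∀ m ∈ B', ∀ x ∈ V, ∀ y ∈ R, DifferentiableWithinAt ℝ (fun x' => H m x' y) V x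
  /-- `∇ₓ H` is continuous -/
  cont_grad_x : ContinuousOn
    (fun z : Euc p × Euc d × Euc d => surfGrad V (fun x' => H z.1 x' z.2.2) z.2.1) (B ×ˢ V ×ˢ R)
  /-- `∂ₘ H` exists -/
  diff_m : ∀ m ∈ B', ∀ x ∈ V, ∀ y ∈ R, DifferentiableAt ℝ (fun m' => H m' x y) m
  /-- `∂ₘ H` is continuous -/
  cont_m : ContinuousOn
    (fun z : Euc p × Euc d × Euc d => fderiv ℝ (fun m' => H m' z.2.1 z.2.2) z.1) (B' ×ˢ V ×ˢ R)
  /-- `∂ₘ ∇ₓ H` exists -/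
  diff_m_grad_x : ∀ m ∈ B', ∀ x ∈ V, ∀ y ∈ R,
    DifferentiableAt ℝ (fun m' => surfGrad V (fun x' => H m' x' y) x) m
  /-- `∂ₘ ∇ₓ H` is continuous -/
  cont_m_grad_x : ContinuousOn
    (fun z : Euc p × Euc d × Euc d =>
      fderiv ℝ (fun m' => surfGrad V (fun x' => H m' x' z.2.2) z.2.1) z.1) (B' ×ˢ V ×ˢ R)
  /-- `∂ₘ ∂ₘ H` exists -/
  diff_m_m : ∀ m ∈ B', ∀ x ∈ V, ∀ y ∈ R,
    DifferentiableAt ℝ (fun m' => fderiv ℝ (fun m'' => H m'' x y) m') m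
  /-- `∂ₘ ∂ₘ H` is continuous -/
  cont_m_m : ContinuousOn
    (fun z : Euc p × Euc d × Euc d =>
      fderiv ℝ (fun m' => fderiv ℝ (fun m'' => H m'' z.2.1 z.2.2) m') z.1) (B' ×ˢ V ×ˢ R)

/-- The operator `(𝒜ₘ u)(x) = ∫_R H m x y u(y) dσ(y)`. -/
def opA {d p s : ℕ} {R : Set (Euc d)} (H : Euc p → Euc d → Euc d → ℝ) (m : Euc p) (u : H10 s R)
    (x : Euc d) : ℝ :=
  ∫ y, H m x y * u.1.1 y ∂(surfaceMeasure s R)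

/-- The directional derivative `∂_q 𝒜ₘ u` of the operator in the parameter. -/
def opDA {d p s : ℕ} {R : Set (Euc d)} (H : Euc p → Euc d → Euc d → ℝ) (q m : Euc p) (u : H10 s R)
    (x : Euc d) : ℝ :=
  lineDeriv ℝ (fun m' => opA H m' u x) m q

/-- First uniqueness assumption: `𝒜_{m₁} u = 𝒜_{m₂} v` in `L²(V)` with `u ≠ 0` or `v ≠ 0` implies
`m₁ = m₂` and `u = v`. -/
def UniqueParameter {d p : ℕ} (t s : ℕ) (V R : Set (Euc d)) (B : Set (Euc p))
    (H : Euc p → Euc d → Euc d → ℝ) : Prop :=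
  ∀ m₁ ∈ B, ∀ m₂ ∈ B, ∀ u v : H10 s R,
    opA H m₁ u =ᵐ[surfaceMeasure t V] opA H m₂ v → (u ≠ 0 ∨ v ≠ 0) → m₁ = m₂ ∧ u = v

/-- Second uniqueness assumption: `∂_q 𝒜ₘ u = 𝒜ₘ v` in `L²(V)` for a unit vector `q` implies
`u = v = 0`. -/
def UniqueDerivative {d p : ℕ} (t s : ℕ) (V R : Set (Euc d)) (B : Set (Euc p))
    (H : Euc p → Euc d → Euc d → ℝ) : Prop :=
  ∀ q : Euc p, ‖q‖ = 1 → ∀ m ∈ B, ∀ u v : H10 s R,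
    opDA H q m u =ᵐ[surfaceMeasure t V] opA H m v → u = 0 ∧ v = 0

/-- `w = 𝒜ₘ* f`, where `𝒜ₘ* : L²(V) → H¹₀(R)` is the adjoint of `𝒜ₘ` for the inner product
`∫ ∇u · ∇w` of `H¹₀(R)` and the inner product of `L²(V)`. -/
def IsAdjointValue {d p s : ℕ} {R : Set (Euc d)} (t : ℕ) (V : Set (Euc d))
    (H : Euc p → Euc d → Euc d → ℝ) (m : Euc p) (f : Euc d → ℝ) (w : H10 s R) : Prop :=
  ∀ φ : H10 s R, gradInner w φ = ∫ x, f x * opA H m φ x ∂(surfaceMeasure t V)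

/-- `u` is an eigenvector of `𝒜ₘ* 𝒜ₘ : H¹₀(R) → H¹₀(R)` for the eigenvalue `l`. -/
def IsEigenvector {d p s : ℕ} {R : Set (Euc d)} (t : ℕ) (V : Set (Euc d))
    (H : Euc p → Euc d → Euc d → ℝ) (m : Euc p) (l : ℝ) (u : H10 s R) : Prop :=
  u ≠ 0 ∧ IsAdjointValue t V H m (opA H m u) (l • u)

/-- `E_m`: the span of the eigenvectors of `𝒜ₘ* 𝒜ₘ` with eigenvalue greater than `β²`. -/
def spaceE {d p : ℕ} (t s : ℕ) (V R : Set (Euc d)) (H : Euc p → Euc d → Euc d → ℝ) (β : ℝ)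
    (m : Euc p) : Submodule ℝ (H10 s R) :=
  Submodule.span ℝ {u | ∃ l : ℝ, β ^ 2 < l ∧ IsEigenvector t V H m l u}

/-! ### Quadrature -/

/-- The discrete quantity `∑ⱼ C'(j,k) |f(P_{j,k})|²`, for nodes `P k j` and weights `c k j`,
`j = 1, …, M k`. -/
def discSq {d : ℕ} (M : ℕ → ℕ) (P : (k : ℕ) → Fin (M k) → Euc d) (c : (k : ℕ) → Fin (M k) → ℝ)
    (k : ℕ) (f : Euc d → ℝ) : ℝ :=
  ∑ j : Fin (M k), c k j * |f (P k j)| ^ 2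

/-- Integrals over `V` of `C¹` functions `φ` are approximated by the sums `∑ⱼ c k j φ(P k j)`, up to
the error `h k * sup_V |∇φ|`, where `h k` tends to `0`. The case `h k = K / M k`, with `M` strictly
increasing, is the usual rate for points on a curve; for `V` of higher dimension `t` the error of
`M k` nodes is of order `(M k)^(-1/t)` at best. -/
structure IsQuadrature {d : ℕ} (t : ℕ) (V : Set (Euc d)) (M : ℕ → ℕ)
    (P : (k : ℕ) → Fin (M k) → Euc d) (c : (k : ℕ) → Fin (M k) → ℝ) (h : ℕ → ℝ) : Prop where
  mem : ∀ k j, P k j ∈ V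
  tendsto : Tendsto h atTop (𝓝 0)
  error_le : ∀ k, ∀ φ : Euc d → ℝ, IsC1On V φ →
    |∑ j : Fin (M k), c k j * φ (P k j) - ∫ x, φ x ∂(surfaceMeasure t V)|
      ≤ h k * ⨆ x : V, ‖surfGrad V φ x‖

/-! ### The two stability estimates -/

/-- The estimate of the continuous problem, with constant `C`: for all `m`, `m'` in `B`, `u` in
`E_m` and `v` in `E_{m'}` with `‖𝒜_{m'} v‖ ≥ A₁` and `‖v‖ ≤ A₂`, one has
`‖𝒜ₘ u - 𝒜_{m'} v‖ ≥ C |m - m'|`. -/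
def ContinuousStability {d p : ℕ} (t s : ℕ) (V R : Set (Euc d)) (B : Set (Euc p))
    (H : Euc p → Euc d → Euc d → ℝ) (β A₁ A₂ C : ℝ) : Prop :=
  ∀ m ∈ B, ∀ m' ∈ B, ∀ u ∈ spaceE t s V R H β m, ∀ v ∈ spaceE t s V R H β m',
    A₁ ≤ normV t V (opA H m' v) → gradNorm v ≤ A₂ →
      C * ‖m - m'‖ ≤ normV t V (fun x => opA H m u x - opA H m' v x)

/-- The estimate `(∑ⱼ C'(j,k) |(𝒜ₘ u - 𝒜_{m'} v)(P_{j,k})|²)^{1/2} ≥ (C/2) |m - m'|`. The weights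
may be negative: that the sum under the root is not negative is part of the claim. -/
def DiscreteEstimate {d p s : ℕ} {R : Set (Euc d)} (H : Euc p → Euc d → Euc d → ℝ) (M : ℕ → ℕ)
    (P : (k : ℕ) → Fin (M k) → Euc d) (c : (k : ℕ) → Fin (M k) → ℝ) (C : ℝ) (k : ℕ)
    (m m' : Euc p) (u v : H10 s R) : Prop :=
  0 ≤ discSq M P c k (fun x => opA H m u x - opA H m' v x) ∧
    C / 2 * ‖m - m'‖ ≤ √(discSq M P c k (fun x => opA H m u x - opA H m' v x))

end ParamInverse

end

/-! Write `f = 𝒜ₘ u - 𝒜_{m'} v`, `n = ‖f‖` in `L²(V)` and `δ = |m - m'|`. The quadrature rule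
applied to `f²` has an error of at most `2 |h_k| sup |f| sup |∇f|`. Since the kernel and its
`x`-gradient are `C¹` in `m`, both suprema are at most a constant times `‖u - v‖ + δ ‖v‖`. If this
quantity is at most a constant times `n`, the error is small relative to `n²`, however close `m` and
`m'` are. The discrete square is then at least `n² / 4` for all large `k`, which gives the sign and
the constant `C / 2` together.

Two estimates remain. The first, `exists_norm_sub_le_of_mem_highSpan`, is `‖u - v‖ ≤ K (n + δ ‖v‖)`
for `u ∈ E_m`, `v ∈ E_{m'}`. The spaces `E_m` need not vary continuously, since eigenvalues may
cross `β²`. The spectrum of `𝒜ₘ* 𝒜ₘ` is therefore cut at `β² / 2`: the gap between `β² / 2` and `β²`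
forces the low-frequency part of a vector of `E_{m'}` to be `O(δ)`, and `𝒜ₘ` is bounded below on the
high-frequency part.

The second, `exists_stability_constant`, is `n ≥ C δ`, by compactness. A sequence violating it has
weak limits `u₀`, `v₀`, and `(u - v) / δ`, bounded by the first estimate, has a weak limit `w₀`.
Compact operators make the limits strong, so `𝒜_a u₀ = 𝒜_{a'} v₀` with `v₀ ≠ 0`, and hence `a = a'`.
Division by `δ` leads to `∂_q 𝒜_a v₀ = -𝒜_a w₀`, which the second uniqueness assumption excludes.

The abstract argument needs `H¹₀(R)` with the gradient norm to be a Hilbert space that embeds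
continuously in `L²(R)`. This is the Poincaré inequality (`IsCompactManifold.poincareOn_self`),
proved in charts at the boundary and propagated along connected components. -/

noncomputable section

namespace ParamInverse

set_option linter.unusedSectionVars false

/-! ### Spectral subspaces of compact symmetric operators -/

section Spectral

variable {𝓗 𝓛 : Type*} [NormedAddCommGroup 𝓗] [InnerProductSpace ℝ 𝓗]
  [NormedAddCommGroup 𝓛] [InnerProductSpace ℝ 𝓛]

/-- The span of the eigenvectors of `F` with eigenvalue in `S`. -/
def spectralSpan (F : 𝓗 →L[ℝ] 𝓗) (S : Set ℝ) : Submodule ℝ 𝓗 :=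
  ⨆ l : S, Module.End.eigenspace (F : Module.End ℝ 𝓗) (l : ℝ)

theorem mem_spectralSpan_of_apply_eq {F : 𝓗 →L[ℝ] 𝓗} {S : Set ℝ} {l : ℝ} (hl : l ∈ S) {x : 𝓗}
    (hx : F x = l • x) : x ∈ spectralSpan F S :=
  Submodule.mem_iSup_of_mem (⟨l, hl⟩ : S) (Module.End.mem_eigenspace_iff.2 hx)

theorem spectralSpan_induction {F : 𝓗 →L[ℝ] 𝓗} {S : Set ℝ} {p : 𝓗 → Prop}
    (mem : ∀ l ∈ S, ∀ x, F x = l • x → p x) (zero : p 0) (add : ∀ x y, p x → p y → p (x + y))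
    {x : 𝓗} (hx : x ∈ spectralSpan F S) : p x :=
  Submodule.iSup_induction _ (motive := p) hx (fun l y hy => mem l l.2 y (Module.End.mem_eigenspace_iff.1 hy))
    zero add

theorem apply_mem_spectralSpan {F : 𝓗 →L[ℝ] 𝓗} {S : Set ℝ} {x : 𝓗} (hx : x ∈ spectralSpan F S) :
    F x ∈ spectralSpan F S :=
  spectralSpan_induction (p := fun x => F x ∈ spectralSpan F S)
    (fun l hl y hy => by
      rw [hy]; exact Submodule.smul_mem _ _ (mem_spectralSpan_of_apply_eq hl hy))
    (by simp) (fun y z hy hz => by rw [map_add]; exact add_mem hy hz) hx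

theorem exists_apply_eq_of_mem_spectralSpan {F : 𝓗 →L[ℝ] 𝓗} {S : Set ℝ} (hS : (0 : ℝ) ∉ S)
    {x : 𝓗} (hx : x ∈ spectralSpan F S) : ∃ y ∈ spectralSpan F S, F y = x :=
  spectralSpan_induction (p := fun x => ∃ y ∈ spectralSpan F S, F y = x)
    (fun l hl y hy => ⟨l⁻¹ • y, Submodule.smul_mem _ _ (mem_spectralSpan_of_apply_eq hl hy), by
      have : l ≠ 0 := fun h => hS (h ▸ hl)
      rw [map_smul, hy, smul_smul, inv_mul_cancel₀ this, one_smul]⟩)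
    ⟨0, zero_mem _, map_zero _⟩
    (fun y z ⟨y', hy', hy⟩ ⟨z', hz', hz⟩ => ⟨y' + z', add_mem hy' hz', by rw [map_add, hy, hz]⟩) hx

theorem exists_sum_of_mem_spectralSpan {F : 𝓗 →L[ℝ] 𝓗} {S : Set ℝ} {x : 𝓗}
    (hx : x ∈ spectralSpan F S) :
    ∃ (t : Finset S) (f : (l : S) → Module.End.eigenspace (F : Module.End ℝ 𝓗) (l : ℝ)),
      x = ∑ l ∈ t, (f l : 𝓗) := by
  classical
  obtain ⟨f, hf⟩ := (Submodule.mem_iSup_iff_exists_dfinsupp' _ _).1 hx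
  exact ⟨f.support, fun l => f l, by rw [← hf]; rfl⟩

variable {F : 𝓗 →L[ℝ] 𝓗} (hF : (F : 𝓗 →ₗ[ℝ] 𝓗).IsSymmetric) {S S' : Set ℝ}
include hF

/-- Eigenspaces are mutually orthogonal, so Pythagoras reduces the bound to single eigenvectors. -/
theorem norm_apply_le_of_mem_spectralSpan {g : ℝ} (hS : ∀ l ∈ S, |l| ≤ g)
    {x : 𝓗} (hx : x ∈ spectralSpan F S) : ‖F x‖ ^ 2 ≤ g ^ 2 * ‖x‖ ^ 2 := by
  obtain ⟨t, f, rfl⟩ := exists_sum_of_mem_spectralSpan hx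
  have horth := hF.orthogonalFamily_eigenspaces.comp (Subtype.coe_injective (p := (· ∈ S)))
  have e1 : ‖∑ l ∈ t, (f l : 𝓗)‖ ^ 2 = ∑ l ∈ t, ‖(f l : 𝓗)‖ ^ 2 := horth.norm_sum f t
  have e2 : ‖∑ l ∈ t, (l : ℝ) • (f l : 𝓗)‖ ^ 2 = ∑ l ∈ t, ‖(l : ℝ) • (f l : 𝓗)‖ ^ 2 :=
    horth.norm_sum (fun l => (l : ℝ) • f l) t
  have e3 : F (∑ l ∈ t, (f l : 𝓗)) = ∑ l ∈ t, (l : ℝ) • (f l : 𝓗) := by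
    rw [map_sum]
    exact Finset.sum_congr rfl fun l _ => Module.End.mem_eigenspace_iff.1 (f l).2
  rw [e3, e1, e2, Finset.mul_sum]
  refine Finset.sum_le_sum fun l _ => ?_
  rw [norm_smul, mul_pow, Real.norm_eq_abs]
  have := hS l l.2
  gcongr

theorem le_inner_apply_of_mem_spectralSpan {b : ℝ} (hS : ∀ l ∈ S, b ≤ l)
    {x : 𝓗} (hx : x ∈ spectralSpan F S) : b * ‖x‖ ^ 2 ≤ inner ℝ (F x) x := by
  obtain ⟨t, f, rfl⟩ := exists_sum_of_mem_spectralSpan hx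
  have horth := hF.orthogonalFamily_eigenspaces.comp (Subtype.coe_injective (p := (· ∈ S)))
  have e1 : ‖∑ l ∈ t, (f l : 𝓗)‖ ^ 2 = ∑ l ∈ t, ‖(f l : 𝓗)‖ ^ 2 := horth.norm_sum f t
  have e2 : inner ℝ (∑ l ∈ t, (l : ℝ) • (f l : 𝓗)) (∑ l ∈ t, (f l : 𝓗)) =
      ∑ l ∈ t, inner ℝ ((l : ℝ) • (f l : 𝓗)) (f l : 𝓗) :=
    horth.inner_sum (fun l => (l : ℝ) • f l) f t
  have e3 : F (∑ l ∈ t, (f l : 𝓗)) = ∑ l ∈ t, (l : ℝ) • (f l : 𝓗) := by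
    rw [map_sum]
    exact Finset.sum_congr rfl fun l _ => Module.End.mem_eigenspace_iff.1 (f l).2
  rw [e3, e1, e2, Finset.mul_sum]
  refine Finset.sum_le_sum fun l _ => ?_
  rw [inner_smul_left, real_inner_self_eq_norm_sq]
  have := hS l l.2
  simp only [conj_trivial]
  gcongr

theorem inner_eq_zero_of_mem_spectralSpan (hSS : Disjoint S S')
    {x y : 𝓗} (hx : x ∈ spectralSpan F S) (hy : y ∈ spectralSpan F S') : inner ℝ x y = 0 := by
  refine spectralSpan_induction (p := fun x => inner ℝ x y = (0 : ℝ)) (fun l hl x hx => ?_)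
    (by simp) (fun a b ha hb => by rw [inner_add_left, ha, hb, add_zero]) hx
  refine spectralSpan_induction (p := fun y => inner ℝ x y = (0 : ℝ)) (fun m hm y hy => ?_)
    (by simp) (fun a b ha hb => by rw [inner_add_right, ha, hb, add_zero]) hy
  exact hF.orthogonalFamily_eigenspaces (i := l) (j := m) (fun h => Set.disjoint_left.1 hSS hl (h ▸ hm))
    ⟨x, Module.End.mem_eigenspace_iff.2 hx⟩ ⟨y, Module.End.mem_eigenspace_iff.2 hy⟩

/-- The spectral splitting of a compact symmetric operator at the level `g`. -/
theorem exists_spectral_splitting [CompleteSpace 𝓗] (hc : IsCompactOperator F) {g : ℝ}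
    (hpos : ∀ x, 0 ≤ inner ℝ (F x) x) :
    ∃ Q : 𝓗 →L[ℝ] 𝓗, (∀ x, ‖Q x‖ ≤ ‖x‖) ∧ (∀ x, Q (F x) = F (Q x)) ∧
      (∀ x, ‖F (Q x)‖ ≤ g * ‖Q x‖) ∧ (∀ x, g * ‖x - Q x‖ ^ 2 ≤ inner ℝ (F (x - Q x)) (x - Q x)) ∧
      ∀ x ∈ spectralSpan F (Ioi g), Q x = 0 := by
  -- `Q` is the orthogonal projection onto the closed span of the eigenvectors with eigenvalue in
  -- `[0, g]`.
  set W : Submodule ℝ 𝓗 := (spectralSpan F (Icc 0 g)).topologicalClosure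
  have hWc : IsClosed (W : Set 𝓗) := Submodule.isClosed_topologicalClosure _
  have : CompleteSpace W := hWc.completeSpace_coe
  have hdisj : Disjoint (Icc 0 g) (Ioi g) :=
    Set.disjoint_left.2 fun l hl hl' => not_lt.2 hl.2 hl'
  have hlow : ∀ x ∈ spectralSpan F (Icc 0 g), W.starProjection x = x := fun x hx =>
    Submodule.starProjection_eq_self_iff.2 (Submodule.le_topologicalClosure _ hx)
  have hhigh : ∀ x ∈ spectralSpan F (Ioi g), W.starProjection x = 0 := by
    intro x hx
    refine (Submodule.starProjection_apply_eq_zero_iff _).2 ?_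
    rw [Submodule.orthogonal_closure]
    exact (Submodule.mem_orthogonal _ _).2 fun y hy => inner_eq_zero_of_mem_spectralSpan hF hdisj hy hx
  -- Spectral theorem: the eigenvectors have dense span, and positivity of `F` leaves no negative
  -- eigenvalue.
  have hdense : Dense ((spectralSpan F (Ioi g) ⊔ spectralSpan F (Icc 0 g) : Submodule ℝ 𝓗) :
      Set 𝓗) := by
    rw [Submodule.dense_iff_topologicalClosure_eq_top,
      Submodule.topologicalClosure_eq_top_iff, eq_bot_iff,
      ← F.orthogonalComplement_iSup_eigenspaces_eq_bot hc hF]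
    refine Submodule.orthogonal_le (iSup_le fun l x hx => ?_)
    have hx' : F x = l • x := Module.End.mem_eigenspace_iff.1 hx
    rcases eq_or_ne x 0 with rfl | hx0
    · exact zero_mem _
    have hl : 0 ≤ l := by
      have := hpos x
      rw [hx', inner_smul_left, real_inner_self_eq_norm_sq] at this
      have h2 : 0 < ‖x‖ ^ 2 := by positivity
      simp only [conj_trivial] at this
      exact nonneg_of_mul_nonneg_left this h2
    rcases lt_or_ge g l with h | h
    · exact Submodule.mem_sup_left (mem_spectralSpan_of_apply_eq h hx')
    · exact Submodule.mem_sup_right (mem_spectralSpan_of_apply_eq (S := Icc 0 g) ⟨hl, h⟩ hx')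
  -- Each remaining claim is a closed condition on `x`, so it may be checked on sums of a high and a
  -- low vector.
  have key : ∀ p : 𝓗 → Prop, IsClosed {x | p x} →
      (∀ x ∈ spectralSpan F (Ioi g), ∀ y ∈ spectralSpan F (Icc 0 g), p (x + y)) → ∀ x, p x := by
    intro p hp h x
    refine hdense.induction (P := p) (fun x hx => ?_) hp x
    obtain ⟨a, ha, b, hb, rfl⟩ := Submodule.mem_sup.1 hx
    exact h a ha b hb
  refine ⟨W.starProjection, fun x => W.norm_starProjection_apply_le x, ?_, ?_, ?_, hhigh⟩
  · refine key _ (isClosed_eq (by fun_prop) (by fun_prop)) fun x hx y hy => ?_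
    simp only [map_add, hhigh x hx, hlow y hy, hhigh _ (apply_mem_spectralSpan hx),
      hlow _ (apply_mem_spectralSpan hy), map_zero]
  · refine key _ (isClosed_le (by fun_prop) (by fun_prop)) fun x hx y hy => ?_
    rw [map_add, hhigh x hx, hlow y hy, zero_add]
    rcases eq_or_ne y 0 with rfl | hy0
    · simp
    have h1 := norm_apply_le_of_mem_spectralSpan hF (g := g)
      (fun l hl => by rw [abs_of_nonneg hl.1]; exact hl.2) hy
    -- For `g < 0` the interval `[0, g]` is empty and its spectral span trivial, contrary to `y ≠
    -- 0`.
    have hg : 0 ≤ g := by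
      by_contra hg
      exact hy0 ((Submodule.mem_bot ℝ).1 ((iSup_le fun l => absurd (l.2.1.trans l.2.2) hg :
        spectralSpan F (Icc 0 g) ≤ ⊥) hy))
    rw [← mul_pow] at h1
    exact (sq_le_sq₀ (norm_nonneg _) (by positivity)).1 h1
  · refine key _ (isClosed_le (by fun_prop) (by fun_prop)) fun x hx y hy => ?_
    rw [map_add, hhigh x hx, hlow y hy, zero_add, add_sub_cancel_right]
    exact le_inner_apply_of_mem_spectralSpan hF (fun l hl => le_of_lt hl) hx

end Spectral

/-! ### Perturbation of the high spectral space across a spectral gap -/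

section Gap

variable {𝓗 𝓛 : Type*} [NormedAddCommGroup 𝓗] [InnerProductSpace ℝ 𝓗] [CompleteSpace 𝓗]
  [NormedAddCommGroup 𝓛] [InnerProductSpace ℝ 𝓛] [CompleteSpace 𝓛]

/-- The operator `T† T`. -/
def normalOp (T : 𝓗 →L[ℝ] 𝓛) : 𝓗 →L[ℝ] 𝓗 := (ContinuousLinearMap.adjoint T) ∘L T

theorem inner_normalOp (T : 𝓗 →L[ℝ] 𝓛) (x y : 𝓗) :
    inner ℝ (normalOp T x) y = inner ℝ (T x) (T y) :=
  ContinuousLinearMap.adjoint_inner_left T y (T x)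

theorem normalOp_isSymmetric (T : 𝓗 →L[ℝ] 𝓛) : (normalOp T : 𝓗 →ₗ[ℝ] 𝓗).IsSymmetric := by
  intro x y
  change inner ℝ (normalOp T x) y = inner ℝ x (normalOp T y)
  rw [inner_normalOp, real_inner_comm, ← inner_normalOp, real_inner_comm]

theorem isCompactOperator_normalOp {T : 𝓗 →L[ℝ] 𝓛} (hT : IsCompactOperator T) :
    IsCompactOperator (normalOp T) :=
  hT.clm_comp (ContinuousLinearMap.adjoint T)

theorem norm_normalOp_sub_le (T T' : 𝓗 →L[ℝ] 𝓛) {M : ℝ} (hT : ‖T‖ ≤ M) (hT' : ‖T'‖ ≤ M) (x : 𝓗) :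
    ‖normalOp T' x - normalOp T x‖ ≤ 2 * M * ‖T - T'‖ * ‖x‖ := by
  have h : normalOp T' x - normalOp T x =
      ContinuousLinearMap.adjoint (T' - T) (T' x) + ContinuousLinearMap.adjoint T ((T' - T) x) := by
    simp [normalOp]
  have h1 : ‖ContinuousLinearMap.adjoint (T' - T) (T' x)‖ ≤ ‖T' - T‖ * (M * ‖x‖) := by
    refine ((ContinuousLinearMap.adjoint (T' - T)).le_opNorm _).trans ?_
    rw [LinearIsometryEquiv.norm_map]
    gcongr
    exact T'.le_of_opNorm_le hT' x
  have h2 : ‖ContinuousLinearMap.adjoint T ((T' - T) x)‖ ≤ M * (‖T' - T‖ * ‖x‖) := by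
    refine ((ContinuousLinearMap.adjoint T).le_opNorm _).trans ?_
    rw [LinearIsometryEquiv.norm_map]
    gcongr
    · exact (norm_nonneg _).trans hT
    · exact (T' - T).le_opNorm x
  rw [h, norm_sub_rev T T']
  refine (norm_add_le _ _).trans ?_
  linarith

/-- The span of the eigenvectors of `T† T` with eigenvalue greater than `β²`. -/
abbrev highSpan (T : 𝓗 →L[ℝ] 𝓛) (β : ℝ) : Submodule ℝ 𝓗 := spectralSpan (normalOp T) (Ioi (β ^ 2))

/-- The high spectral spaces of two operators are close to each other. -/
theorem norm_sub_le_of_mem_highSpan {β M : ℝ} (hβ : 0 < β) (T T' : 𝓗 →L[ℝ] 𝓛)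
    (hc : IsCompactOperator T) (hT : ‖T‖ ≤ M) (hT' : ‖T'‖ ≤ M) {u v : 𝓗} (hu : u ∈ highSpan T β)
    (hv : v ∈ highSpan T' β) :
    ‖u - v‖ ≤ 2 / β * ‖T (u - v)‖ + (2 / β * M + 1) * (4 * M / β ^ 2) * (‖T - T'‖ * ‖v‖) := by
  have hM : 0 ≤ M := (norm_nonneg _).trans hT
  -- Cutting at `β² / 2` leaves a gap below `β²`, whatever eigenvalues `T† T` has near `β²`.
  obtain ⟨Q, hQ1, hQF, hQlow, hQhigh, hQE⟩ := exists_spectral_splitting (normalOp_isSymmetric T)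
    (isCompactOperator_normalOp hc) (g := β ^ 2 / 2)
    (fun x => by rw [inner_normalOp]; exact real_inner_self_nonneg)
  set D := 2 * M * ‖T - T'‖
  have hD : 0 ≤ D := by positivity
  -- With `F = T† T`, `F' = T'† T'` and `w = F' z`, one has `Q w = Q (F' - F) z + F Q z` and `‖z‖ ≤
  -- ‖w‖ / β²`. Hence `‖X‖ ≤ D / β² + ‖X‖ / 2`, and the last term is absorbed.
  set X : highSpan T' β →L[ℝ] 𝓗 := Q ∘L (highSpan T' β).subtypeL
  have hX : ‖X‖ ≤ (D + β ^ 2 / 2 * ‖X‖) / β ^ 2 := by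
    refine X.opNorm_le_bound (by positivity) fun ⟨w, hw⟩ => ?_
    obtain ⟨z, hz, rfl⟩ := exists_apply_eq_of_mem_spectralSpan
      (fun h0 => absurd (mem_Ioi.1 h0) (not_lt.2 (sq_nonneg β))) hw
    have hzn : β ^ 2 * ‖z‖ ≤ ‖normalOp T' z‖ := by
      rcases eq_or_ne z 0 with rfl | hz0
      · simp
      have h1 := le_inner_apply_of_mem_spectralSpan (normalOp_isSymmetric T')
        (fun l (hl : l ∈ Ioi (β ^ 2)) => le_of_lt hl) hz
      have h2 := real_inner_le_norm (normalOp T' z) z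
      have h3 : 0 < ‖z‖ := norm_pos_iff.2 hz0
      exact le_of_mul_le_mul_right (by nlinarith) h3
    change ‖Q (normalOp T' z)‖ ≤ _ * ‖normalOp T' z‖
    have h4 : Q (normalOp T' z) = Q (normalOp T' z - normalOp T z) + normalOp T (Q z) := by
      rw [map_sub, hQF, sub_add_cancel]
    have h5 : ‖Q (normalOp T' z)‖ ≤ D * ‖z‖ + β ^ 2 / 2 * (‖X‖ * ‖z‖) := by
      rw [h4]
      refine (norm_add_le _ _).trans (add_le_add ?_ ?_)
      · exact (hQ1 _).trans (norm_normalOp_sub_le T T' hT hT' z)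
      · refine (hQlow z).trans ?_
        gcongr
        exact X.le_opNorm ⟨z, hz⟩
    calc ‖Q (normalOp T' z)‖ ≤ (D + β ^ 2 / 2 * ‖X‖) / β ^ 2 * (β ^ 2 * ‖z‖) := by
          refine h5.trans (le_of_eq ?_)
          field_simp
      _ ≤ _ := by gcongr
  have hX2 : ‖X‖ ≤ 2 * D / β ^ 2 := by
    rw [le_div_iff₀ (by positivity)] at hX ⊢
    linarith
  have hQv : ‖Q v‖ ≤ 2 * D / β ^ 2 * ‖v‖ := X.le_of_opNorm_le hX2 ⟨v, hv⟩
  have hQu : Q u = 0 := by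
    refine hQE u ?_
    refine (iSup_le fun l => ?_ : highSpan T β ≤ _) hu
    intro x hx
    have hl : β ^ 2 < (l : ℝ) := l.2
    exact mem_spectralSpan_of_apply_eq (l := l)
      (mem_Ioi.2 (by have := sq_nonneg β; linarith)) (Module.End.mem_eigenspace_iff.1 hx)
  set x := (u - v) - Q (u - v)
  have hx1 : u - v = x - Q v := by simp [x, hQu]
  -- The splitting gives the constant `β / √2`; the smaller `β / 2` avoids the root.
  have hx2 : β / 2 * ‖x‖ ≤ ‖T x‖ := by
    have := hQhigh (u - v)
    rw [inner_normalOp, real_inner_self_eq_norm_sq] at this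
    have h3 : (β / 2 * ‖x‖) ^ 2 ≤ ‖T x‖ ^ 2 := by
      rw [mul_pow]
      refine le_trans ?_ this
      gcongr
      nlinarith [sq_nonneg β]
    exact (sq_le_sq₀ (by positivity) (norm_nonneg _)).1 h3
  have hx3 : ‖T x‖ ≤ ‖T (u - v)‖ + M * ‖Q v‖ := by
    have : T x = T (u - v) + T (Q v) := by rw [hx1, ← map_add, sub_add_cancel]
    rw [this]
    exact (norm_add_le _ _).trans (by gcongr; exact T.le_of_opNorm_le hT _)
  have hx4 : ‖x‖ ≤ 2 / β * (‖T (u - v)‖ + M * ‖Q v‖) := by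
    rw [div_mul_eq_mul_div, le_div_iff₀ hβ]
    linarith
  have hx5 : ‖u - v‖ ≤ ‖x‖ + ‖Q v‖ := by rw [hx1]; exact norm_sub_le _ _
  calc ‖u - v‖ ≤ 2 / β * ‖T (u - v)‖ + (2 / β * M + 1) * ‖Q v‖ := by linarith
    _ ≤ 2 / β * ‖T (u - v)‖ + (2 / β * M + 1) * (2 * D / β ^ 2 * ‖v‖) := by gcongr
    _ = _ := by simp only [D]; ring

end Gap

/-! ### Weak limits along ultrafilters -/

section WeakLimits

variable {𝓗 𝓛 : Type*} [NormedAddCommGroup 𝓗] [InnerProductSpace ℝ 𝓗] [CompleteSpace 𝓗]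
  [NormedAddCommGroup 𝓛] [InnerProductSpace ℝ 𝓛] [CompleteSpace 𝓛]

theorem Ultrafilter.exists_tendsto_of_forall_mem {ι X : Type*} [TopologicalSpace X]
    (𝒰 : Ultrafilter ι) {K : Set X} (hK : IsCompact K) {x : ι → X} (hx : ∀ n, x n ∈ K) :
    ∃ a ∈ K, Tendsto x 𝒰 (𝓝 a) :=
  hK.ultrafilter_le_nhds' (𝒰.map x) (Filter.mem_map.2 (Filter.univ_mem' hx))

/-- Bounded families of a Hilbert space converge weakly along every ultrafilter. -/
theorem exists_weak_limit {ι : Type*} (𝒰 : Ultrafilter ι) {w : ι → 𝓗} {M : ℝ}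
    (hw : ∀ n, ‖w n‖ ≤ M) :
    ∃ a : 𝓗, ∀ y, Tendsto (fun n => inner ℝ (w n) y) 𝒰 (𝓝 (inner ℝ a y)) := by
  have hM : ∀ y n, ‖inner ℝ (w n) y‖ ≤ M * ‖y‖ := fun y n =>
    (norm_inner_le_norm _ _).trans (by gcongr; exact hw n)
  have hex : ∀ y, ∃ a : ℝ, ‖a‖ ≤ M * ‖y‖ ∧ Tendsto (fun n => inner ℝ (w n) y) 𝒰 (𝓝 a) := by
    intro y
    obtain ⟨a, ha, ha'⟩ := Ultrafilter.exists_tendsto_of_forall_mem 𝒰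
      (isCompact_closedBall (0 : ℝ) (M * ‖y‖)) (x := fun n => inner ℝ (w n) y)
      (fun n => mem_closedBall_zero_iff.2 (hM y n))
    exact ⟨a, mem_closedBall_zero_iff.1 ha, ha'⟩
  choose ℓ hℓ1 hℓ2 using hex
  -- The limits of the pairings depend linearly on `y` because limits are unique; the Riesz
  -- representation then supplies the weak limit.
  let L : 𝓗 →L[ℝ] ℝ := LinearMap.mkContinuous
    { toFun := ℓ
      map_add' := fun y z => tendsto_nhds_unique (hℓ2 (y + z))
        (by simpa only [inner_add_right] using (hℓ2 y).add (hℓ2 z))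
      map_smul' := fun c y => tendsto_nhds_unique (hℓ2 (c • y))
        (by simpa only [inner_smul_right, RingHom.id_apply, smul_eq_mul] using
          (hℓ2 y).const_mul c) } M hℓ1
  refine ⟨(InnerProductSpace.toDual ℝ 𝓗).symm L, fun y => ?_⟩
  rw [InnerProductSpace.toDual_symm_apply]
  exact hℓ2 y

/-- Compact operators turn weak limits into limits. -/
theorem IsCompactOperator.tendsto_of_weak {ι : Type*} {𝒰 : Ultrafilter ι} {T : 𝓗 →L[ℝ] 𝓛}
    (hT : IsCompactOperator T) {w : ι → 𝓗} {M : ℝ} (hw : ∀ n, ‖w n‖ ≤ M) {a : 𝓗}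
    (ha : ∀ y, Tendsto (fun n => inner ℝ (w n) y) 𝒰 (𝓝 (inner ℝ a y))) :
    Tendsto (fun n => T (w n)) 𝒰 (𝓝 (T a)) := by
  obtain ⟨K, hK, hTK⟩ :=
    _root_.IsCompactOperator.image_closedBall_subset_compact (𝕜₁ := ℝ) (f := (T : 𝓗 →ₗ[ℝ] 𝓛)) hT M
  obtain ⟨z, -, hz⟩ := Ultrafilter.exists_tendsto_of_forall_mem 𝒰 hK (x := fun n => T (w n))
    (fun n => hTK ⟨w n, mem_closedBall_zero_iff.2 (hw n), rfl⟩)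
  have : z = T a := by
    refine ext_inner_right ℝ fun y => ?_
    refine tendsto_nhds_unique (hz.inner tendsto_const_nhds) ?_
    simpa only [ContinuousLinearMap.adjoint_inner_right] using ha (ContinuousLinearMap.adjoint T y)
  rwa [← this]

/-- Variant of `IsCompactOperator.tendsto_of_weak` with operators that converge in norm. -/
theorem tendsto_apply_of_weak {ι : Type*} {𝒰 : Ultrafilter ι} {T : 𝓗 →L[ℝ] 𝓛}
    (hT : IsCompactOperator T) {Tn : ι → 𝓗 →L[ℝ] 𝓛} (hTn : Tendsto Tn 𝒰 (𝓝 T))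
    {w : ι → 𝓗} {M : ℝ} (hw : ∀ n, ‖w n‖ ≤ M) {a : 𝓗}
    (ha : ∀ y, Tendsto (fun n => inner ℝ (w n) y) 𝒰 (𝓝 (inner ℝ a y))) :
    Tendsto (fun n => Tn n (w n)) 𝒰 (𝓝 (T a)) := by
  have h1 := IsCompactOperator.tendsto_of_weak hT hw ha
  have h2 : Tendsto (fun n => (Tn n - T) (w n)) 𝒰 (𝓝 0) := by
    have h3 : Tendsto (fun n => ‖Tn n - T‖ * M) 𝒰 (𝓝 0) := by
      simpa using (tendsto_iff_norm_sub_tendsto_zero.1 hTn).mul_const M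
    exact squeeze_zero_norm (fun n => (Tn n - T).le_opNorm_of_le (hw n)) h3
  simpa using h2.add h1

end WeakLimits

/-! ### Lipschitz stability for an abstract family of compact operators -/

section Stability

variable {Θ 𝓗 𝓛 : Type*} [NormedAddCommGroup Θ] [NormedSpace ℝ Θ]
  [NormedAddCommGroup 𝓗] [InnerProductSpace ℝ 𝓗] [CompleteSpace 𝓗]
  [NormedAddCommGroup 𝓛] [InnerProductSpace ℝ 𝓛] [CompleteSpace 𝓛]

theorem exists_norm_sub_le_of_hasStrictFDerivAt {X : Type*} [NormedAddCommGroup X]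
    [NormedSpace ℝ X] {B : Set Θ} (hB : IsCompact B) {T : Θ → X} {D : Θ → Θ →L[ℝ] X}
    (hD : ∀ m ∈ B, HasStrictFDerivAt T (D m) m) :
    ∃ L, 0 ≤ L ∧ ∀ m ∈ B, ∀ m' ∈ B, ‖T m - T m'‖ ≤ L * ‖m - m'‖ := by
  have : LocallyLipschitzOn B T := fun m hm => by
    obtain ⟨K, s, hs, h⟩ := (hD m hm).exists_lipschitzOnWith
    exact ⟨K, s, mem_nhdsWithin_of_mem_nhds hs, h⟩
  obtain ⟨K, hK⟩ := this.exists_lipschitzOnWith_of_compact hB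
  exact ⟨K, K.2, fun m hm m' hm' => hK.norm_sub_le hm hm'⟩

/-- Uniform version of `norm_sub_le_of_mem_highSpan`: on the compact set `B` the norms of `T m` are
bounded and `T` is Lipschitz, and `T m (u - v) = (T m u - T m' v) - (T m - T m') v`. -/
theorem exists_norm_sub_le_of_mem_highSpan {β : ℝ} (hβ : 0 < β) {B : Set Θ} (hB : IsCompact B)
    {T : Θ → 𝓗 →L[ℝ] 𝓛} {D : Θ → Θ →L[ℝ] 𝓗 →L[ℝ] 𝓛} (hc : ∀ m, IsCompactOperator (T m))
    (hD : ∀ m ∈ B, HasStrictFDerivAt T (D m) m) :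
    ∃ K, 0 ≤ K ∧ ∀ m ∈ B, ∀ m' ∈ B, ∀ u ∈ highSpan (T m) β, ∀ v ∈ highSpan (T m') β,
      ‖u - v‖ ≤ K * (‖T m u - T m' v‖ + ‖m - m'‖ * ‖v‖) := by
  obtain ⟨L, hL0, hL⟩ := exists_norm_sub_le_of_hasStrictFDerivAt hB hD
  obtain ⟨M, hM⟩ := hB.exists_bound_of_continuousOn (f := T)
    fun m hm => (hD m hm).continuousAt.continuousWithinAt
  rcases B.eq_empty_or_nonempty with rfl | ⟨m₀, hm₀⟩
  · exact ⟨0, le_rfl, fun m hm => absurd hm (Set.notMem_empty m)⟩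
  have hM0 : 0 ≤ M := (norm_nonneg _).trans (hM m₀ hm₀)
  set a := 2 / β
  set b := (2 / β * M + 1) * (4 * M / β ^ 2)
  have ha : 0 ≤ a := by positivity
  have hb : 0 ≤ b := by positivity
  refine ⟨a + (a + b) * L, by positivity, fun m hm m' hm' u hu v hv => ?_⟩
  have h1 := norm_sub_le_of_mem_highSpan hβ (T m) (T m') (hc m) (hM m hm) (hM m' hm') hu hv
  have h2 : ‖(T m - T m') v‖ ≤ L * ‖m - m'‖ * ‖v‖ := (T m - T m').le_of_opNorm_le (hL m hm m' hm') v
  have h3 : T m (u - v) = (T m u - T m' v) - (T m - T m') v := by simp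
  have h4 : ‖T m (u - v)‖ ≤ ‖T m u - T m' v‖ + L * ‖m - m'‖ * ‖v‖ := by
    rw [h3]; exact (norm_sub_le _ _).trans (by gcongr)
  have h5 : ‖T m - T m'‖ * ‖v‖ ≤ L * ‖m - m'‖ * ‖v‖ := by gcongr; exact hL m hm m' hm'
  calc ‖u - v‖ ≤ a * (‖T m u - T m' v‖ + L * ‖m - m'‖ * ‖v‖) + b * (L * ‖m - m'‖ * ‖v‖) :=
        h1.trans (by gcongr)
    _ = a * ‖T m u - T m' v‖ + (a + b) * L * (‖m - m'‖ * ‖v‖) := by ring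
    _ ≤ _ := by
        have e1 : 0 ≤ (a + b) * L * ‖T m u - T m' v‖ := by positivity
        have e2 : 0 ≤ a * (‖m - m'‖ * ‖v‖) := by positivity
        linarith

omit [CompleteSpace 𝓗] in
-- A directional derivative is a norm limit of difference quotients, which are compact.
theorem isCompactOperator_fderiv {T : Θ → 𝓗 →L[ℝ] 𝓛} {T' : Θ →L[ℝ] 𝓗 →L[ℝ] 𝓛} {m : Θ}
    (hc : ∀ m, IsCompactOperator (T m)) (hD : HasFDerivAt T T' m) (q : Θ) :
    IsCompactOperator (T' q) := by
  have h := hD.hasLineDerivAt q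
  have h2 := hasDerivAt_iff_tendsto_slope_zero.1 h
  refine isCompactOperator_of_tendsto h2 (Eventually.of_forall fun t => ?_)
  exact ((hc _).sub (hc _)).smul _

/-- Argument by contradiction and compactness: the weak limit of the `v n` is nonzero because of
`A₁`, and the first-order expansion of a counterexample contradicts the second uniqueness
assumption. -/
theorem exists_stability_constant {β : ℝ} (hβ : 0 < β) {B : Set Θ} [FiniteDimensional ℝ Θ]
    (hB : IsCompact B)
    {T : Θ → 𝓗 →L[ℝ] 𝓛} {D : Θ → Θ →L[ℝ] 𝓗 →L[ℝ] 𝓛} (hc : ∀ m, IsCompactOperator (T m))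
    (hD : ∀ m ∈ B, HasStrictFDerivAt T (D m) m)
    (hU₁ : ∀ m₁ ∈ B, ∀ m₂ ∈ B, ∀ u v : 𝓗, T m₁ u = T m₂ v → (u ≠ 0 ∨ v ≠ 0) → m₁ = m₂ ∧ u = v)
    (hU₂ : ∀ q : Θ, ‖q‖ = 1 → ∀ m ∈ B, ∀ u v : 𝓗, D m q u = T m v → u = 0 ∧ v = 0)
    {A₁ : ℝ} (hA₁ : 0 < A₁) (A₂ : ℝ) :
    ∃ C, 0 < C ∧ ∀ m ∈ B, ∀ m' ∈ B, ∀ u ∈ highSpan (T m) β, ∀ v ∈ highSpan (T m') β,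
      A₁ ≤ ‖T m' v‖ → ‖v‖ ≤ A₂ → C * ‖m - m'‖ ≤ ‖T m u - T m' v‖ := by
  by_contra! hcon
  choose m hm m' hm' u hu v hv hv1 hv2 hlt using
    fun n : ℕ => hcon (1 / ((n : ℝ) + 1)) Nat.one_div_pos_of_nat
  obtain ⟨L, hL0, hL⟩ := exists_norm_sub_le_of_hasStrictFDerivAt hB hD
  obtain ⟨K, hK0, hK⟩ := exists_norm_sub_le_of_mem_highSpan hβ hB hc hD
  obtain ⟨M, hM⟩ := hB.exists_bound_of_continuousOn (f := T)
    fun m hm => (hD m hm).continuousAt.continuousWithinAt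
  have hA₂ : 0 ≤ A₂ := (norm_nonneg _).trans (hv2 0)
  -- The violated inequality is strict, so `m n = m' n` would require a negative norm.
  have hδ : ∀ n, 0 < ‖m n - m' n‖ := fun n => by
    rcases (norm_nonneg (m n - m' n)).eq_or_lt with h | h
    · have := hlt n
      rw [← h, mul_zero] at this
      exact absurd this (not_lt.2 (norm_nonneg _))
    · exact h
  have hsmall : ∀ n, ‖T (m n) (u n) - T (m' n) (v n)‖ ≤ 1 / ((n : ℝ) + 1) * ‖m n - m' n‖ :=
    fun n => (hlt n).le
  have h1n : ∀ n : ℕ, 1 / ((n : ℝ) + 1) ≤ 1 := fun n => by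
    rw [div_le_one (by positivity)]; linarith [n.cast_nonneg (α := ℝ)]
  have hsmall' : ∀ n, ‖T (m n) (u n) - T (m' n) (v n)‖ ≤ ‖m n - m' n‖ := fun n =>
    (hsmall n).trans (mul_le_of_le_one_left (norm_nonneg _) (h1n n))
  have hwb : ∀ n, ‖u n - v n‖ ≤ K * (1 + A₂) * ‖m n - m' n‖ := fun n => by
    refine (hK _ (hm n) _ (hm' n) _ (hu n) _ (hv n)).trans ?_
    have : ‖m n - m' n‖ * ‖v n‖ ≤ ‖m n - m' n‖ * A₂ := by gcongr; exact hv2 n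
    rw [mul_assoc]
    gcongr
    linarith [hsmall' n]
  obtain ⟨R, hR⟩ : ∃ R, ∀ n, ‖m n - m' n‖ ≤ R := by
    obtain ⟨R, hR⟩ := hB.isBounded.exists_norm_le
    exact ⟨R + R, fun n => (norm_sub_le _ _).trans (add_le_add (hR _ (hm n)) (hR _ (hm' n)))⟩
  -- A nonprincipal ultrafilter provides all limits at once, without successive subsequences.
  set 𝒰 : Ultrafilter ℕ := hyperfilter ℕ
  have h𝒰 : Tendsto (fun n : ℕ => 1 / ((n : ℝ) + 1)) 𝒰 (𝓝 0) :=
    tendsto_one_div_add_atTop_nhds_zero_nat.mono_left Nat.hyperfilter_le_atTop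
  obtain ⟨a, haB, ha⟩ := Ultrafilter.exists_tendsto_of_forall_mem 𝒰 hB hm
  obtain ⟨a', haB', ha'⟩ := Ultrafilter.exists_tendsto_of_forall_mem 𝒰 hB hm'
  set w : ℕ → 𝓗 := fun n => ‖m n - m' n‖⁻¹ • (u n - v n)
  have hw : ∀ n, ‖w n‖ ≤ K * (1 + A₂) := fun n => by
    rw [norm_smul, norm_inv, norm_norm, inv_mul_le_iff₀ (hδ n), mul_comm]
    exact hwb n
  have hub : ∀ n, ‖u n‖ ≤ A₂ + K * (1 + A₂) * R := fun n => by
    have h1 : ‖u n‖ ≤ ‖u n - v n‖ + ‖v n‖ := by simpa using norm_add_le (u n - v n) (v n)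
    have h2 : K * (1 + A₂) * ‖m n - m' n‖ ≤ K * (1 + A₂) * R := by gcongr; exact hR n
    linarith [hwb n, hv2 n]
  obtain ⟨u₀, hu₀⟩ := exists_weak_limit 𝒰 hub
  obtain ⟨v₀, hv₀⟩ := exists_weak_limit 𝒰 hv2
  obtain ⟨w₀, hw₀⟩ := exists_weak_limit 𝒰 hw
  have hTa : Tendsto (fun n => T (m n)) 𝒰 (𝓝 (T a)) := (hD a haB).continuousAt.tendsto.comp ha
  have hTa' : Tendsto (fun n => T (m' n)) 𝒰 (𝓝 (T a')) :=
    (hD a' haB').continuousAt.tendsto.comp ha'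
  have hTu := tendsto_apply_of_weak (hc a) hTa hub hu₀
  have hTv := tendsto_apply_of_weak (hc a') hTa' hv2 hv₀
  have hTw := tendsto_apply_of_weak (hc a) hTa hw hw₀
  have hquot : Tendsto (fun n => ‖m n - m' n‖⁻¹ • (T (m n) (u n) - T (m' n) (v n))) 𝒰 (𝓝 0) := by
    refine squeeze_zero_norm (fun n => ?_) h𝒰
    rw [norm_smul, norm_inv, norm_norm, inv_mul_le_iff₀ (hδ n), mul_comm]
    exact hsmall n
  have hdiff : Tendsto (fun n => T (m n) (u n) - T (m' n) (v n)) 𝒰 (𝓝 0) := by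
    refine squeeze_zero_norm (a := fun n : ℕ => 1 / ((n : ℝ) + 1) * R)
      (fun n => (hsmall n).trans ?_) (by simpa using h𝒰.mul_const R)
    gcongr
    exact hR n
  have hlim : T a u₀ = T a' v₀ :=
    sub_eq_zero.1 (tendsto_nhds_unique (hTu.sub hTv) hdiff)
  -- The operators turn weak into strong convergence, so the lower bound `A₁` survives in the limit.
  have hv₀ne : v₀ ≠ 0 := by
    rintro rfl
    have h := ge_of_tendsto hTv.norm (Eventually.of_forall hv1)
    rw [map_zero, norm_zero] at h
    exact absurd hA₁ (not_lt.2 h)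
  obtain ⟨rfl, -⟩ := hU₁ a haB a' haB' u₀ v₀ hlim (Or.inr hv₀ne)
  obtain ⟨q, hq, hqlim⟩ := Ultrafilter.exists_tendsto_of_forall_mem 𝒰 (isCompact_sphere (0 : Θ) 1)
    (x := fun n => ‖m n - m' n‖⁻¹ • (m n - m' n)) (fun n => by
      rw [mem_sphere_zero_iff_norm, norm_smul, norm_inv, norm_norm, inv_mul_cancel₀ (hδ n).ne'])
  -- Both endpoints move towards `a`, so strict differentiability is what applies here.
  have hE : Tendsto (fun n => ‖m n - m' n‖⁻¹ • (T (m n) - T (m' n))) 𝒰 (𝓝 (D a q)) := by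
    have h1 := (hD a haB).isLittleO.comp_tendsto (ha.prodMk_nhds ha')
    have h2 : Tendsto (fun n => ‖m n - m' n‖⁻¹ •
        (T (m n) - T (m' n) - D a (m n - m' n))) 𝒰 (𝓝 0) := by
      refine tendsto_zero_iff_norm_tendsto_zero.2 ?_
      have h3 := h1.norm_norm.tendsto_div_nhds_zero
      refine h3.congr fun n => ?_
      simp only [Function.comp, norm_smul, norm_inv, norm_norm]
      rw [div_eq_inv_mul]
    have h4 := h2.add (((D a).continuous.tendsto q).comp hqlim)
    rw [zero_add] at h4
    refine h4.congr fun n => ?_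
    simp only [Function.comp]
    rw [map_smul, ← smul_add, sub_add_cancel]
  have hDv := tendsto_apply_of_weak (isCompactOperator_fderiv hc (hD a haB).hasFDerivAt q) hE hv2 hv₀
  -- Limit of `T m (u - v) / δ + ((T m - T m') / δ) v = (T m u - T m' v) / δ`, whose right side
  -- tends to zero.
  have hsum : T a w₀ + D a q v₀ = 0 := by
    refine tendsto_nhds_unique (hTw.add hDv) (hquot.congr fun n => ?_)
    simp only [w, map_smul, ← smul_add, map_sub, smul_apply,
      sub_apply]
    congr 1
    abel
  refine hv₀ne (hU₂ q (mem_sphere_zero_iff_norm.1 hq) a haB v₀ (-w₀) ?_).1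
  rw [map_neg]
  exact eq_neg_of_add_eq_zero_right hsum

end Stability

/-! ### Differentiable families of functions as maps into `C(K, E)` -/

section ParametricMaps

variable {Θ K E : Type*} [NormedAddCommGroup Θ] [NormedSpace ℝ Θ] [TopologicalSpace K]
  [CompactSpace K] [NormedAddCommGroup E] [NormedSpace ℝ E]

open Classical in
/-- A function as a continuous map; the zero map if the function is not continuous. -/
def toContinuousMap (g : K → E) : C(K, E) := if h : Continuous g then ⟨g, h⟩ else 0

omit [CompactSpace K] [NormedSpace ℝ E] in
theorem toContinuousMap_apply {g : K → E} (hg : Continuous g) (k : K) :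
    toContinuousMap g k = g k := by
  simp [toContinuousMap, hg]

/-- The derivative in the parameter of a family of functions on `K`. -/
abbrev paramDeriv (G : Θ → K → E) (m : Θ) (k : K) : Θ →L[ℝ] E := fderiv ℝ (fun m' => G m' k) m

variable {G : Θ → K → E} {B' : Set Θ}

omit [CompactSpace K] in
-- The kernel is assumed continuous for `m ∈ B` only, whereas differentiation needs a neighborhood.
-- Continuity spreads along segments: the derivative of `ζ ↦ G ζ k - G ζ k₀` is uniformly small on
-- the compact segment for `k` near `k₀`, and the mean value inequality applies.
theorem continuous_of_segment_subset (hdiff : ∀ m ∈ B', ∀ k, DifferentiableAt ℝ (fun m' => G m' k) m)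
    (hcont : ContinuousOn (fun z : Θ × K => paramDeriv G z.1 z.2) (B' ×ˢ univ)) (hB' : IsOpen B')
    {m m' : Θ} (hseg : segment ℝ m m' ⊆ B') (hm : Continuous (G m)) : Continuous (G m') := by
  refine continuous_iff_continuousAt.2 fun k₀ => Metric.continuousAt_iff'.2 fun ε hε => ?_
  -- The summand `1` covers `m' = m`; the increment along the segment is then less than `ε / 2`.
  have hη : 0 < ε / 2 / (‖m' - m‖ + 1) := by positivity
  set η := ε / 2 / (‖m' - m‖ + 1)
  have hsegc : IsCompact (segment ℝ m m') := by
    rw [segment_eq_image ℝ m m']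
    exact isCompact_Icc.image (by fun_prop)
  have hu : ∀ᶠ k in 𝓝 k₀, ∀ ζ ∈ segment ℝ m m',
      ‖paramDeriv G ζ k - paramDeriv G ζ k₀‖ ≤ η := by
    refine hsegc.eventually_forall_of_forall_eventually fun ζ hζ => ?_
    have hc : ContinuousAt (fun z : Θ × K => paramDeriv G z.1 z.2) (ζ, k₀) :=
      hcont.continuousAt (prod_mem_nhds (hB'.mem_nhds (hseg hζ)) univ_mem)
    have h1 : Tendsto (fun z : K × Θ => paramDeriv G z.2 z.1 - paramDeriv G z.2 k₀) (𝓝 (k₀, ζ))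
        (𝓝 0) := by
      have e1 : Tendsto (fun z : K × Θ => paramDeriv G z.2 z.1) (𝓝 (k₀, ζ))
          (𝓝 (paramDeriv G ζ k₀)) :=
        hc.tendsto.comp (Continuous.tendsto' (by fun_prop : Continuous fun z : K × Θ => (z.2, z.1))
          _ _ rfl)
      have e2 : Tendsto (fun z : K × Θ => paramDeriv G z.2 k₀) (𝓝 (k₀, ζ))
          (𝓝 (paramDeriv G ζ k₀)) :=
        hc.tendsto.comp (Continuous.tendsto' (by fun_prop : Continuous fun z : K × Θ => (z.2, k₀))
          _ _ rfl)
      simpa using e1.sub e2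
    filter_upwards [h1.norm.eventually (ge_mem_nhds (by simpa using hη))] with z hz using hz
  filter_upwards [hu, Metric.continuousAt_iff'.1 hm.continuousAt (ε / 2) (half_pos hε)] with k h1 h2
  have h3 := (convex_segment m m').norm_image_sub_le_of_norm_fderiv_le (𝕜 := ℝ)
    (f := fun ζ => G ζ k - G ζ k₀) (C := η)
    (fun ζ hζ => (hdiff ζ (hseg hζ) k).sub (hdiff ζ (hseg hζ) k₀))
    (fun ζ hζ => by
      rw [fderiv_fun_sub (hdiff ζ (hseg hζ) k) (hdiff ζ (hseg hζ) k₀)]; exact h1 ζ hζ)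
    (left_mem_segment ℝ m m') (right_mem_segment ℝ m m')
  rw [dist_eq_norm] at h2 ⊢
  have h4 : η * ‖m' - m‖ < ε / 2 := by
    have : ε / 2 = η * (‖m' - m‖ + 1) := by simp only [η]; field_simp
    nlinarith
  have h5 : G m' k - G m' k₀ = (G m' k - G m' k₀ - (G m k - G m k₀)) + (G m k - G m k₀) := by abel
  rw [h5]
  refine (norm_add_le _ _).trans_lt ?_
  linarith

/-- Compactness of `K` makes joint continuity uniform in `k`. -/
theorem eventually_norm_paramDeriv_sub_le
    (hcont : ContinuousOn (fun z : Θ × K => paramDeriv G z.1 z.2) (B' ×ˢ univ)) (hB' : IsOpen B')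
    {m : Θ} (hmB : m ∈ B') {ε : ℝ} (hε : 0 < ε) :
    ∀ᶠ ζ in 𝓝 m, ∀ k, ‖paramDeriv G ζ k - paramDeriv G m k‖ ≤ ε := by
  have : ∀ᶠ ζ in 𝓝 m, ∀ k ∈ (univ : Set K), ‖paramDeriv G ζ k - paramDeriv G m k‖ ≤ ε := by
    refine isCompact_univ.eventually_forall_of_forall_eventually fun k _ => ?_
    have hc : ContinuousAt (fun z : Θ × K => paramDeriv G z.1 z.2) (m, k) :=
      hcont.continuousAt (prod_mem_nhds (hB'.mem_nhds hmB) univ_mem)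
    have e2 : Tendsto (fun z : Θ × K => paramDeriv G m z.2) (𝓝 (m, k))
          (𝓝 (paramDeriv G m k)) :=
        hc.tendsto.comp (Continuous.tendsto' (by fun_prop : Continuous fun z : Θ × K => (m, z.2))
          _ _ rfl)
    have h1 := hc.tendsto.sub e2
    rw [sub_self] at h1
    filter_upwards [h1.norm.eventually (ge_mem_nhds (by simpa using hε))] with z hz using hz
  filter_upwards [this] with ζ hζ k using hζ k trivial

/-- Differentiation of a family of continuous functions, as a map into `C(K, E)`. -/
theorem exists_hasStrictFDerivAt_toContinuousMap
    (hdiff : ∀ m ∈ B', ∀ k, DifferentiableAt ℝ (fun m' => G m' k) m)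
    (hcont : ContinuousOn (fun z : Θ × K => paramDeriv G z.1 z.2) (B' ×ˢ univ)) (hB' : IsOpen B')
    {m : Θ} (hmB : m ∈ B') (hm : Continuous (G m)) :
    (∀ᶠ m' in 𝓝 m, Continuous (G m')) ∧ ∃ D : Θ →L[ℝ] C(K, E),
      HasStrictFDerivAt (fun m' => toContinuousMap (G m')) D m ∧
        ∀ q k, D q k = paramDeriv G m k q := by
  have hnhds : ∀ᶠ m' in 𝓝 m, Continuous (G m') := by
    obtain ⟨r, hr, hrB⟩ := Metric.isOpen_iff.1 hB' m hmB
    filter_upwards [Metric.ball_mem_nhds m hr] with m' hm'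
    exact continuous_of_segment_subset hdiff hcont hB'
      (((convex_ball m r).segment_subset (Metric.mem_ball_self hr) hm').trans hrB) hm
  refine ⟨hnhds, ?_⟩
  have hc : Continuous (paramDeriv G m) := by
    have := hcont.comp_continuous (f := fun k : K => (m, k)) (by fun_prop)
      (fun k => ⟨hmB, trivial⟩)
    exact this
  let F : C(K, Θ →L[ℝ] E) := ⟨paramDeriv G m, hc⟩
  let D : Θ →L[ℝ] C(K, E) := LinearMap.mkContinuous
    { toFun := fun q => ⟨fun k => F k q, by fun_prop⟩
      map_add' := fun a b => by ext k; simp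
      map_smul' := fun c a => by ext k; simp } ‖F‖ (fun q =>
        (ContinuousMap.norm_le _ (by positivity)).2 fun k =>
          (F k).le_of_opNorm_le (F.norm_coe_le_norm k) q)
  refine ⟨D, .of_isLittleO (Asymptotics.isLittleO_iff.2 fun ε hε => ?_), fun q k => rfl⟩
  obtain ⟨r, hr, hball⟩ := Metric.eventually_nhds_iff_ball.1
    ((hnhds.and (eventually_norm_paramDeriv_sub_le hcont hB' hmB hε)).and
      (hB'.mem_nhds hmB))
  have : ∀ᶠ z : Θ × Θ in 𝓝 (m, m), z.1 ∈ Metric.ball m r ∧ z.2 ∈ Metric.ball m r :=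
    prod_mem_nhds (Metric.ball_mem_nhds m hr) (Metric.ball_mem_nhds m hr)
  filter_upwards [this] with z hz
  refine (ContinuousMap.norm_le _ (by positivity)).2 fun k => ?_
  rw [ContinuousMap.sub_apply, ContinuousMap.sub_apply, toContinuousMap_apply (hball _ hz.1).1.1,
    toContinuousMap_apply (hball _ hz.2).1.1]
  -- On the ball every derivative is within `ε` of the one at `m`. The mean value inequality between
  -- two arbitrary points of it is the strict differentiability estimate, uniformly in `k`.
  exact (convex_ball m r).norm_image_sub_le_of_norm_fderiv_le' (𝕜 := ℝ) (f := fun ζ => G ζ k)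
    (fun ζ hζ => hdiff ζ (hball ζ hζ).2 k) (fun ζ hζ => (hball ζ hζ).1.2 k) hz.2 hz.1

end ParametricMaps

/-! ### Integral operators with continuous kernels -/

section KernelOperators

variable {X Y E : Type*} [TopologicalSpace X] [CompactSpace X] [TopologicalSpace Y]
  [CompactSpace Y] [SecondCountableTopology Y] [MeasurableSpace Y] [BorelSpace Y]
  (ν : Measure Y) [IsFiniteMeasure ν] [NormedAddCommGroup E] [NormedSpace ℝ E]

/-- The constant in the inequality between the norms of `L¹` and `L²`. -/
def lpConst : ℝ := (ν univ ^ (1 / (1 : ENNReal).toReal - 1 / (2 : ENNReal).toReal)).toReal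

theorem lpConst_nonneg : 0 ≤ lpConst ν := ENNReal.toReal_nonneg

theorem integral_norm_le_lpConst_mul (u : Lp ℝ 2 ν) : ∫ y, ‖u y‖ ∂ν ≤ lpConst ν * ‖u‖ := by
  have h := eLpNorm_le_eLpNorm_mul_rpow_measure_univ (p := 1) (q := 2) (μ := ν) (by norm_num)
    (Lp.aestronglyMeasurable u)
  rw [integral_norm_eq_lintegral_enorm (Lp.aestronglyMeasurable u), ← eLpNorm_one_eq_lintegral_enorm,
    Lp.norm_def, lpConst, mul_comm, ← ENNReal.toReal_mul]
  refine ENNReal.toReal_mono (ENNReal.mul_ne_top (Lp.eLpNorm_ne_top u) ?_) h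
  exact ENNReal.rpow_ne_top_of_nonneg (by norm_num) (measure_ne_top ν univ)

theorem integrable_smul_of_continuous (u : Lp ℝ 2 ν) (g : C(Y, E)) :
    Integrable (fun y => u y • g y) ν :=
  Integrable.smul_bdd ((Lp.memLp u).integrable (by norm_num)) ‖g‖
    g.continuous.aestronglyMeasurable (Eventually.of_forall fun y => g.norm_coe_le_norm y)

theorem norm_integral_smul_le (u : Lp ℝ 2 ν) (g : C(Y, E)) :
    ‖∫ y, u y • g y ∂ν‖ ≤ lpConst ν * ‖u‖ * ‖g‖ := by
  calc ‖∫ y, u y • g y ∂ν‖ ≤ ∫ y, ‖u y‖ * ‖g‖ ∂ν := by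
        refine norm_integral_le_of_norm_le
          (((Lp.memLp u).integrable (by norm_num)).norm.mul_const _)
          (Eventually.of_forall fun y => ?_)
        rw [norm_smul]
        gcongr
        exact g.norm_coe_le_norm y
    _ = (∫ y, ‖u y‖ ∂ν) * ‖g‖ := integral_mul_const _ _
    _ ≤ _ := by gcongr; exact integral_norm_le_lpConst_mul ν u

variable (X Y E) in
/-- The functional `g ↦ ∫ u g` on `C(Y, E)`, for `u` in `L²`. -/
def integralPairing : Lp ℝ 2 ν →L[ℝ] C(Y, E) →L[ℝ] E :=
  LinearMap.mkContinuous₂ (LinearMap.mk₂ ℝ (fun (u : Lp ℝ 2 ν) (g : C(Y, E)) => ∫ y, u y • g y ∂ν)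
    (fun u v g => by
      rw [← integral_add (integrable_smul_of_continuous ν u g) (integrable_smul_of_continuous ν v g)]
      refine integral_congr_ae ?_
      filter_upwards [Lp.coeFn_add u v] with y hy
      rw [hy, Pi.add_apply, add_smul])
    (fun c u g => by
      rw [← integral_smul]
      refine integral_congr_ae ?_
      filter_upwards [Lp.coeFn_smul c u] with y hy
      rw [hy, Pi.smul_apply, smul_assoc])
    (fun u g h => by
      rw [← integral_add (integrable_smul_of_continuous ν u g) (integrable_smul_of_continuous ν u h)]
      simp only [ContinuousMap.add_apply, smul_add])
    (fun c u g => by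
      rw [← integral_smul]
      simp only [ContinuousMap.smul_apply, smul_comm c]))
    (lpConst ν) (norm_integral_smul_le ν)

variable (X Y E) in
/-- The operator `u ↦ ∫ u(y) κ(·, y)` with a continuous kernel `κ`. -/
def kernelOp : C(X × Y, E) →L[ℝ] Lp ℝ 2 ν →L[ℝ] C(X, E) :=
  LinearMap.mkContinuous₂ (LinearMap.mk₂ ℝ (fun (κ : C(X × Y, E)) (u : Lp ℝ 2 ν) =>
      ((integralPairing Y E ν u : C(C(Y, E), E)).comp κ.curry : C(X, E)))
    (fun κ κ' u => by
      ext x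
      have : (κ + κ').curry x = κ.curry x + κ'.curry x := rfl
      simp [this])
    (fun c κ u => by
      ext x
      have : (c • κ).curry x = c • κ.curry x := rfl
      simp [this])
    (fun κ u v => by ext x; simp)
    (fun c κ u => by ext x; simp))
    (lpConst ν) (fun κ u => by
      have := lpConst_nonneg ν
      refine (ContinuousMap.norm_le _ (by positivity)).2 fun x => ?_
      refine (norm_integral_smul_le ν u (κ.curry x)).trans ?_
      have h : ‖κ.curry x‖ ≤ ‖κ‖ :=
        (ContinuousMap.norm_le _ (norm_nonneg _)).2 fun y => κ.norm_coe_le_norm (x, y)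
      calc lpConst ν * ‖u‖ * ‖κ.curry x‖ ≤ lpConst ν * ‖u‖ * ‖κ‖ := by gcongr
        _ = _ := by ring)

theorem kernelOp_apply (κ : C(X × Y, E)) (u : Lp ℝ 2 ν) (x : X) :
    kernelOp X Y E ν κ u x = ∫ y, u y • κ (x, y) ∂ν := rfl

theorem kernelOp_apply' (κ : C(X × Y, E)) (u : Lp ℝ 2 ν) (x : X) :
    kernelOp X Y E ν κ u x = integralPairing Y E ν u (κ.curry x) := rfl

/-- Arzelà–Ascoli: the images of the unit ball are bounded, and they are equicontinuous because `x ↦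
κ(x, ·)` is continuous into `C(Y)`. -/
theorem isCompactOperator_kernelOp (κ : C(X × Y, ℝ)) :
    IsCompactOperator (kernelOp X Y ℝ ν κ) := by
  set T := kernelOp X Y ℝ ν κ
  let e := ContinuousMap.isometryEquivBoundedOfCompact X ℝ
  let A : Set (BoundedContinuousFunction X ℝ) := e '' (T '' Metric.ball 0 1)
  have hA : IsCompact (closure A) := by
    refine BoundedContinuousFunction.arzela_ascoli (Metric.closedBall 0 ‖T‖)
      (isCompact_closedBall _ _) A ?_ ?_
    · rintro _ x ⟨_, ⟨u, hu, rfl⟩, rfl⟩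
      rw [mem_closedBall_zero_iff]
      change ‖T u x‖ ≤ ‖T‖
      refine ((T u).norm_coe_le_norm x).trans ?_
      exact (T.le_opNorm_of_le (mem_ball_zero_iff.1 hu).le).trans_eq (mul_one _)
    · intro x₀
      refine Metric.equicontinuousAt_iff_right.2 fun ε hε => ?_
      have hc : Tendsto (fun x => ‖integralPairing Y ℝ ν‖ * ‖κ.curry x₀ - κ.curry x‖) (𝓝 x₀)
          (𝓝 0) := by
        refine Continuous.tendsto' (by fun_prop) _ _ (by simp)
      filter_upwards [hc.eventually (gt_mem_nhds hε)] with x hx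
      rintro ⟨_, ⟨_, ⟨u, hu, rfl⟩, rfl⟩⟩
      change dist (T u x₀) (T u x) < ε
      rw [dist_eq_norm, kernelOp_apply', kernelOp_apply', ← map_sub]
      refine lt_of_le_of_lt ?_ hx
      refine ((integralPairing Y ℝ ν).le_opNorm₂ u _).trans ?_
      gcongr
      exact mul_le_of_le_one_right (by positivity) (mem_ball_zero_iff.1 hu).le
  refine (isCompactOperator_iff_exists_mem_nhds_image_subset_compact _).2
    ⟨Metric.ball 0 1, Metric.ball_mem_nhds _ one_pos, e.symm '' closure A,
      hA.image e.symm.continuous, ?_⟩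
  intro f hf
  exact ⟨e f, subset_closure ⟨f, hf, rfl⟩, e.symm_apply_apply f⟩

end KernelOperators

/-! ### Calculus of the surface gradient -/

section SurfaceGradient

variable {d : ℕ} {R : Set (Euc d)} {f g : Euc d → ℝ} {x : Euc d}

theorem surfGrad_mem_tangentSpan : surfGrad R f x ∈ tangentSpan R x :=
  Submodule.starProjection_apply_mem _ _

/-- Two derivatives within `R` agree on the tangent cone, so their difference is normal and is
removed by the projection. Any derivative may thus replace the choice made by `fderivWithin`. -/
theorem surfGrad_eq_of_hasFDerivWithinAt {f' : Euc d →L[ℝ] ℝ} (h : HasFDerivWithinAt f f' R x) :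
    surfGrad R f x =
      (tangentSpan R x).starProjection ((InnerProductSpace.toDual ℝ (Euc d)).symm f') := by
  rw [surfGrad, ← sub_eq_zero, ← map_sub, Submodule.starProjection_apply_eq_zero_iff,
    tangentSpan]
  refine (Submodule.mem_orthogonal _ _).2 fun v hv => ?_
  induction hv using Submodule.span_induction with
  | mem v hv =>
    rw [real_inner_comm, inner_sub_left, InnerProductSpace.toDual_symm_apply,
      InnerProductSpace.toDual_symm_apply, sub_eq_zero]
    exact h.differentiableWithinAt.hasFDerivWithinAt.unique_on h hv
  | zero => exact inner_zero_left _
  | add a b _ _ ha hb => rw [inner_add_left, ha, hb, add_zero]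
  | smul c a _ ha => rw [inner_smul_left, ha, mul_zero]

theorem surfGrad_eq_of_hasFDerivWithinAt_inner {a : Euc d} (ha : a ∈ tangentSpan R x)
    (h : HasFDerivWithinAt f (innerSL ℝ a) R x) : surfGrad R f x = a := by
  rw [surfGrad_eq_of_hasFDerivWithinAt h]
  have : (InnerProductSpace.toDual ℝ (Euc d)).symm (innerSL ℝ a) = a :=
    (InnerProductSpace.toDual ℝ (Euc d)).symm_apply_apply a
  rw [this, Submodule.starProjection_eq_self_iff.2 ha]

/-- Otherwise, along an ultrafilter of counterexamples, the normalized displacements converge to a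
tangent vector while their normal components stay above `ε`. No regularity of `R` is involved. -/
theorem isLittleO_sub_starProjection_tangentSpan :
    (fun y => y - x - (tangentSpan R x).starProjection (y - x)) =o[𝓝[R] x] fun y => y - x := by
  refine Asymptotics.isLittleO_iff.2 fun ε hε => ?_
  by_contra hcon
  have := Filter.frequently_iff_neBot.1 (Filter.not_eventually.1 hcon)
  obtain ⟨𝒰, h𝒰⟩ := Ultrafilter.exists_le (𝓝[R] x ⊓ 𝓟 {y |
    ¬‖y - x - (tangentSpan R x).starProjection (y - x)‖ ≤ ε * ‖y - x‖})
  have h1 : (𝒰 : Filter (Euc d)) ≤ 𝓝[R] x := h𝒰.trans inf_le_left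
  have h2 : ∀ᶠ y in 𝒰, ε * ‖y - x‖ < ‖y - x - (tangentSpan R x).starProjection (y - x)‖ := by
    filter_upwards [h𝒰 (mem_inf_of_right (mem_principal_self _))] with y hy using not_le.1 hy
  have hne : ∀ᶠ y in 𝒰, y - x ≠ 0 := by
    filter_upwards [h2] with y hy h0
    rw [h0] at hy
    simp at hy
  -- The ball rather than the sphere, because for `y = x` the quotient is `0`.
  have hunit : ∀ y, ‖y - x‖⁻¹ • (y - x) ∈ Metric.closedBall (0 : Euc d) 1 := fun y => by
    rw [mem_closedBall_zero_iff, norm_smul, norm_inv, norm_norm]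
    exact inv_mul_le_one
  obtain ⟨v, -, hv'⟩ := Ultrafilter.exists_tendsto_of_forall_mem 𝒰 (isCompact_closedBall 0 1) hunit
  have hmem : v ∈ tangentSpan R x := by
    refine Submodule.subset_span (mem_tangentConeAt_of_seq (𝒰 : Filter (Euc d))
      (fun y => ‖y - x‖⁻¹) (fun y => y - x) ?_ ?_ hv')
    · have : Tendsto (fun y => y - x) (𝓝 x) (𝓝 0) :=
        Continuous.tendsto' (by fun_prop) _ _ (sub_self x)
      exact this.mono_left (h1.trans inf_le_left)
    · filter_upwards [h1 self_mem_nhdsWithin] with y hy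
      simpa using hy
  have h3 : Tendsto (fun y => ‖‖y - x‖⁻¹ • (y - x) -
      (tangentSpan R x).starProjection (‖y - x‖⁻¹ • (y - x))‖) 𝒰
      (𝓝 ‖v - (tangentSpan R x).starProjection v‖) :=
    (hv'.sub (((tangentSpan R x).starProjection.continuous.tendsto v).comp hv')).norm
  rw [Submodule.starProjection_eq_self_iff.2 hmem, sub_self, norm_zero] at h3
  refine absurd (ge_of_tendsto h3 ?_) (not_le.2 hε)
  filter_upwards [h2, hne] with y hy hy0
  rw [map_smul, ← smul_sub, norm_smul, norm_inv, norm_norm, inv_mul_eq_div,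
    le_div_iff₀ (norm_pos_iff.2 hy0)]
  exact hy.le

/-- Projecting the derivative changes it only on normal components, which are `o(|y - x|)` within
`R`. The calculus rules below follow from those for derivatives. -/
theorem hasFDerivWithinAt_surfGrad (h : DifferentiableWithinAt ℝ f R x) :
    HasFDerivWithinAt f (innerSL ℝ (surfGrad R f x)) R x := by
  have h1 := h.hasFDerivWithinAt
  set D := fderivWithin ℝ f R x
  have hD : ∀ v, D v - inner ℝ (surfGrad R f x) v =
      D (v - (tangentSpan R x).starProjection v) := by
    intro v
    rw [map_sub, surfGrad, Submodule.inner_starProjection_left_eq_right,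
      InnerProductSpace.toDual_symm_apply]
  refine .of_isLittleO ?_
  have h2 := (D.isBigO_comp _ _).trans_isLittleO
    (isLittleO_sub_starProjection_tangentSpan (R := R) (x := x))
  refine (h1.isLittleO.add h2).congr_left fun y => ?_
  change f y - f x - D (y - x) + D _ = f y - f x - inner ℝ (surfGrad R f x) (y - x)
  rw [← hD]
  ring

theorem surfGrad_add (hf : DifferentiableWithinAt ℝ f R x) (hg : DifferentiableWithinAt ℝ g R x) :
    surfGrad R (fun y => f y + g y) x = surfGrad R f x + surfGrad R g x := by
  refine surfGrad_eq_of_hasFDerivWithinAt_inner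
    (add_mem surfGrad_mem_tangentSpan surfGrad_mem_tangentSpan) ?_
  rw [map_add]
  exact (hasFDerivWithinAt_surfGrad hf).add (hasFDerivWithinAt_surfGrad hg)

theorem surfGrad_sub (hf : DifferentiableWithinAt ℝ f R x) (hg : DifferentiableWithinAt ℝ g R x) :
    surfGrad R (fun y => f y - g y) x = surfGrad R f x - surfGrad R g x := by
  refine surfGrad_eq_of_hasFDerivWithinAt_inner
    (sub_mem surfGrad_mem_tangentSpan surfGrad_mem_tangentSpan) ?_
  rw [map_sub]
  exact (hasFDerivWithinAt_surfGrad hf).sub (hasFDerivWithinAt_surfGrad hg)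

theorem surfGrad_const_mul (c : ℝ) (hf : DifferentiableWithinAt ℝ f R x) :
    surfGrad R (fun y => c * f y) x = c • surfGrad R f x := by
  refine surfGrad_eq_of_hasFDerivWithinAt_inner
    (Submodule.smul_mem _ _ surfGrad_mem_tangentSpan) ?_
  rw [map_smul]
  exact (hasFDerivWithinAt_surfGrad hf).const_mul c

theorem surfGrad_sq (hf : DifferentiableWithinAt ℝ f R x) :
    surfGrad R (fun y => f y ^ 2) x = (2 * f x) • surfGrad R f x := by
  refine surfGrad_eq_of_hasFDerivWithinAt_inner
    (Submodule.smul_mem _ _ surfGrad_mem_tangentSpan) ?_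
  rw [map_smul]
  have := (hasFDerivWithinAt_surfGrad hf).pow 2
  simpa using this

end SurfaceGradient

/-! ### Straightenings and local Lipschitz bounds -/

section Charts

variable {d s : ℕ} {R : Set (Euc d)}

theorem convex_corner (d s : ℕ) : Convex ℝ (corner d s) := by
  intro a ha b hb α β hα hβ _ i
  refine ⟨fun hi => ?_, fun hi => ?_⟩
  · have h1 := (ha i).1 hi
    have h2 := (hb i).1 hi
    simp only [PiLp.add_apply, PiLp.smul_apply, smul_eq_mul]
    positivity
  · simp [(ha i).2 hi, (hb i).2 hi]

theorem IsStraightening.symm_mem_iff {Φ : OpenPartialHomeomorph (Euc d) (Euc d)}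
    (h : IsStraightening s R Φ) {z : Euc d} (hz : z ∈ Φ.target) :
    Φ.symm z ∈ R ↔ z ∈ corner d s := by
  rw [h.mem_iff _ (Φ.map_target hz), Φ.right_inv hz]

/-- Uniform control of a straightening and of its inverse near a point. -/
theorem IsStraightening.exists_ball {Φ : OpenPartialHomeomorph (Euc d) (Euc d)}
    (h : IsStraightening s R Φ) {x : Euc d} (hx : x ∈ Φ.source) :
    ∃ (K : NNReal) (r : ℝ), 0 < r ∧ Metric.ball (Φ x) r ⊆ Φ.target ∧
      (∀ z ∈ Metric.ball (Φ x) r, DifferentiableAt ℝ Φ.symm z ∧ ‖fderiv ℝ Φ.symm z‖ ≤ K) ∧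
      LipschitzOnWith K Φ.symm (Metric.ball (Φ x) r) ∧
      LipschitzOnWith K Φ (Φ.symm '' Metric.ball (Φ x) r) := by
  have hz : Φ x ∈ Φ.target := Φ.map_source hx
  have hsymm : ContDiffAt ℝ 1 Φ.symm (Φ x) :=
    h.contDiffOn_symm.contDiffAt (Φ.open_target.mem_nhds hz)
  have hΦ : ContDiffAt ℝ 1 Φ x := h.contDiffOn.contDiffAt (Φ.open_source.mem_nhds hx)
  obtain ⟨K₁, U₁, hU₁, hK₁⟩ := hΦ.exists_lipschitzOnWith
  have hcont : ContinuousOn (fderiv ℝ Φ.symm) Φ.target :=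
    h.contDiffOn_symm.continuousOn_fderiv_of_isOpen Φ.open_target le_rfl
  set K₂ : NNReal := ‖fderiv ℝ Φ.symm (Φ x)‖₊ + 1
  have hK₂ : ∀ᶠ z in 𝓝 (Φ x), ‖fderiv ℝ Φ.symm z‖ ≤ K₂ := by
    filter_upwards [(hcont.continuousAt (Φ.open_target.mem_nhds hz)).norm.eventually
      (ge_mem_nhds (lt_add_one _))] with z hz
    simpa [K₂] using hz
  have hpre : ∀ᶠ z in 𝓝 (Φ x), Φ.symm z ∈ U₁ := by
    have h1 : ContinuousAt Φ.symm (Φ x) := hsymm.continuousAt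
    refine h1.tendsto.eventually_mem ?_
    rwa [Φ.left_inv hx]
  obtain ⟨r, hr, hball⟩ := Metric.eventually_nhds_iff_ball.1
    ((hK₂.and hpre).and (Φ.open_target.mem_nhds hz))
  have hdiff : ∀ z ∈ Metric.ball (Φ x) r, DifferentiableAt ℝ Φ.symm z := fun z hz =>
    (h.contDiffOn_symm.contDiffAt (Φ.open_target.mem_nhds (hball z hz).2)).differentiableAt
      one_ne_zero
  refine ⟨max K₁ K₂, r, hr, fun z hz => (hball z hz).2, fun z hz => ⟨hdiff z hz,
    (hball z hz).1.1.trans (by exact_mod_cast le_max_right _ _)⟩, ?_, ?_⟩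
  · refine LipschitzOnWith.weaken ?_ (le_max_right K₁ K₂)
    exact (convex_ball _ _).lipschitzOnWith_of_nnnorm_fderiv_le hdiff
      fun z hz => (hball z hz).1.1
  · refine (hK₁.mono ?_).weaken (le_max_left _ _)
    rintro _ ⟨z, hz, rfl⟩
    exact (hball z hz).1.2

theorem symm_image_ball_mem_nhds {Φ : OpenPartialHomeomorph (Euc d) (Euc d)}
    {x : Euc d} (hx : x ∈ Φ.source) {r : ℝ} (hr : 0 < r) : Φ.symm '' Metric.ball (Φ x) r ∈ 𝓝 x := by
  have := Φ.symm.image_mem_nhds (x := Φ x) (Φ.map_source hx) (Metric.ball_mem_nhds _ hr)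
  rwa [Φ.left_inv hx] at this

/-- On a manifold, a bound of the surface gradient gives a local Lipschitz bound. -/
theorem IsCompactManifold.exists_local_lipschitz (hR : IsCompactManifold s R) {x : Euc d}
    (hx : x ∈ R) : ∃ L : ℝ, 0 ≤ L ∧ ∃ U ∈ 𝓝 x, ∀ (f : Euc d → ℝ) (G : ℝ),
      (∀ y ∈ R, DifferentiableWithinAt ℝ f R y) → (∀ y ∈ R, ‖surfGrad R f y‖ ≤ G) →
        ∀ y ∈ U ∩ R, ∀ y' ∈ U ∩ R, ‖f y' - f y‖ ≤ G * L * ‖y' - y‖ := by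
  obtain ⟨Φ, hΦ, hxs⟩ := hR.exists_chart x hx
  obtain ⟨K, r, hr, hb, hd, hL, hL'⟩ := hΦ.exists_ball hxs
  -- The mean value inequality is used on the convex set `ball ∩ corner`. One `K` bounds the
  -- derivative of the inverse chart, the other compares lengths; neither depends on `f`.
  refine ⟨K * K, by positivity, _, symm_image_ball_mem_nhds hxs hr, ?_⟩
  rintro f G hf hG _ ⟨⟨z, hz, rfl⟩, hzR⟩ _ ⟨⟨z', hz', rfl⟩, hzR'⟩
  have hG0 : 0 ≤ G := (norm_nonneg _).trans (hG x hx)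
  set S := Metric.ball (Φ x) r ∩ corner d s
  have hS : Convex ℝ S := (convex_ball _ _).inter (convex_corner d s)
  have hmaps : MapsTo Φ.symm S R := fun w hw => (hΦ.symm_mem_iff (hb hw.1)).2 hw.2
  have hder : ∀ w ∈ S, HasFDerivWithinAt (f ∘ Φ.symm)
      ((innerSL ℝ (surfGrad R f (Φ.symm w))).comp (fderiv ℝ Φ.symm w)) S w := fun w hw =>
    (hasFDerivWithinAt_surfGrad (hf _ (hmaps hw))).comp w
      (hd w hw.1).1.hasFDerivAt.hasFDerivWithinAt hmaps
  have h1 := hS.norm_image_sub_le_of_norm_hasFDerivWithin_le (C := G * K) hder (fun w hw => by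
      refine (ContinuousLinearMap.opNorm_comp_le _ _).trans ?_
      rw [innerSL_apply_norm]
      exact mul_le_mul (hG _ (hmaps hw)) (hd w hw.1).2 (norm_nonneg _) hG0)
    ⟨hz, (hΦ.symm_mem_iff (hb hz)).1 hzR⟩ ⟨hz', (hΦ.symm_mem_iff (hb hz')).1 hzR'⟩
  have h2 : ‖z' - z‖ ≤ K * ‖Φ.symm z' - Φ.symm z‖ := by
    have := hL'.norm_sub_le ⟨z', hz', rfl⟩ ⟨z, hz, rfl⟩
    rwa [Φ.right_inv (hb hz), Φ.right_inv (hb hz')] at this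
  calc _ ≤ G * K * ‖z' - z‖ := h1
    _ ≤ G * K * (K * ‖Φ.symm z' - Φ.symm z‖) := by gcongr
    _ = _ := by ring

end Charts

/-! ### The coordinate subspace `ℝˢ` of `ℝᵈ` -/

section Embedding

variable {d s : ℕ}

/-- The coordinates of the standard embedding of `ℝˢ` into `ℝᵈ`. -/
def extendZero (d : ℕ) {s : ℕ} (z : Euc s) : Euc d :=
  WithLp.toLp 2 fun i => if h : (i : ℕ) < s then z ⟨i, h⟩ else 0

theorem extendZero_apply (z : Euc s) (i : Fin d) :
    extendZero d z i = if h : (i : ℕ) < s then z ⟨i, h⟩ else 0 := rfl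

/-- The standard embedding of `ℝˢ` into `ℝᵈ`, for `s ≤ d`. -/
def embed (h : s ≤ d) : Euc s →ₗᵢ[ℝ] Euc d where
  toFun := extendZero d
  map_add' a b := by
    ext i
    simp only [PiLp.add_apply, extendZero_apply]
    split_ifs <;> simp
  map_smul' c a := by
    ext i
    simp only [PiLp.smul_apply, extendZero_apply, RingHom.id_apply]
    split_ifs <;> simp
  norm_map' z := by
    obtain ⟨k, rfl⟩ := Nat.exists_eq_add_of_le h
    change ‖extendZero (s + k) z‖ = ‖z‖
    rw [EuclideanSpace.norm_eq, EuclideanSpace.norm_eq, Fin.sum_univ_add]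
    simp [extendZero_apply]

theorem embed_apply (h : s ≤ d) (z : Euc s) (i : Fin d) :
    embed h z i = if h : (i : ℕ) < s then z ⟨i, h⟩ else 0 := rfl

theorem embed_apply_castLE (h : s ≤ d) (z : Euc s) (j : Fin s) :
    embed h z (Fin.castLE h j) = z j := by
  simp [embed_apply]

theorem embed_mem_corner_iff (h : s ≤ d) {z : Euc s} : embed h z ∈ corner d s ↔ ∀ j, 0 ≤ z j := by
  refine ⟨fun hz j => ?_, fun hz i => ⟨fun hi => ?_, fun hi => ?_⟩⟩
  · simpa [embed_apply] using (hz (Fin.castLE h j)).1 (by simp)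
  · rw [embed_apply, dif_pos hi]; exact hz _
  · rw [embed_apply, dif_neg (not_lt.2 hi)]

theorem exists_embed_eq_of_mem_corner (h : s ≤ d) {z : Euc d} (hz : z ∈ corner d s) :
    ∃ w : Euc s, embed h w = z := by
  refine ⟨WithLp.toLp 2 fun j => z (Fin.castLE h j), ?_⟩
  ext i
  rw [embed_apply]
  split_ifs with hi
  · rfl
  · exact ((hz i).2 (not_lt.1 hi)).symm

end Embedding

/-! ### Finiteness of the surface measure -/

section SurfaceMeasure

open scoped MeasureTheory NNReal ENNReal

theorem euclideanHausdorffMeasure_image_le_of_lipschitzOnWith {X Y : Type*} [EMetricSpace X]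
    [EMetricSpace Y] [MeasurableSpace X] [BorelSpace X] [MeasurableSpace Y] [BorelSpace Y]
    {K : ℝ≥0} {f : X → Y} {A : Set X} (h : LipschitzOnWith K f A) (n : ℕ) :
    μHE[n] (f '' A) ≤ (K : ℝ≥0∞) ^ n * μHE[n] A := by
  have := h.hausdorffMeasure_image_le (d := n) n.cast_nonneg
  rw [ENNReal.rpow_natCast] at this
  simp only [Measure.euclideanHausdorffMeasure_def, Measure.smul_apply]
  rw [ENNReal.smul_def, ENNReal.smul_def, smul_eq_mul, smul_eq_mul]
  calc _ ≤ _ * ((K : ℝ≥0∞) ^ n * _) := by gcongr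
    _ = _ := by ring

variable {d s : ℕ} {R : Set (Euc d)}

theorem IsCompactManifold.measurableSet (hR : IsCompactManifold s R) : MeasurableSet R :=
  hR.isCompact.measurableSet

/-- Locally `R` is contained in a Lipschitz image of a bounded subset of `ℝˢ`, where the normalized
Hausdorff measure is Lebesgue measure; compactness concludes. -/
theorem IsCompactManifold.surfaceMeasure_lt_top (hR : IsCompactManifold s R) :
    surfaceMeasure s R univ < ⊤ := by
  rw [surfaceMeasure, Measure.restrict_apply_univ]
  refine hR.isCompact.measure_lt_top_of_nhdsWithin fun x hx => ?_
  obtain ⟨Φ, hΦ, hxs⟩ := hR.exists_chart x hx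
  obtain ⟨K, r, hr, hb, hd, hL, hL'⟩ := hΦ.exists_ball hxs
  refine ⟨R ∩ Φ.symm '' Metric.ball (Φ x) r,
    inter_mem_nhdsWithin R (symm_image_ball_mem_nhds hxs hr), ?_⟩
  set A : Set (Euc s) := embed hR.dim_le ⁻¹' Metric.ball (Φ x) r
  have hsub : R ∩ Φ.symm '' Metric.ball (Φ x) r ⊆ Φ.symm '' (embed hR.dim_le '' A) := by
    rintro _ ⟨hzR, z, hz, rfl⟩
    obtain ⟨w, rfl⟩ := exists_embed_eq_of_mem_corner hR.dim_le
      ((hΦ.symm_mem_iff (hb hz)).1 hzR)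
    exact ⟨_, ⟨w, hz, rfl⟩, rfl⟩
  have hA : Bornology.IsBounded A := by
    obtain ⟨c, hc⟩ := (Metric.isBounded_ball (x := Φ x) (r := r)).exists_norm_le
    exact isBounded_iff_forall_norm_le.2 ⟨c, fun w hw => by
      rw [← (embed hR.dim_le).norm_map]; exact hc _ hw⟩
  have hL2 : LipschitzOnWith K Φ.symm (embed hR.dim_le '' A) :=
    hL.mono (by rintro _ ⟨w, hw, rfl⟩; exact hw)
  refine (measure_mono hsub).trans_lt ((euclideanHausdorffMeasure_image_le_of_lipschitzOnWith hL2 s).trans_lt ?_)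
  rw [(embed hR.dim_le).isometry.euclideanHausdorffMeasure_image,
    EuclideanSpace.euclideanHausdorffMeasure_eq_volume]
  exact ENNReal.mul_lt_top (ENNReal.pow_lt_top ENNReal.coe_lt_top) hA.measure_lt_top

end SurfaceMeasure

/-! ### Surface gradients of parametric integrals -/

section ParametricIntegral

variable {d t : ℕ} {V : Set (Euc d)} {Y : Type*} [MeasurableSpace Y] {ν : Measure Y}

/-- Differentiation under the integral sign on a manifold. -/
theorem IsCompactManifold.surfGrad_integral (hV : IsCompactManifold t V)
    {F : Euc d → Y → ℝ} {w : Y → ℝ} (hw : Integrable w ν) {G : ℝ}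
    (hF : ∀ y, ∀ x ∈ V, DifferentiableWithinAt ℝ (fun x' => F x' y) V x)
    (hG : ∀ y, ∀ x ∈ V, ‖surfGrad V (fun x' => F x' y) x‖ ≤ G)
    (hint : ∀ x ∈ V, Integrable (fun y => w y * F x y) ν) {x : Euc d} (hx : x ∈ V)
    (hmeas : AEStronglyMeasurable (fun y => surfGrad V (fun x' => F x' y) x) ν) :
    DifferentiableWithinAt ℝ (fun x' => ∫ y, w y * F x' y ∂ν) V x ∧
      surfGrad V (fun x' => ∫ y, w y * F x' y ∂ν) x =
        ∫ y, w y • surfGrad V (fun x' => F x' y) x ∂ν := by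
  obtain ⟨L, hL0, U, hU, hLip⟩ := hV.exists_local_lipschitz hx
  have hgi : Integrable (fun y => w y • surfGrad V (fun x' => F x' y) x) ν :=
    Integrable.smul_bdd hw G hmeas (Eventually.of_forall fun y => hG y x hx)
  set a := ∫ y, w y • surfGrad V (fun x' => F x' y) x ∂ν
  -- The projection commutes with the integral and fixes the integrand; tangency is what identifies
  -- `a` as the surface gradient.
  have ha : a ∈ tangentSpan V x := by
    rw [← Submodule.starProjection_eq_self_iff, ← ContinuousLinearMap.integral_comp_comm _ hgi]
    refine integral_congr_ae (Eventually.of_forall fun y => ?_)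
    change (tangentSpan V x).starProjection _ = _
    rw [map_smul, Submodule.starProjection_eq_self_iff.2 surfGrad_mem_tangentSpan]
  have hinner : ∀ v : Euc d, inner ℝ a v =
      ∫ y, w y * inner ℝ (surfGrad V (fun x' => F x' y) x) v ∂ν := by
    intro v
    rw [real_inner_comm, ← innerSL_apply_apply ℝ, ← ContinuousLinearMap.integral_comp_comm _ hgi]
    refine integral_congr_ae (Eventually.of_forall fun y => ?_)
    simp [real_inner_comm]
  have hinti : ∀ v : Euc d,
      Integrable (fun y => w y * inner ℝ (surfGrad V (fun x' => F x' y) x) v) ν := by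
    intro v
    refine ((innerSL ℝ v).integrable_comp hgi).congr (Eventually.of_forall fun y => ?_)
    simp [real_inner_comm]
  have hder : HasFDerivWithinAt (fun x' => ∫ y, w y * F x' y ∂ν) (innerSL ℝ a) V x := by
    rw [hasFDerivWithinAt_iff_tendsto]
    -- Dominated convergence for the normalized remainders. The Lipschitz constant `G * L` is
    -- uniform in `y`, and the linear term contributes the other `G`.
    have hdom : Tendsto (fun x' => ∫ y, ‖x' - x‖⁻¹ * (w y * (F x' y - F x y -
        inner ℝ (surfGrad V (fun x' => F x' y) x) (x' - x))) ∂ν) (𝓝[V] x) (𝓝 (∫ _, 0 ∂ν)) := by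
      refine tendsto_integral_filter_of_dominated_convergence
        (fun y => ‖w y‖ * (G * L + G)) ?_ ?_ (hw.norm.mul_const _) ?_
      · filter_upwards [self_mem_nhdsWithin] with x' hx'
        refine (Integrable.const_mul ?_ _).aestronglyMeasurable
        refine (((hint x' hx').sub (hint x hx)).sub (hinti (x' - x))).congr
          (Eventually.of_forall fun y => ?_)
        simp only [Pi.sub_apply]
        ring
      · filter_upwards [self_mem_nhdsWithin, mem_nhdsWithin_of_mem_nhds hU] with x' hx' hx'U
        refine Eventually.of_forall fun y => ?_
        have hG0 : 0 ≤ G := (norm_nonneg _).trans (hG y x hx)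
        rcases eq_or_ne x' x with rfl | hne
        · simp; positivity
        have hpos : 0 < ‖x' - x‖ := norm_pos_iff.2 (sub_ne_zero.2 hne)
        rw [norm_mul, norm_inv, norm_norm, inv_mul_le_iff₀ hpos, norm_mul]
        have h1 := hLip (fun x' => F x' y) G (hF y) (hG y) x ⟨mem_of_mem_nhds hU, hx⟩ x' ⟨hx'U, hx'⟩
        have h2 : ‖inner ℝ (surfGrad V (fun x' => F x' y) x) (x' - x)‖ ≤ G * ‖x' - x‖ :=
          (norm_inner_le_norm _ _).trans (by gcongr; exact hG y x hx)
        have h3 := (norm_sub_le (F x' y - F x y)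
          (inner ℝ (surfGrad V (fun x' => F x' y) x) (x' - x))).trans (add_le_add h1 h2)
        calc _ ≤ ‖w y‖ * (G * L * ‖x' - x‖ + G * ‖x' - x‖) := by gcongr
          _ = _ := by ring
      · refine Eventually.of_forall fun y => ?_
        have h1 := hasFDerivWithinAt_iff_tendsto.1 (hasFDerivWithinAt_surfGrad (hF y x hx))
        have h2 := h1.const_mul ‖w y‖
        rw [mul_zero] at h2
        refine squeeze_zero_norm (fun x' => le_of_eq ?_) h2
        rw [norm_mul, norm_mul, norm_inv, norm_norm]
        simp only [innerSL_apply_apply]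
        ring
    rw [integral_zero] at hdom
    refine (tendsto_zero_iff_norm_tendsto_zero.1 hdom).congr' ?_
    filter_upwards [self_mem_nhdsWithin] with x' hx'
    rw [integral_const_mul, norm_mul, norm_inv, norm_norm]
    congr 2
    have hi : Integrable (fun y => w y * F x' y - w y * F x y) ν := (hint x' hx').sub (hint x hx)
    rw [innerSL_apply_apply, hinner, ← integral_sub (hint x' hx') (hint x hx),
      ← integral_sub hi (hinti _)]
    refine integral_congr_ae (Eventually.of_forall fun y => ?_)
    simp only
    ring
  exact ⟨hder.differentiableWithinAt, surfGrad_eq_of_hasFDerivWithinAt_inner ha hder⟩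

end ParametricIntegral

/-! ### Comparison of integrals under bi-Lipschitz maps -/

section ChangeOfVariables

open scoped MeasureTheory NNReal ENNReal

variable {X Y : Type*} [EMetricSpace X] [EMetricSpace Y] [MeasurableSpace X] [BorelSpace X]
  [MeasurableSpace Y] [BorelSpace Y] {K : ℝ≥0} {f : X → Y} {S : Set X}

theorem restrict_image_le_smul_map (hf : LipschitzOnWith K f S) (hS : MeasurableSet S) (n : ℕ) :
    (μHE[n] : Measure Y).restrict (f '' S) ≤
      (K : ℝ≥0∞) ^ n • Measure.map f ((μHE[n] : Measure X).restrict S) := by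
  have hfm : AEMeasurable f ((μHE[n] : Measure X).restrict S) := hf.continuousOn.aemeasurable hS
  refine Measure.le_iff.2 fun A hA => ?_
  rw [Measure.restrict_apply hA, Measure.smul_apply, Measure.map_apply_of_aemeasurable hfm hA,
    Measure.restrict_apply' hS, smul_eq_mul]
  have : A ∩ f '' S ⊆ f '' (f ⁻¹' A ∩ S) := by
    rintro _ ⟨hA, x, hx, rfl⟩
    exact ⟨x, ⟨hA, hx⟩, rfl⟩
  exact (measure_mono this).trans
    (euclideanHausdorffMeasure_image_le_of_lipschitzOnWith (hf.mono inter_subset_right) n)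

/-- The hypothesis makes `f` injective on `S` with a `K`-Lipschitz inverse, which scales the
`n`-dimensional measure by at most `K ^ n`. -/
theorem map_restrict_le_smul_restrict_image
    (hanti : ∀ x ∈ S, ∀ x' ∈ S, edist x x' ≤ K * edist (f x) (f x')) (hS : MeasurableSet S)
    (n : ℕ) (hfm : AEMeasurable f ((μHE[n] : Measure X).restrict S)) :
    Measure.map f ((μHE[n] : Measure X).restrict S) ≤
      (K : ℝ≥0∞) ^ n • (μHE[n] : Measure Y).restrict (f '' S) := by
  refine Measure.le_iff.2 fun A hA => ?_
  rw [Measure.smul_apply, Measure.restrict_apply hA, Measure.map_apply_of_aemeasurable hfm hA,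
    Measure.restrict_apply' hS, smul_eq_mul]
  rcases isEmpty_or_nonempty X with hX | hX
  · rw [Set.eq_empty_of_isEmpty (f ⁻¹' A ∩ S)]; simp
  have hinv : ∀ x ∈ S, Function.invFunOn f S (f x) = x := fun x hx => by
    have h1 : f x ∈ f '' S := ⟨x, hx, rfl⟩
    have := hanti _ (Function.invFunOn_mem h1) x hx
    rw [Function.invFunOn_eq h1, edist_self, mul_zero] at this
    exact edist_le_zero.1 this
  have hlip : LipschitzOnWith K (Function.invFunOn f S) (A ∩ f '' S) := by
    rintro _ ⟨-, x, hx, rfl⟩ _ ⟨-, x', hx', rfl⟩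
    rw [hinv x hx, hinv x' hx']
    exact hanti x hx x' hx'
  have : f ⁻¹' A ∩ S ⊆ Function.invFunOn f S '' (A ∩ f '' S) := by
    rintro x ⟨hA, hx⟩
    exact ⟨f x, ⟨hA, x, hx, rfl⟩, hinv x hx⟩
  exact (measure_mono this).trans (euclideanHausdorffMeasure_image_le_of_lipschitzOnWith hlip n)

theorem setLIntegral_image_le (hf : LipschitzOnWith K f S) (hS : MeasurableSet S) (n : ℕ)
    (u : Y → ℝ≥0∞) :
    ∫⁻ y in f '' S, u y ∂(μHE[n] : Measure Y) ≤
      (K : ℝ≥0∞) ^ n * ∫⁻ x in S, u (f x) ∂(μHE[n] : Measure X) := by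
  refine (lintegral_mono' (restrict_image_le_smul_map hf hS n) le_rfl).trans ?_
  rw [lintegral_smul_measure, smul_eq_mul]
  gcongr
  exact lintegral_map_le _ _

theorem setLIntegral_comp_le (hanti : ∀ x ∈ S, ∀ x' ∈ S, edist x x' ≤ K * edist (f x) (f x'))
    (hS : MeasurableSet S) (n : ℕ) (hfm : AEMeasurable f ((μHE[n] : Measure X).restrict S))
    {u : Y → ℝ≥0∞} (hu : AEMeasurable u ((μHE[n] : Measure Y).restrict (f '' S))) :
    ∫⁻ x in S, u (f x) ∂(μHE[n] : Measure X) ≤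
      (K : ℝ≥0∞) ^ n * ∫⁻ y in f '' S, u y ∂(μHE[n] : Measure Y) := by
  have h1 := map_restrict_le_smul_restrict_image hanti hS n hfm
  have hu' : AEMeasurable u (Measure.map f ((μHE[n] : Measure X).restrict S)) :=
    (hu.smul_measure _).mono_measure h1
  rw [← lintegral_map' hu' hfm]
  refine (lintegral_mono' h1 le_rfl).trans ?_
  rw [lintegral_smul_measure, smul_eq_mul]

end ChangeOfVariables

/-! ### A Poincaré-type estimate on convex sets -/

section Contraction

open scoped MeasureTheory NNReal ENNReal

/-- Cauchy–Schwarz against the constant `1`. -/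
theorem sq_lintegral_le_lintegral_sq {α : Type*} [MeasurableSpace α] {μ : Measure α}
    (hμ : μ univ ≤ 1) {f : α → ℝ≥0∞} (hf : AEMeasurable f μ) :
    (∫⁻ a, f a ∂μ) ^ 2 ≤ ∫⁻ a, f a ^ 2 ∂μ := by
  have h := ENNReal.lintegral_mul_le_Lp_mul_Lq μ Real.HolderConjugate.two_two hf
    (aemeasurable_const (b := (1 : ℝ≥0∞)))
  simp only [Pi.mul_apply, mul_one, ENNReal.one_rpow, lintegral_const, one_mul] at h
  have h2 : ∫⁻ a, f a ∂μ ≤ (∫⁻ a, f a ^ (2 : ℝ) ∂μ) ^ (1 / 2 : ℝ) := by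
    refine h.trans (mul_le_of_le_one_right zero_le ?_)
    exact ENNReal.rpow_le_one hμ (by norm_num)
  calc (∫⁻ a, f a ∂μ) ^ 2 ≤ ((∫⁻ a, f a ^ (2 : ℝ) ∂μ) ^ (1 / 2 : ℝ)) ^ 2 := by gcongr
    _ = ∫⁻ a, f a ^ 2 ∂μ := by
      rw [← ENNReal.rpow_natCast, ← ENNReal.rpow_mul]
      simp

theorem ENNReal_add_sq_le (a b : ℝ≥0∞) : (a + b) ^ 2 ≤ 2 * (a ^ 2 + b ^ 2) := by
  have h := ENNReal.rpow_add_le_mul_rpow_add_rpow a b (p := 2) (by norm_num)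
  have e : (2 : ℝ) - 1 = 1 := by norm_num
  rw [e, ENNReal.rpow_one] at h
  simpa using h

variable {s : ℕ}

/-- The contraction `z ↦ a + t (z - a)` of `ℝˢ`. -/
def contraction (a : Euc s) (t : ℝ) (z : Euc s) : Euc s := a + t • (z - a)

theorem contraction_mem {S : Set (Euc s)} (hS : Convex ℝ S) {a z : Euc s} (ha : a ∈ S) (hz : z ∈ S)
    {t : ℝ} (ht : t ∈ Icc (0 : ℝ) 1) : contraction a t z ∈ S :=
  hS.add_smul_sub_mem ha hz ht

theorem edist_le_mul_edist_contraction {ε t : ℝ} (hε : 0 < ε) (ht : ε ≤ t) (a z z' : Euc s) :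
    edist z z' ≤ (Real.toNNReal ε⁻¹ : ℝ≥0∞) * edist (contraction a t z) (contraction a t z') := by
  have h1 : edist (contraction a t z) (contraction a t z') = ENNReal.ofReal t * edist z z' := by
    rw [contraction, contraction, edist_dist, edist_dist, dist_add_left, dist_smul₀, dist_sub_right,
      Real.norm_of_nonneg (hε.le.trans ht), ENNReal.ofReal_mul (hε.le.trans ht)]
  rw [h1, ← mul_assoc]
  refine le_mul_of_one_le_left zero_le ?_
  change 1 ≤ ENNReal.ofReal ε⁻¹ * ENNReal.ofReal t
  rw [← ENNReal.ofReal_mul (by positivity), ENNReal.one_le_ofReal, inv_mul_eq_div, one_le_div hε]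
  exact ht

/-- Along the segments to the center of a convex set, a function is controlled by its values on a
small copy of the set and by its derivative. -/
theorem setLIntegral_sq_le_of_contraction {S : Set (Euc s)} (hS : Convex ℝ S)
    (hSm : MeasurableSet S) {a : Euc s} (ha : a ∈ S) {ρ : ℝ≥0} (hρ : ∀ z ∈ S, ‖z - a‖ₑ ≤ ρ)
    {ε : ℝ} (hε : 0 < ε) (hε1 : ε ≤ 1) {g : Euc s → ℝ} (hg : ∀ z ∈ S, ContDiffAt ℝ 1 g z) :
    ∫⁻ z in S, ‖g z‖ₑ ^ 2 ≤ 2 * ((Real.toNNReal ε⁻¹ : ℝ≥0∞) ^ s *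
        (∫⁻ z in contraction a ε '' S, ‖g z‖ₑ ^ 2) +
      ρ ^ 2 * (Real.toNNReal ε⁻¹ : ℝ≥0∞) ^ s * ∫⁻ z in S, ‖fderiv ℝ g z‖ₑ ^ 2) := by
  have hIcc : ∀ t ∈ Icc ε 1, t ∈ Icc (0 : ℝ) 1 := fun t ht => ⟨hε.le.trans ht.1, ht.2⟩
  have hcontr : ∀ t, Continuous (contraction a t) := fun t => by unfold contraction; fun_prop
  -- For `t ≥ ε` the inverse contraction is `ε⁻¹`-Lipschitz. Stopping at `ε` rather than `0` keeps
  -- the factor `ε⁻ˢ` finite.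
  have hcov : ∀ t ∈ Icc ε 1, ∀ u : Euc s → ℝ≥0∞,
      AEMeasurable u (volume.restrict (contraction a t '' S)) →
      ∫⁻ z in S, u (contraction a t z) ≤
        (Real.toNNReal ε⁻¹ : ℝ≥0∞) ^ s * ∫⁻ z in contraction a t '' S, u z := by
    intro t ht u hu
    have := setLIntegral_comp_le (f := contraction a t)
      (fun z _ z' _ => edist_le_mul_edist_contraction hε ht.1 a z z') hSm s
      (hcontr t).aemeasurable (u := u)
      (by rwa [EuclideanSpace.euclideanHausdorffMeasure_eq_volume])
    rwa [EuclideanSpace.euclideanHausdorffMeasure_eq_volume] at this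
  have hsub : ∀ t ∈ Icc ε 1, contraction a t '' S ⊆ S := by
    rintro t ht _ ⟨z, hz, rfl⟩
    exact contraction_mem hS ha hz (hIcc t ht)
  have hgc : ContinuousOn g S := fun z hz => (hg z hz).continuousAt.continuousWithinAt
  have hgm : AEMeasurable (fun z => ‖g z‖ₑ ^ 2) (volume.restrict S) :=
    ((hgc.aemeasurable hSm).enorm).pow_const 2
  have hDm : Measurable fun z => ‖fderiv ℝ g z‖ₑ ^ 2 := ((measurable_fderiv ℝ g).enorm).pow_const 2
  have hjoint : Measurable fun p : Euc s × ℝ => ‖fderiv ℝ g (contraction a p.2 p.1)‖ₑ ^ 2 :=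
    hDm.comp (by unfold contraction; fun_prop)
  -- Fundamental theorem of calculus along the segment for `t ∈ [ε, 1]`, followed by Cauchy–Schwarz
  -- on an interval of length at most `1`.
  have hpt : ∀ z ∈ S, ‖g z‖ₑ ^ 2 ≤ 2 * (‖g (contraction a ε z)‖ₑ ^ 2 +
      ρ ^ 2 * ∫⁻ t in Icc ε 1, ‖fderiv ℝ g (contraction a t z)‖ₑ ^ 2) := by
    intro z hz
    have hdt : ∀ t, HasDerivAt (fun t => contraction a t z) (z - a) t := fun t => by
      unfold contraction
      simpa using ((hasDerivAt_id t).smul_const (z - a)).const_add a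
    have hder : ∀ t ∈ uIcc ε 1, HasDerivAt (fun t => g (contraction a t z))
        (fderiv ℝ g (contraction a t z) (z - a)) t := fun t ht => by
      rw [uIcc_of_le hε1] at ht
      have h1 := ((hg _ (contraction_mem hS ha hz (hIcc t ht))).differentiableAt
        one_ne_zero).hasFDerivAt
      exact h1.comp_hasDerivAt t (hdt t)
    have hcd : ContinuousOn (fun t => fderiv ℝ g (contraction a t z)) (Icc ε 1) := fun t ht => by
      have h1 : ContinuousAt (fderiv ℝ g) (contraction a t z) :=
        ((hg _ (contraction_mem hS ha hz (hIcc t ht))).fderiv_right (m := 0)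
          le_rfl).continuousAt
      exact (h1.comp (f := fun t => contraction a t z)
        (hdt t).continuousAt).continuousWithinAt
    have hint : IntervalIntegrable (fun t => fderiv ℝ g (contraction a t z) (z - a)) volume ε 1 := by
      refine ContinuousOn.intervalIntegrable ?_
      rw [uIcc_of_le hε1]
      exact hcd.clm_apply continuousOn_const
    have hftc := intervalIntegral.integral_eq_sub_of_hasDerivAt hder hint
    have hone : contraction a 1 z = z := by simp [contraction]
    rw [hone, intervalIntegral.integral_of_le hε1, ← integral_Icc_eq_integral_Ioc] at hftc
    have h1 : ‖g z‖ₑ ≤ ‖g (contraction a ε z)‖ₑ +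
        ρ * ∫⁻ t in Icc ε 1, ‖fderiv ℝ g (contraction a t z)‖ₑ := by
      have e : g z = g (contraction a ε z) + (g z - g (contraction a ε z)) := by ring
      rw [e, ← hftc]
      refine (enorm_add_le _ _).trans (add_le_add le_rfl ?_)
      refine (enorm_integral_le_lintegral_enorm _).trans ?_
      rw [← lintegral_const_mul' _ _ ENNReal.coe_ne_top]
      refine lintegral_mono fun t => ?_
      refine (ContinuousLinearMap.le_opENorm _ _).trans ?_
      rw [mul_comm]
      gcongr
      exact hρ z hz
    have hmz : Measurable fun t : ℝ => fderiv ℝ g (contraction a t z) :=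
      (measurable_fderiv ℝ g).comp (by unfold contraction; fun_prop)
    calc ‖g z‖ₑ ^ 2 ≤ _ := by gcongr
      _ ≤ _ := ENNReal_add_sq_le _ _
      _ ≤ _ := by
        rw [mul_pow]
        gcongr
        refine sq_lintegral_le_lintegral_sq ?_ hmz.enorm.aemeasurable
        rw [Measure.restrict_apply_univ, Real.volume_Icc, ENNReal.ofReal_le_one]
        linarith
  have h1ε : ε ∈ Icc ε 1 := ⟨le_rfl, hε1⟩
  calc ∫⁻ z in S, ‖g z‖ₑ ^ 2
      ≤ ∫⁻ z in S, 2 * (‖g (contraction a ε z)‖ₑ ^ 2 +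
          ρ ^ 2 * ∫⁻ t in Icc ε 1, ‖fderiv ℝ g (contraction a t z)‖ₑ ^ 2) :=
        setLIntegral_mono' hSm hpt
    _ = 2 * ((∫⁻ z in S, ‖g (contraction a ε z)‖ₑ ^ 2) +
          ρ ^ 2 * ∫⁻ z in S, ∫⁻ t in Icc ε 1, ‖fderiv ℝ g (contraction a t z)‖ₑ ^ 2) := by
        rw [lintegral_const_mul' _ _ (by norm_num), lintegral_add_right,
          lintegral_const_mul' _ _ (by finiteness)]
        exact (hjoint.lintegral_prod_right' (ν := volume.restrict (Icc ε 1))).const_mul _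
    _ ≤ _ := by
        rw [mul_assoc]
        gcongr
        · exact hcov ε h1ε _ (hgm.mono_set (hsub ε h1ε))
        · rw [lintegral_lintegral_swap hjoint.aemeasurable]
          calc _ ≤ ∫⁻ t in Icc ε 1, (Real.toNNReal ε⁻¹ : ℝ≥0∞) ^ s *
                ∫⁻ z in S, ‖fderiv ℝ g z‖ₑ ^ 2 := by
                refine setLIntegral_mono' measurableSet_Icc fun t ht => ?_
                refine (hcov t ht _ hDm.aemeasurable).trans ?_
                gcongr
                exact hsub t ht
            _ ≤ _ := by
                rw [lintegral_const, Measure.restrict_apply_univ, Real.volume_Icc]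
                refine mul_le_of_le_one_right zero_le ?_
                rw [ENNReal.ofReal_le_one]
                linarith

end Contraction

/-! ### Invariance of the boundary under change of charts -/

section Boundary

variable {d s : ℕ} {R : Set (Euc d)}

/-- The points of `ℝˢ` whose coordinates are all nonnegative. -/
def orthant (s : ℕ) : Set (Euc s) := {z | ∀ j, 0 ≤ z j}

theorem convex_orthant (s : ℕ) : Convex ℝ (orthant s) := by
  intro a ha b hb α β hα hβ _ j
  have h1 := ha j
  have h2 := hb j
  simp only [PiLp.add_apply, PiLp.smul_apply, smul_eq_mul]
  positivity

theorem isClosed_orthant (s : ℕ) : IsClosed (orthant s) := by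
  simp only [orthant, Set.ofPred_forall]
  exact isClosed_iInter fun j => isClosed_le continuous_const (by fun_prop)

theorem isOpen_forall_pos (s : ℕ) : IsOpen {z : Euc s | ∀ j, 0 < z j} := by
  simp only [Set.ofPred_forall]
  exact isOpen_iInter_of_finite fun j => isOpen_lt continuous_const (by fun_prop)

theorem isOpen_forall_pos_subset (s : ℕ) : {z : Euc s | ∀ j, 0 < z j} ⊆ orthant s :=
  fun _ hz j => (hz j).le

/-- The boundary of a manifold does not depend on the chart that is used to describe it. -/
theorem IsStraightening.notMem_manifoldInterior (hs : s ≤ d)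
    {Φ : OpenPartialHomeomorph (Euc d) (Euc d)} (hΦ : IsStraightening s R Φ) {y : Euc d}
    (hy : y ∈ Φ.source) {j : Fin d} (hj : (j : ℕ) < s) (hyj : Φ y j = 0) :
    y ∉ manifoldInterior s R := by
  rintro ⟨hyR, Ψ, hΨ, hyΨ, hpos⟩
  obtain ⟨a, ha⟩ := exists_embed_eq_of_mem_corner hs ((hΨ.mem_iff y hyΨ).1 hyR)
  have hapos : ∀ i, 0 < a i := fun i => by
    have := hpos (Fin.castLE hs i) (by simp)
    rwa [← ha, embed_apply_castLE] at this
  have hΨy : Ψ.symm (embed hs a) = y := by rw [ha, Ψ.left_inv hyΨ]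
  have hat : embed hs a ∈ Ψ.target := by rw [ha]; exact Ψ.map_source hyΨ
  -- If `Ψ` exhibited `y` as an interior point, this transition map would send a full neighborhood
  -- of `a` in `ℝˢ` into the corner.
  set θ : Euc s → Euc d := fun z => Φ (Ψ.symm (embed hs z))
  have hd1 : HasFDerivAt Ψ.symm (fderiv ℝ Ψ.symm (embed hs a)) (embed hs a) :=
    ((hΨ.contDiffOn_symm.contDiffAt (Ψ.open_target.mem_nhds hat)).differentiableAt
      one_ne_zero).hasFDerivAt
  have hd2 : HasFDerivAt Φ (fderiv ℝ Φ y) (Ψ.symm (embed hs a)) := by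
    rw [hΨy]
    exact ((hΦ.contDiffOn.contDiffAt (Φ.open_source.mem_nhds hy)).differentiableAt
      one_ne_zero).hasFDerivAt
  have hd3 : HasFDerivAt (embed hs : Euc s → Euc d) (embed hs).toContinuousLinearMap a :=
    (embed hs).toContinuousLinearMap.hasFDerivAt
  set D : Euc s →L[ℝ] Euc d := (fderiv ℝ Φ y).comp
    ((fderiv ℝ Ψ.symm (embed hs a)).comp (embed hs).toContinuousLinearMap)
  have hθ : HasFDerivAt θ D a := hd2.comp a (hd1.comp a hd3)
  have hcont : ContinuousAt (fun z => Ψ.symm (embed hs z)) a := (hd1.comp a hd3).continuousAt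
  have hnear : ∀ᶠ z in 𝓝 a, θ z ∈ corner d s := by
    have h1 : ∀ᶠ z in 𝓝 a, Ψ.symm (embed hs z) ∈ Φ.source := by
      refine hcont.eventually_mem ?_
      rw [hΨy]
      exact Φ.open_source.mem_nhds hy
    have h2 : ∀ᶠ z in 𝓝 a, embed hs z ∈ Ψ.target :=
      (embed hs).continuous.continuousAt.eventually_mem (Ψ.open_target.mem_nhds hat)
    have h3 : ∀ᶠ z in 𝓝 a, ∀ i, 0 < z i := (isOpen_forall_pos s).mem_nhds hapos
    filter_upwards [h1, h2, h3] with z h1 h2 h3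
    refine (hΦ.mem_iff _ h1).1 ((hΨ.symm_mem_iff h2).2 ?_)
    exact (embed_mem_corner_iff hs).2 fun i => (h3 i).le
  have hθa : θ a = Φ y := by simp only [θ, hΨy]
  have hcoord : ∀ i : Fin d, HasFDerivAt (fun z => θ z i) ((EuclideanSpace.proj i).comp D) a :=
    fun i => (EuclideanSpace.proj (𝕜 := ℝ) i).hasFDerivAt.comp a hθ
  -- Near `a` the coordinates beyond `s` vanish, and coordinate `j` has a local minimum with value
  -- `0` at `a`.
  have hzero : ∀ i : Fin d, (s ≤ (i : ℕ) ∨ i = j) → ∀ v, D v i = 0 := by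
    intro i hi v
    have hmin : IsLocalMin (fun z => θ z i) a := by
      filter_upwards [hnear] with z hz
      rcases hi with hi | rfl
      · rw [(hz i).2 hi, (hnear.self_of_nhds i).2 hi]
      · rw [hθa, hyj]
        exact (hz i).1 hj
    have := hmin.hasFDerivAt_eq_zero (hcoord i)
    exact congrArg (fun L : Euc s →L[ℝ] ℝ => L v) this
  have hinj : Function.Injective D := by
    have e1 : Function.Injective (fderiv ℝ Φ y) := by
      have hx : HasFDerivAt Φ.symm (fderiv ℝ Φ.symm (Φ y)) (Φ y) :=
        ((hΦ.contDiffOn_symm.contDiffAt (Φ.open_target.mem_nhds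
          (Φ.map_source hy))).differentiableAt one_ne_zero).hasFDerivAt
      rw [hΨy] at hd2
      have hcomp := (hx.comp y hd2).congr_of_eventuallyEq (f₁ := id) (by
        filter_upwards [Φ.open_source.mem_nhds hy] with z hz using (Φ.left_inv hz).symm)
      have := hcomp.unique (hasFDerivAt_id y)
      intro v w hvw
      have h1 := congrArg (fun L : Euc d →L[ℝ] Euc d => L v) this
      have h2 := congrArg (fun L : Euc d →L[ℝ] Euc d => L w) this
      simp only [ContinuousLinearMap.comp_apply, ContinuousLinearMap.id_apply] at h1 h2
      rw [← h1, ← h2, hvw]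
    have e2 : Function.Injective (fderiv ℝ Ψ.symm (embed hs a)) := by
      have hx : HasFDerivAt Ψ (fderiv ℝ Ψ y) (Ψ.symm (embed hs a)) := by
        rw [hΨy]
        exact ((hΨ.contDiffOn.contDiffAt (Ψ.open_source.mem_nhds hyΨ)).differentiableAt
          one_ne_zero).hasFDerivAt
      have hcomp := (hx.comp _ hd1).congr_of_eventuallyEq (f₁ := id) (by
        filter_upwards [Ψ.open_target.mem_nhds hat] with z hz using (Ψ.right_inv hz).symm)
      have := hcomp.unique (hasFDerivAt_id _)
      intro v w hvw
      have h1 := congrArg (fun L : Euc d →L[ℝ] Euc d => L v) this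
      have h2 := congrArg (fun L : Euc d →L[ℝ] Euc d => L w) this
      simp only [ContinuousLinearMap.comp_apply, ContinuousLinearMap.id_apply] at h1 h2
      rw [← h1, ← h2, hvw]
    exact e1.comp (e2.comp (embed hs).injective)
  let j' : Fin s := ⟨j, hj⟩
  -- The injective `D` is determined by `s - 1` coordinates, which contradicts its having rank `s`.
  let Q : Euc s →ₗ[ℝ] ({i : Fin s // i ≠ j'} → ℝ) :=
    { toFun := fun v i => D v (Fin.castLE hs i)
      map_add' := fun v w => by ext i; simp
      map_smul' := fun c v => by ext i; simp }
  have hQ : Function.Injective Q := by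
    intro v w hvw
    refine hinj ?_
    ext i
    by_cases hi : s ≤ (i : ℕ) ∨ i = j
    · rw [hzero i hi, hzero i hi]
    · push Not at hi
      exact congrFun hvw ⟨⟨i, hi.1⟩, fun h => hi.2 (Fin.ext (by simpa [j'] using h))⟩
  have hle := LinearMap.finrank_le_finrank_of_injective hQ
  rw [finrank_euclideanSpace_fin, Module.finrank_fintype_fun_eq_card,
    Fintype.card_subtype_compl, Fintype.card_fin, Fintype.card_subtype_eq] at hle
  have : (j : ℕ) < s := hj
  omega

theorem IsTestFunction.eventuallyEq_zero {φ : Euc d → ℝ} (hφ : IsTestFunction s R φ) {y : Euc d}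
    (hy : y ∈ R) (hy' : y ∉ manifoldInterior s R) : φ =ᶠ[𝓝 y] 0 :=
  notMem_tsupport_iff_eventuallyEq.1 fun h => hy' (hφ.2.2 ⟨h, hy⟩)

end Boundary

/-! ### Local parametrizations by pieces of the orthant -/

section ChartPiece

variable {d s : ℕ} {R : Set (Euc d)}

/-- A local parametrization `ψ` of the manifold `R`, by the part of the ball with center `z₀` and
radius `r` that lies in the orthant. -/
structure IsLocalParam (s : ℕ) (R : Set (Euc d)) (ψ : Euc s → Euc d) (z₀ : Euc s) (r : ℝ)
    (N : Set (Euc d)) (K : NNReal) : Prop where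
  pos : 0 < r
  isOpen : IsOpen N
  image : ψ '' (Metric.ball z₀ r ∩ orthant s) = N ∩ R
  contDiffAt : ∀ z ∈ Metric.ball z₀ r, ContDiffAt ℝ 1 ψ z
  norm_fderiv_le : ∀ z ∈ Metric.ball z₀ r, ‖fderiv ℝ ψ z‖ ≤ K
  lipschitz : LipschitzOnWith K ψ (Metric.ball z₀ r)
  anti : ∀ z ∈ Metric.ball z₀ r, ∀ z' ∈ Metric.ball z₀ r, edist z z' ≤ K * edist (ψ z) (ψ z')
  boundary : ∀ z ∈ Metric.ball z₀ r, ∀ j, z j = 0 → ψ z ∉ manifoldInterior s R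

theorem IsCompactManifold.exists_isLocalParam (hR : IsCompactManifold s R) {x : Euc d}
    (hx : x ∈ R) : ∃ (ψ : Euc s → Euc d) (z₀ : Euc s) (r : ℝ) (N : Set (Euc d)) (K : NNReal),
      IsLocalParam s R ψ z₀ r N K ∧ x ∈ N ∧ ψ z₀ = x ∧ z₀ ∈ orthant s ∧
        (x ∉ manifoldInterior s R → ∃ j, z₀ j = 0) := by
  obtain ⟨Φ, hΦ, hxs⟩ := hR.exists_chart x hx
  obtain ⟨K, r, hr, hb, hd, hL, hL'⟩ := hΦ.exists_ball hxs
  have hs := hR.dim_le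
  have hxc := (hΦ.mem_iff x hxs).1 hx
  obtain ⟨z₀, hz₀⟩ := exists_embed_eq_of_mem_corner hs hxc
  have hball : ∀ z, z ∈ Metric.ball z₀ r ↔ embed hs z ∈ Metric.ball (Φ x) r := fun z => by
    rw [← hz₀, Metric.mem_ball, Metric.mem_ball, (embed hs).isometry.dist_eq]
  have hder : ∀ z ∈ Metric.ball z₀ r, HasFDerivAt (fun z => Φ.symm (embed hs z))
      ((fderiv ℝ Φ.symm (embed hs z)).comp (embed hs).toContinuousLinearMap) z := fun z hz =>
    (hd _ ((hball z).1 hz)).1.hasFDerivAt.comp z (embed hs).toContinuousLinearMap.hasFDerivAt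
  refine ⟨fun z => Φ.symm (embed hs z), z₀, r, Φ.symm '' Metric.ball (Φ x) r, K,
    ⟨hr, ?_, ?_, ?_, ?_, ?_, ?_, ?_⟩, ?_, ?_, ?_, ?_⟩
  · exact Φ.symm.isOpen_image_of_subset_source Metric.isOpen_ball hb
  · ext y
    constructor
    · rintro ⟨z, ⟨hz, hzo⟩, rfl⟩
      exact ⟨⟨_, (hball z).1 hz, rfl⟩, (hΦ.symm_mem_iff (hb ((hball z).1 hz))).2
        ((embed_mem_corner_iff hs).2 hzo)⟩
    · rintro ⟨⟨w, hw, rfl⟩, hwR⟩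
      have hwc := (hΦ.symm_mem_iff (hb hw)).1 hwR
      obtain ⟨z, rfl⟩ := exists_embed_eq_of_mem_corner hs hwc
      exact ⟨z, ⟨(hball z).2 hw, (embed_mem_corner_iff hs).1 hwc⟩, rfl⟩
  · intro z hz
    exact (hΦ.contDiffOn_symm.contDiffAt (Φ.open_target.mem_nhds (hb ((hball z).1 hz)))).comp z
      (embed hs).toContinuousLinearMap.contDiff.contDiffAt
  · intro z hz
    rw [(hder z hz).fderiv]
    refine (ContinuousLinearMap.opNorm_comp_le _ _).trans ?_
    refine (mul_le_of_le_one_right (norm_nonneg _)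
      (embed hs).norm_toContinuousLinearMap_le).trans ?_
    exact (hd _ ((hball z).1 hz)).2
  · intro z hz z' hz'
    have := hL ((hball z).1 hz) ((hball z').1 hz')
    rwa [(embed hs).isometry.edist_eq] at this
  · intro z hz z' hz'
    have h1 := (hball z).1 hz
    have h2 := (hball z').1 hz'
    have := hL' ⟨_, h1, rfl⟩ ⟨_, h2, rfl⟩
    rwa [Φ.right_inv (hb h1), Φ.right_inv (hb h2), (embed hs).isometry.edist_eq] at this
  · intro z hz j hj
    have h1 := hb ((hball z).1 hz)
    refine hΦ.notMem_manifoldInterior hs (Φ.map_target h1) (j := Fin.castLE hs j) (by simp) ?_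
    rw [Φ.right_inv h1, embed_apply_castLE, hj]
  · exact ⟨Φ x, Metric.mem_ball_self hr, Φ.left_inv hxs⟩
  · simp only [hz₀, Φ.left_inv hxs]
  · exact (embed_mem_corner_iff hs).1 (hz₀ ▸ hxc)
  · intro hxi
    by_contra! hne
    refine hxi ⟨hx, Φ, hΦ, hxs, fun i hi => ?_⟩
    refine lt_of_le_of_ne ((hxc i).1 hi) fun h => hne ⟨i, hi⟩ ?_
    rw [← hz₀, embed_apply, dif_pos hi] at h
    exact h.symm

end ChartPiece

/-! ### The Poincaré inequality for test functions -/

section Poincare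

open scoped MeasureTheory NNReal ENNReal

variable {d s : ℕ} {R : Set (Euc d)}

/-- The Dirichlet energy of a function on `R`. -/
def energy (s : ℕ) (R : Set (Euc d)) (φ : Euc d → ℝ) : ℝ≥0∞ :=
  ∫⁻ x, ‖surfGrad R φ x‖ₑ ^ 2 ∂(surfaceMeasure s R)

/-- The `L²` norm on `U ∩ R` of test functions is bounded by their energy on `R`. -/
def PoincareOn (s : ℕ) (R U : Set (Euc d)) : Prop :=
  ∃ C : ℝ≥0, ∀ φ, IsTestFunction s R φ → AEStronglyMeasurable (surfGrad R φ) (surfaceMeasure s R) →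
    ∫⁻ x in U ∩ R, ‖φ x‖ₑ ^ 2 ∂(μHE[s] : Measure (Euc d)) ≤ C * energy s R φ

theorem PoincareOn.mono {U U' : Set (Euc d)} (h : PoincareOn s R U') (hU : U ∩ R ⊆ U' ∩ R) :
    PoincareOn s R U := by
  obtain ⟨C, hC⟩ := h
  exact ⟨C, fun φ hφ hm => (lintegral_mono_set hU).trans (hC φ hφ hm)⟩

section LocalParam

variable {ψ : Euc s → Euc d} {z₀ : Euc s} {r : ℝ} {N : Set (Euc d)} {K : ℝ≥0}
  (h : IsLocalParam s R ψ z₀ r N K)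
include h

theorem IsLocalParam.mapsTo : MapsTo ψ (Metric.ball z₀ r ∩ orthant s) R := fun z hz => by
  have : ψ z ∈ N ∩ R := h.image ▸ ⟨z, hz, rfl⟩
  exact this.2

theorem IsLocalParam.measurableSet : MeasurableSet (Metric.ball z₀ r ∩ orthant s) :=
  Metric.isOpen_ball.measurableSet.inter (isClosed_orthant s).measurableSet

theorem IsLocalParam.convex : Convex ℝ (Metric.ball z₀ r ∩ orthant s) :=
  (convex_ball _ _).inter (convex_orthant s)

theorem IsLocalParam.contDiffAt_comp {φ : Euc d → ℝ} (hφ : ContDiff ℝ 1 φ) {z : Euc s}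
    (hz : z ∈ Metric.ball z₀ r) : ContDiffAt ℝ 1 (fun z => φ (ψ z)) z :=
  hφ.contDiffAt.comp z (h.contDiffAt z hz)

/-- The orthant has nonempty interior, so derivatives within it are unique even at its faces. The
full derivative of `φ ∘ ψ` is therefore the surface gradient composed with `Dψ`, and normal
derivatives of `φ` play no role. -/
theorem IsLocalParam.norm_fderiv_comp_le {φ : Euc d → ℝ} (hφ : ContDiff ℝ 1 φ) {z : Euc s}
    (hz : z ∈ Metric.ball z₀ r ∩ orthant s) :
    ‖fderiv ℝ (fun z => φ (ψ z)) z‖ₑ ≤ K * ‖surfGrad R φ (ψ z)‖ₑ := by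
  have hu : UniqueDiffWithinAt ℝ (Metric.ball z₀ r ∩ orthant s) z := by
    rw [inter_comm]
    refine UniqueDiffWithinAt.inter ?_ (Metric.isOpen_ball.mem_nhds hz.1)
    refine uniqueDiffOn_convex (convex_orthant s) ⟨WithLp.toLp 2 fun _ => 1, ?_⟩ z hz.2
    exact interior_maximal (isOpen_forall_pos_subset s) (isOpen_forall_pos s) fun _ => one_pos
  have h1 : HasFDerivWithinAt (fun z => φ (ψ z)) (fderiv ℝ (fun z => φ (ψ z)) z)
      (Metric.ball z₀ r ∩ orthant s) z :=
    ((h.contDiffAt_comp hφ hz.1).differentiableAt one_ne_zero).hasFDerivAt.hasFDerivWithinAt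
  have h2 : HasFDerivWithinAt (fun z => φ (ψ z))
      ((innerSL ℝ (surfGrad R φ (ψ z))).comp (fderiv ℝ ψ z)) (Metric.ball z₀ r ∩ orthant s) z :=
    (hasFDerivWithinAt_surfGrad
      (hφ.contDiffAt.differentiableAt one_ne_zero).differentiableWithinAt).comp z
      ((h.contDiffAt z hz.1).differentiableAt one_ne_zero).hasFDerivAt.hasFDerivWithinAt h.mapsTo
  rw [hu.eq h1 h2, mul_comm]
  have h3 := ContinuousLinearMap.opNorm_comp_le (innerSL ℝ (surfGrad R φ (ψ z))) (fderiv ℝ ψ z)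
  rw [innerSL_apply_norm] at h3
  have h4 := h3.trans (mul_le_mul_of_nonneg_left (h.norm_fderiv_le z hz.1) (norm_nonneg _))
  rw [← ofReal_norm, ← ofReal_norm, ← ENNReal.ofReal_coe_nnreal,
    ← ENNReal.ofReal_mul (norm_nonneg _)]
  exact ENNReal.ofReal_le_ofReal h4

theorem IsLocalParam.setLIntegral_comp_le {u : Euc d → ℝ≥0∞} {T : Set (Euc s)}
    (hT : T ⊆ Metric.ball z₀ r) (hTm : MeasurableSet T)
    (hu : AEMeasurable u ((μHE[s] : Measure (Euc d)).restrict (ψ '' T))) :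
    ∫⁻ z in T, u (ψ z) ≤ (K : ℝ≥0∞) ^ s * ∫⁻ y in ψ '' T, u y ∂(μHE[s] : Measure (Euc d)) := by
  have := ParamInverse.setLIntegral_comp_le (K := K) (f := ψ)
    (fun z hz z' hz' => h.anti z (hT hz) z' (hT hz')) hTm s
    ((h.lipschitz.continuousOn.mono hT).aemeasurable hTm) hu
  rwa [EuclideanSpace.euclideanHausdorffMeasure_eq_volume] at this

/-- `K ^ 2` comes from the chain rule, `K ^ s` from the change of variables. -/
theorem IsLocalParam.setLIntegral_fderiv_le {φ : Euc d → ℝ} (hφ : ContDiff ℝ 1 φ)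
    (hm : AEStronglyMeasurable (surfGrad R φ) (surfaceMeasure s R)) :
    ∫⁻ z in Metric.ball z₀ r ∩ orthant s, ‖fderiv ℝ (fun z => φ (ψ z)) z‖ₑ ^ 2 ≤
      (K : ℝ≥0∞) ^ 2 * (K : ℝ≥0∞) ^ s * energy s R φ := by
  have hsub : ψ '' (Metric.ball z₀ r ∩ orthant s) ⊆ R := h.mapsTo.image_subset
  calc _ ≤ ∫⁻ z in Metric.ball z₀ r ∩ orthant s, (K : ℝ≥0∞) ^ 2 * ‖surfGrad R φ (ψ z)‖ₑ ^ 2 := by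
        refine setLIntegral_mono' h.measurableSet fun z hz => ?_
        rw [← mul_pow]
        gcongr
        exact h.norm_fderiv_comp_le hφ hz
    _ = (K : ℝ≥0∞) ^ 2 *
          ∫⁻ z in Metric.ball z₀ r ∩ orthant s, ‖surfGrad R φ (ψ z)‖ₑ ^ 2 :=
        lintegral_const_mul' _ _ (by finiteness)
    _ ≤ (K : ℝ≥0∞) ^ 2 * ((K : ℝ≥0∞) ^ s * energy s R φ) := by
        gcongr
        have hae : AEMeasurable (fun x => ‖surfGrad R φ x‖ₑ ^ 2)
            ((μHE[s] : Measure (Euc d)).restrict R) := hm.enorm.pow_const 2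
        refine (h.setLIntegral_comp_le (u := fun x => ‖surfGrad R φ x‖ₑ ^ 2) inter_subset_left
          h.measurableSet (hae.mono_set hsub)).trans ?_
        gcongr
        exact lintegral_mono_set hsub
    _ = _ := by ring

theorem IsLocalParam.setLIntegral_image_le (φ : Euc d → ℝ) :
    ∫⁻ x in N ∩ R, ‖φ x‖ₑ ^ 2 ∂(μHE[s] : Measure (Euc d)) ≤
      (K : ℝ≥0∞) ^ s * ∫⁻ z in Metric.ball z₀ r ∩ orthant s, ‖φ (ψ z)‖ₑ ^ 2 := by
  have := ParamInverse.setLIntegral_image_le (h.lipschitz.mono inter_subset_left) h.measurableSet s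
    (fun x => ‖φ x‖ₑ ^ 2)
  rwa [EuclideanSpace.euclideanHausdorffMeasure_eq_volume, h.image] at this

theorem IsLocalParam.enorm_sub_le {z z' : Euc s} (hz : z ∈ Metric.ball z₀ r)
    (hz' : z' ∈ Metric.ball z₀ r) : ‖z - z'‖ₑ ≤ Real.toNNReal (2 * r) := by
  rw [← ofReal_norm]
  refine ENNReal.ofReal_le_ofReal ?_
  rw [← dist_eq_norm]
  have := dist_triangle_right z z' z₀
  rw [Metric.mem_ball] at hz hz'
  linarith

/-- A Poincaré inequality near one point of a chart gives one on the whole chart. -/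
theorem IsLocalParam.poincareOn_of_mem {y : Euc d} (hyN : y ∈ N) (hyR : y ∈ R) {U : Set (Euc d)}
    (hU : U ∈ 𝓝 y) (hUP : PoincareOn s R U) : PoincareOn s R N := by
  obtain ⟨C, hC⟩ := hUP
  obtain ⟨a, ha, rfl⟩ : y ∈ ψ '' (Metric.ball z₀ r ∩ orthant s) := h.image ▸ ⟨hyN, hyR⟩
  obtain ⟨δ, hδ, hδU⟩ := Metric.mem_nhds_iff.1 ((h.contDiffAt a ha.1).continuousAt hU)
  have hr := h.pos
  -- The piece lies within distance `2 r` of `a`, so the contraction with ratio `ε` carries it into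
  -- the ball of radius `δ`, where the inequality is known.
  set ε := min 1 (δ / (4 * r))
  have hε : 0 < ε := by positivity
  have hε1 : ε ≤ 1 := min_le_left _ _
  set S := Metric.ball z₀ r ∩ orthant s
  set e : ℝ≥0 := Real.toNNReal ε⁻¹
  set ρ : ℝ≥0 := Real.toNNReal (2 * r)
  have hT : contraction a ε '' S ⊆ Metric.ball a δ ∩ S := by
    rintro _ ⟨z, hz, rfl⟩
    refine ⟨?_, contraction_mem h.convex ha hz ⟨hε.le, hε1⟩⟩
    rw [Metric.mem_ball, contraction, dist_self_add_left, norm_smul, Real.norm_of_nonneg hε.le]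
    have h1 : ‖z - a‖ < 2 * r := by
      have := dist_triangle_right z a z₀
      have h2 := Metric.mem_ball.1 hz.1
      have h3 := Metric.mem_ball.1 ha.1
      rw [← dist_eq_norm]
      linarith
    have h2 : ε * (4 * r) ≤ δ := by
      rw [← le_div_iff₀ (by positivity)]
      exact min_le_right _ _
    nlinarith
  refine ⟨K ^ s * (2 * (e ^ s * (K ^ s * C) + ρ ^ 2 * e ^ s * (K ^ 2 * K ^ s))), fun φ hφ hm => ?_⟩
  have hcontr := setLIntegral_sq_le_of_contraction h.convex h.measurableSet ha (ρ := ρ)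
    (fun z hz => h.enorm_sub_le hz.1 ha.1) hε hε1
    (g := fun z => φ (ψ z)) (fun z hz => h.contDiffAt_comp hφ.1 hz.1)
  have hball : MeasurableSet (Metric.ball a δ ∩ S) :=
    Metric.isOpen_ball.measurableSet.inter h.measurableSet
  have hmid : ∫⁻ z in contraction a ε '' S, ‖φ (ψ z)‖ₑ ^ 2 ≤ K ^ s * (C * energy s R φ) := by
    refine (lintegral_mono_set hT).trans ?_
    have hφm : Measurable fun x => ‖φ x‖ₑ ^ 2 := hφ.1.continuous.measurable.enorm.pow_const 2
    refine (h.setLIntegral_comp_le (u := fun x => ‖φ x‖ₑ ^ 2)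
      (inter_subset_right.trans inter_subset_left) hball hφm.aemeasurable).trans ?_
    gcongr
    refine (lintegral_mono_set ?_).trans (hC φ hφ hm)
    rintro _ ⟨z, hz, rfl⟩
    exact ⟨hδU hz.1, h.mapsTo hz.2⟩
  calc _ ≤ _ := h.setLIntegral_image_le φ
    _ ≤ (K : ℝ≥0∞) ^ s * (2 * (e ^ s * (K ^ s * (C * energy s R φ)) +
          ρ ^ 2 * e ^ s * (K ^ 2 * K ^ s * energy s R φ))) := by
        gcongr
        refine hcontr.trans ?_
        gcongr
        exact h.setLIntegral_fderiv_le hφ.1 hm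
    _ = _ := by push_cast; ring

/-- The Poincaré inequality in a chart around a boundary point. -/
theorem IsLocalParam.poincareOn_of_boundary {j : Fin s} (hj : z₀ j = 0) (hz₀ : z₀ ∈ orthant s) :
    PoincareOn s R N := by
  have hr := h.pos
  set S := Metric.ball z₀ r ∩ orthant s
  -- The constraint `z j ≥ 0` is dropped, which makes room for extending functions by zero across
  -- that face.
  set S' : Set (Euc s) := Metric.ball z₀ r ∩ {z | ∀ i, i ≠ j → 0 ≤ z i}
  have hS'c : Convex ℝ S' := by
    refine (convex_ball _ _).inter ?_
    intro a ha b hb α β hα hβ _ i hi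
    have h1 := ha i hi
    have h2 := hb i hi
    simp only [PiLp.add_apply, PiLp.smul_apply, smul_eq_mul]
    positivity
  have hS'm : MeasurableSet S' := by
    refine Metric.isOpen_ball.measurableSet.inter (IsClosed.measurableSet ?_)
    simp only [Set.ofPred_forall]
    exact isClosed_iInter fun i => isClosed_iInter fun _ => isClosed_le continuous_const
      (by fun_prop)
  have hSS' : S ⊆ S' := fun z hz => ⟨hz.1, fun i _ => hz.2 i⟩
  -- With center `a` and ratio `1 / 8`, a point with `z j < r` goes to one with `j`-th coordinate
  -- below `-r/2 + (r + r/2) / 8 < 0`, where the extension vanishes.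
  set a : Euc s := z₀ - EuclideanSpace.single j (r / 2)
  have hadist : dist a z₀ = r / 2 := by
    rw [dist_eq_norm]
    simp [a, abs_of_pos hr]
  have haj : a j = -(r / 2) := by simp [a, hj]
  have ha : a ∈ S' := by
    refine ⟨by rw [Metric.mem_ball, hadist]; linarith, fun i hi => ?_⟩
    simpa [a, hi] using hz₀ i
  have hcoord : ∀ z ∈ Metric.ball z₀ r, z j < r := fun z hz => by
    have h1 := PiLp.norm_apply_le (z - z₀) j
    rw [PiLp.sub_apply, hj, sub_zero, ← dist_eq_norm] at h1
    exact (le_abs_self _).trans_lt (h1.trans_lt (Metric.mem_ball.1 hz))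
  set e : ℝ≥0 := Real.toNNReal (1 / 8 : ℝ)⁻¹
  set ρ : ℝ≥0 := Real.toNNReal (2 * r)
  refine ⟨K ^ s * (2 * (ρ ^ 2 * e ^ s * (K ^ 2 * K ^ s))), fun φ hφ hm => ?_⟩
  set g : Euc s → ℝ := fun z => φ (ψ z)
  -- The extension is `C¹` at the points of `S'`: a test function vanishes near every boundary point
  -- of `R`, so `g` vanishes near the face `z j = 0` of `S`.
  set g' : Euc s → ℝ := fun z => if 0 < z j then g z else 0
  have hpos : ∀ z : Euc s, 0 < z j → g' =ᶠ[𝓝 z] g := fun z hz => by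
    have : ∀ᶠ w : Euc s in 𝓝 z, 0 < w j :=
      (isOpen_lt continuous_const (by fun_prop : Continuous fun w : Euc s => w j)).mem_nhds hz
    filter_upwards [this] with w hw
    simp [g', hw]
  have hg0 : ∀ z ∈ S, z j = 0 → g =ᶠ[𝓝 z] 0 := fun z hz hzj => by
    have h1 := hφ.eventuallyEq_zero (h.mapsTo hz) (h.boundary z hz.1 j hzj)
    exact (h.contDiffAt z hz.1).continuousAt.eventually h1
  have hneg : ∀ z ∈ S', z j ≤ 0 → g' =ᶠ[𝓝 z] fun _ => 0 := fun z hz hzj => by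
    rcases hzj.lt_or_eq with hlt | heq
    · have : ∀ᶠ w : Euc s in 𝓝 z, w j < 0 :=
        (isOpen_lt (by fun_prop : Continuous fun w : Euc s => w j) continuous_const).mem_nhds hlt
      filter_upwards [this] with w hw
      simp [g', hw.le]
    · have hzS : z ∈ S := ⟨hz.1, fun i => by
        rcases eq_or_ne i j with rfl | hi
        · exact heq.ge
        · exact hz.2 i hi⟩
      filter_upwards [hg0 z hzS heq] with w hw
      simp only [g', hw, Pi.zero_apply, ite_self]
  have hg' : ∀ z ∈ S', ContDiffAt ℝ 1 g' z := fun z hz => by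
    rcases lt_or_ge 0 (z j) with hlt | hle
    · exact (h.contDiffAt_comp hφ.1 hz.1).congr_of_eventuallyEq (hpos z hlt)
    · exact contDiffAt_const.congr_of_eventuallyEq (hneg z hz hle)
  have hcontr := setLIntegral_sq_le_of_contraction hS'c hS'm ha (ρ := ρ)
    (fun z hz => h.enorm_sub_le hz.1 ha.1) (by norm_num : (0 : ℝ) < 1 / 8) (by norm_num) hg'
  have hzero : ∫⁻ z in contraction a (1 / 8) '' S', ‖g' z‖ₑ ^ 2 = 0 := by
    have hle : IsClosed {z : Euc s | z j ≤ 0} :=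
      isClosed_le (by fun_prop : Continuous fun w : Euc s => w j) continuous_const
    refine le_antisymm ((lintegral_mono_set (t := {z | z j ≤ 0}) ?_).trans_eq ?_) zero_le
    · rintro _ ⟨z, hz, rfl⟩
      have := hcoord z hz.1
      simp only [contraction, mem_ofPred_eq, PiLp.add_apply, PiLp.smul_apply, PiLp.sub_apply,
        smul_eq_mul, haj]
      linarith
    · rw [setLIntegral_congr_fun (g := fun _ => 0) hle.measurableSet, lintegral_zero]
      intro z hz
      simp [g', not_lt.2 (mem_ofPred_eq ▸ hz)]
  have hD : ∫⁻ z in S', ‖fderiv ℝ g' z‖ₑ ^ 2 ≤ ∫⁻ z in S, ‖fderiv ℝ g z‖ₑ ^ 2 := by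
    rw [← lintegral_indicator h.measurableSet]
    refine (setLIntegral_mono' hS'm fun z hz => ?_).trans (setLIntegral_le_lintegral S' _)
    rcases lt_or_ge 0 (z j) with hlt | hle
    · have hzS : z ∈ S := ⟨hz.1, fun i => by
        rcases eq_or_ne i j with rfl | hi
        · exact hlt.le
        · exact hz.2 i hi⟩
      rw [indicator_of_mem hzS, (hpos z hlt).fderiv_eq]
    · rw [(hneg z hz hle).fderiv_eq, ← ofReal_norm, fderiv_fun_const, Pi.zero_apply, norm_zero]
      simp
  have hSint : ∫⁻ z in S, ‖g z‖ₑ ^ 2 ≤ ∫⁻ z in S', ‖g' z‖ₑ ^ 2 := by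
    refine le_trans (le_of_eq ?_) (lintegral_mono_set hSS')
    refine setLIntegral_congr_fun h.measurableSet fun z hz => ?_
    rcases (hz.2 j).lt_or_eq with hlt | heq
    · simp only [(hpos z hlt).self_of_nhds]
    · simp only [(hneg z (hSS' hz) heq.ge).self_of_nhds, (hg0 z hz heq.symm).self_of_nhds,
        Pi.zero_apply]
  calc _ ≤ _ := h.setLIntegral_image_le φ
    _ ≤ (K : ℝ≥0∞) ^ s * (2 * (ρ ^ 2 * e ^ s * (K ^ 2 * K ^ s * energy s R φ))) := by
        gcongr
        refine hSint.trans (hcontr.trans ?_)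
        rw [hzero, mul_zero, zero_add]
        gcongr
        exact hD.trans (h.setLIntegral_fderiv_le hφ.1 hm)
    _ = _ := by push_cast; ring

end LocalParam

/-- The points of `R` with a local inequality form an open set. It is closed because a chart around
a limit point contains such a point, and `IsLocalParam.poincareOn_of_mem` spreads the inequality
over the chart. It contains the boundary points, hence every component. -/
theorem IsCompactManifold.exists_poincareOn_nhds (hR : IsCompactManifold s R)
    (hRb : ComponentsHaveBoundary s R) {x : Euc d} (hx : x ∈ R) : ∃ U ∈ 𝓝 x, PoincareOn s R U := by
  set G : Set R := {y | ∃ U ∈ 𝓝 (y : Euc d), PoincareOn s R U}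
  have hopen : IsOpen G := by
    refine isOpen_iff_mem_nhds.2 fun y ⟨U, hU, hP⟩ => ?_
    have h1 : ∀ᶠ z : R in 𝓝 y, U ∈ 𝓝 (z : Euc d) :=
      continuous_subtype_val.continuousAt.eventually (eventually_mem_nhds_iff.2 hU)
    filter_upwards [h1] with z hz using ⟨U, hz, hP⟩
  have hclosed : IsClosed G := by
    refine isClosed_of_closure_subset fun y hy => ?_
    obtain ⟨ψ, z₀, r, N, K, h, hyN, -⟩ := hR.exists_isLocalParam y.2
    obtain ⟨w, hwN, U, hU, hP⟩ := mem_closure_iff_nhds.1 hy (Subtype.val ⁻¹' N)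
      ((h.isOpen.preimage continuous_subtype_val).mem_nhds hyN)
    exact ⟨N, h.isOpen.mem_nhds hyN, h.poincareOn_of_mem hwN w.2 hU hP⟩
  obtain ⟨y, hy, hyb⟩ := hRb x hx
  rw [connectedComponentIn_eq_image hx] at hy
  obtain ⟨y, hy, rfl⟩ := hy
  have hyG : y ∈ G := by
    obtain ⟨ψ, z₀, r, N, K, h, hyN, -, hz₀, hb⟩ := hR.exists_isLocalParam y.2
    obtain ⟨j, hj⟩ := hb hyb
    exact ⟨N, h.isOpen.mem_nhds hyN, h.poincareOn_of_boundary hj hz₀⟩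
  have hxy : (⟨x, hx⟩ : R) ∈ connectedComponent y := by
    rw [← connectedComponent_eq hy]
    exact mem_connectedComponent
  exact IsClopen.connectedComponent_subset ⟨hclosed, hopen⟩ hyG hxy

/-- The Poincaré inequality for test functions. -/
theorem IsCompactManifold.poincareOn_self (hR : IsCompactManifold s R)
    (hRb : ComponentsHaveBoundary s R) : PoincareOn s R R := by
  refine hR.isCompact.induction_on (p := PoincareOn s R) ⟨0, fun φ _ _ => by simp⟩
    (fun U U' hU h => h.mono (by gcongr)) ?_ ?_
  · rintro U U' ⟨C, hC⟩ ⟨C', hC'⟩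
    refine ⟨C + C', fun φ hφ hm => ?_⟩
    rw [union_inter_distrib_right]
    refine (lintegral_union_le _ _ _).trans ?_
    rw [ENNReal.coe_add, add_mul]
    exact add_le_add (hC φ hφ hm) (hC' φ hφ hm)
  · intro x hx
    obtain ⟨U, hU, h⟩ := hR.exists_poincareOn_nhds hRb hx
    exact ⟨U, mem_nhdsWithin_of_mem_nhds hU, h⟩

end Poincare

/-! ### `H¹₀(R)` as a Hilbert space of gradients -/

section HilbertModel

open scoped MeasureTheory NNReal ENNReal

theorem Lp_enorm_sq {α E : Type*} [MeasurableSpace α] {μ : Measure α} [NormedAddCommGroup E]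
    (f : Lp E 2 μ) : ‖f‖ₑ ^ 2 = ∫⁻ x, ‖f x‖ₑ ^ 2 ∂μ := by
  rw [Lp.enorm_def, eLpNorm_eq_lintegral_rpow_enorm_toReal (by norm_num) (by norm_num),
    ← ENNReal.rpow_natCast, ← ENNReal.rpow_mul]
  simp

variable {d s : ℕ} {R : Set (Euc d)}

theorem IsTestFunction.add {φ χ : Euc d → ℝ} (hφ : IsTestFunction s R φ)
    (hχ : IsTestFunction s R χ) : IsTestFunction s R (fun x => φ x + χ x) := by
  refine ⟨hφ.1.add hχ.1, hφ.2.1.add hχ.2.1, fun x hx => ?_⟩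
  rcases tsupport_add φ χ hx.1 with h | h
  · exact hφ.2.2 ⟨h, hx.2⟩
  · exact hχ.2.2 ⟨h, hx.2⟩

theorem IsTestFunction.const_mul {φ : Euc d → ℝ} (hφ : IsTestFunction s R φ) (c : ℝ) :
    IsTestFunction s R (fun x => c * φ x) := by
  refine ⟨contDiff_const.mul hφ.1, hφ.2.1.mul_left, fun x hx => hφ.2.2 ⟨?_, hx.2⟩⟩
  exact tsupport_mul_subset_right hx.1

theorem IsTestFunction.zero : IsTestFunction s R (fun _ => 0) :=
  ⟨contDiff_const, HasCompactSupport.zero, fun x hx => by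
    have h : x ∈ tsupport (0 : Euc d → ℝ) := hx.1
    simp at h⟩

theorem IsTestFunction.differentiableWithinAt {φ : Euc d → ℝ} (hφ : IsTestFunction s R φ)
    (x : Euc d) : DifferentiableWithinAt ℝ φ R x :=
  (hφ.1.contDiffAt.differentiableAt one_ne_zero).differentiableWithinAt

/-- The pairs `(φ, ∇φ)`, for test functions `φ`, form a linear space. -/
theorem exists_isTestFunction_of_mem_span
    {w : Lp ℝ 2 (surfaceMeasure s R) × Lp (Euc d) 2 (surfaceMeasure s R)}
    (hw : w ∈ Submodule.span ℝ {w : Lp ℝ 2 (surfaceMeasure s R) × Lp (Euc d) 2 (surfaceMeasure s R) |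
      ∃ φ : Euc d → ℝ, IsTestFunction s R φ ∧
        w.1 =ᵐ[surfaceMeasure s R] φ ∧ w.2 =ᵐ[surfaceMeasure s R] surfGrad R φ}) :
    ∃ φ : Euc d → ℝ, IsTestFunction s R φ ∧
      w.1 =ᵐ[surfaceMeasure s R] φ ∧ w.2 =ᵐ[surfaceMeasure s R] surfGrad R φ := by
  induction hw using Submodule.span_induction with
  | mem w hw => exact hw
  | zero =>
    refine ⟨_, IsTestFunction.zero, Lp.coeFn_zero _ _ _, (Lp.coeFn_zero _ _ _).trans ?_⟩
    refine Eventually.of_forall fun x => ?_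
    have := surfGrad_const_mul (R := R) (x := x) (f := fun _ => (0 : ℝ)) 0
      (differentiableWithinAt_const 0)
    simp only [mul_zero, zero_smul] at this
    exact this.symm
  | add w v _ _ hw hv =>
    obtain ⟨φ, hφ, h1, h2⟩ := hw
    obtain ⟨χ, hχ, h3, h4⟩ := hv
    refine ⟨_, hφ.add hχ, ?_, ?_⟩
    · filter_upwards [Lp.coeFn_add w.1 v.1, h1, h3] with x e1 e2 e3
      rw [Prod.fst_add, e1, Pi.add_apply, e2, e3]
    · filter_upwards [Lp.coeFn_add w.2 v.2, h2, h4] with x e1 e2 e3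
      rw [Prod.snd_add, e1, Pi.add_apply, e2, e3,
        surfGrad_add (hφ.differentiableWithinAt x) (hχ.differentiableWithinAt x)]
  | smul c w _ hw =>
    obtain ⟨φ, hφ, h1, h2⟩ := hw
    refine ⟨_, hφ.const_mul c, ?_, ?_⟩
    · filter_upwards [Lp.coeFn_smul c w.1, h1] with x e1 e2
      rw [Prod.smul_fst, e1, Pi.smul_apply, e2, smul_eq_mul]
    · filter_upwards [Lp.coeFn_smul c w.2, h2] with x e1 e2
      rw [Prod.smul_snd, e1, Pi.smul_apply, e2, surfGrad_const_mul c (hφ.differentiableWithinAt x)]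

/-- The Poincaré inequality in `H¹₀(R)`. -/
theorem IsCompactManifold.exists_poincare_const (hR : IsCompactManifold s R)
    (hRb : ComponentsHaveBoundary s R) :
    ∃ C : ℝ, 0 ≤ C ∧ ∀ u : H10 s R, ‖u.1.1‖ ≤ C * ‖grad u‖ := by
  obtain ⟨C, hC⟩ := hR.poincareOn_self hRb
  refine ⟨√C, Real.sqrt_nonneg _, fun u => ?_⟩
  have hclosed : IsClosed {w : Lp ℝ 2 (surfaceMeasure s R) × Lp (Euc d) 2 (surfaceMeasure s R) |
      ‖w.1‖ ≤ √C * ‖w.2‖} := isClosed_le (by fun_prop) (by fun_prop)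
  have hu : u.1 ∈ closure ((Submodule.span ℝ {w : Lp ℝ 2 (surfaceMeasure s R) ×
      Lp (Euc d) 2 (surfaceMeasure s R) | ∃ φ : Euc d → ℝ, IsTestFunction s R φ ∧
        w.1 =ᵐ[surfaceMeasure s R] φ ∧ w.2 =ᵐ[surfaceMeasure s R] surfGrad R φ} :
      Submodule ℝ _) : Set (Lp ℝ 2 (surfaceMeasure s R) × Lp (Euc d) 2 (surfaceMeasure s R))) := u.2
  refine closure_minimal (fun w hw => ?_) hclosed hu
  obtain ⟨φ, hφ, h1, h2⟩ := exists_isTestFunction_of_mem_span hw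
  have h3 := hC φ hφ ((Lp.aestronglyMeasurable w.2).congr h2)
  have e1 : ‖w.1‖ₑ ^ 2 = ∫⁻ x in R ∩ R, ‖φ x‖ₑ ^ 2 ∂(μHE[s] : Measure (Euc d)) := by
    rw [Lp_enorm_sq, inter_self]
    refine lintegral_congr_ae ?_
    filter_upwards [h1] with x hx
    rw [hx]
  have e2 : ‖w.2‖ₑ ^ 2 = energy s R φ := by
    rw [Lp_enorm_sq]
    refine lintegral_congr_ae ?_
    filter_upwards [h2] with x hx
    rw [hx]
  rw [← e1, ← e2] at h3
  have h4 : ‖w.1‖ ^ 2 ≤ C * ‖w.2‖ ^ 2 := by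
    have h5 := ENNReal.toReal_mono (by finiteness) h3
    simpa using h5
  exact (sq_le_sq₀ (norm_nonneg _) (by positivity)).1 (by rw [mul_pow, Real.sq_sqrt C.coe_nonneg]; exact h4)

/-- The gradients of the elements of `H¹₀(R)`, as a subspace of `L²(R; ℝᵈ)`. -/
def gradRange (s : ℕ) (R : Set (Euc d)) : Submodule ℝ (Lp (Euc d) 2 (surfaceMeasure s R)) :=
  (H10 s R).map (LinearMap.snd ℝ _ _)

/-- `H¹₀(R)` with the inner product of the gradients is a Hilbert space, embedded in `L²(R)`. -/
theorem IsCompactManifold.exists_hilbertModel (hR : IsCompactManifold s R)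
    (hRb : ComponentsHaveBoundary s R) :
    CompleteSpace (gradRange s R) ∧
      ∃ (e : H10 s R ≃ₗ[ℝ] gradRange s R) (J : gradRange s R →L[ℝ] Lp ℝ 2 (surfaceMeasure s R)),
        (∀ u, (e u : Lp (Euc d) 2 (surfaceMeasure s R)) = grad u) ∧ ∀ u, J (e u) = u.1.1 := by
  obtain ⟨C, hC0, hC⟩ := hR.exists_poincare_const hRb
  set p : H10 s R →ₗ[ℝ] gradRange s R :=
    (LinearMap.snd ℝ (Lp ℝ 2 (surfaceMeasure s R))
      (Lp (Euc d) 2 (surfaceMeasure s R))).submoduleMap (H10 s R)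
  have hp : ∀ u, (p u : Lp (Euc d) 2 (surfaceMeasure s R)) = grad u := fun u => rfl
  have hsurj : Function.Surjective p := LinearMap.submoduleMap_surjective _ _
  -- The norm inherited from the product is a maximum, not Hilbertian. By Poincaré it is equivalent
  -- to the gradient norm, so `H10 s R` can be replaced by its space of gradients, and completeness
  -- carries over.
  have hbound : ∀ u, ‖u‖ ≤ max C 1 * ‖p u‖ := fun u => by
    have h1 : ‖p u‖ = ‖grad u‖ := rfl
    have h2 : ‖u‖ = max ‖u.1.1‖ ‖grad u‖ := rfl
    rw [h1, h2, max_mul_of_nonneg _ _ (norm_nonneg _), one_mul]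
    exact max_le_max (hC u) le_rfl
  have hinj : Function.Injective p := (injective_iff_map_eq_zero p).2 fun u hu => by
    have := hbound u
    rw [hu, norm_zero, mul_zero] at this
    exact norm_le_zero_iff.1 this
  let e := LinearEquiv.ofBijective p ⟨hinj, hsurj⟩
  have he : ∀ u, e u = p u := fun u => rfl
  have hcomp : CompleteSpace (H10 s R) :=
    (Submodule.isClosed_topologicalClosure _).completeSpace_coe
  have hanti : AntilipschitzWith (Real.toNNReal (max C 1)) p :=
    AddMonoidHomClass.antilipschitz_of_bound p fun u => by
      rw [Real.coe_toNNReal _ (le_max_of_le_right zero_le_one)]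
      exact hbound u
  have hlip : LipschitzWith 1 p := AddMonoidHomClass.lipschitz_of_bound_nnnorm p 1 fun u => by
    rw [one_mul]
    exact norm_snd_le u.1
  refine ⟨?_, e, LinearMap.mkContinuous
    ((LinearMap.fst ℝ _ _ ∘ₗ (H10 s R).subtype) ∘ₗ e.symm.toLinearMap) C ?_, hp, ?_⟩
  · have h := hanti.isComplete_range hlip.uniformContinuous
    rw [hsurj.range_eq] at h
    exact completeSpace_iff_isComplete_univ.2 h
  · intro w
    obtain ⟨u, rfl⟩ := e.surjective w
    change ‖(e.symm (e u)).1.1‖ ≤ _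
    rw [e.symm_apply_apply]
    exact hC u
  · intro u
    change (e.symm (e u)).1.1 = _
    rw [e.symm_apply_apply]

end HilbertModel

/-! ### Passage from subsets of `ℝᵈ` to compact types -/

section Transfer

open scoped MeasureTheory

variable {d p s t : ℕ} {V R : Set (Euc d)}

/-- The surface measure of `R`, as a measure on the type `R`. -/
def surfaceMeasureOn (s : ℕ) (R : Set (Euc d)) : Measure R :=
  Measure.comap Subtype.val (μHE[s] : Measure (Euc d))

theorem measurePreserving_val (hR : MeasurableSet R) :
    MeasurePreserving (Subtype.val : R → Euc d) (surfaceMeasureOn s R) (surfaceMeasure s R) :=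
  ⟨measurable_subtype_coe, map_comap_subtype_coe hR _⟩

theorem IsCompactManifold.isFiniteMeasureOn (hR : IsCompactManifold s R) :
    IsFiniteMeasure (surfaceMeasureOn s R) := by
  refine ⟨?_⟩
  rw [← preimage_univ (f := (Subtype.val : R → Euc d)),
    (measurePreserving_val hR.measurableSet).measure_preimage MeasurableSet.univ.nullMeasurableSet]
  exact hR.surfaceMeasure_lt_top

/-- Elements of `L²(R)` as functions on the type `R`. -/
def restrictLp (hR : MeasurableSet R) :
    Lp ℝ 2 (surfaceMeasure s R) →ₗᵢ[ℝ] Lp ℝ 2 (surfaceMeasureOn s R) :=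
  Lp.compMeasurePreservingₗᵢ ℝ Subtype.val (measurePreserving_val hR)

theorem coeFn_restrictLp (hR : MeasurableSet R) (u : Lp ℝ 2 (surfaceMeasure s R)) :
    restrictLp hR u =ᵐ[surfaceMeasureOn s R] fun y => u (y : Euc d) :=
  Lp.coeFn_compMeasurePreserving u (measurePreserving_val hR)

theorem opA_eq_integral (hR : MeasurableSet R) (H : Euc p → Euc d → Euc d → ℝ) (m : Euc p)
    (u : H10 s R) (x : Euc d) :
    opA H m u x = ∫ y : R, restrictLp hR u.1.1 y * H m x y ∂(surfaceMeasureOn s R) := by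
  change ∫ y in R, H m x y * u.1.1 y ∂(μHE[s] : Measure (Euc d)) = _
  rw [← integral_subtype_comap hR]
  refine integral_congr_ae ?_
  filter_upwards [coeFn_restrictLp hR u.1.1] with y hy
  rw [hy, mul_comm]

theorem ae_surfaceMeasure_iff (hV : MeasurableSet V) {q : Euc d → Prop} :
    (∀ᵐ x ∂(surfaceMeasure t V), q x) ↔ ∀ᵐ x : V ∂(surfaceMeasureOn t V), q x :=
  ae_restrict_iff_subtype hV

variable [CompactSpace V] [CompactSpace R] [IsFiniteMeasure (surfaceMeasureOn t V)]
  [IsFiniteMeasure (surfaceMeasureOn s R)]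

/-- The class in `L²(V)` of a continuous function on `V`. -/
abbrev toL2 (t : ℕ) (V : Set (Euc d)) [CompactSpace V] [IsFiniteMeasure (surfaceMeasureOn t V)] :
    C(V, ℝ) →L[ℝ] Lp ℝ 2 (surfaceMeasureOn t V) :=
  ContinuousMap.toLp 2 (surfaceMeasureOn t V) ℝ

theorem inner_toL2 (hV : MeasurableSet V) {f g : Euc d → ℝ} {F G : C(V, ℝ)}
    (hf : ∀ x : V, f x = F x) (hg : ∀ x : V, g x = G x) :
    inner ℝ (toL2 t V F) (toL2 t V G) = ∫ x, f x * g x ∂(surfaceMeasure t V) := by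
  change _ = ∫ x in V, f x * g x ∂(μHE[t] : Measure (Euc d))
  rw [L2.inner_def, ← integral_subtype_comap hV]
  refine integral_congr_ae ?_
  filter_upwards [ContinuousMap.coeFn_toLp (p := 2) (𝕜 := ℝ) (surfaceMeasureOn t V) F,
    ContinuousMap.coeFn_toLp (p := 2) (𝕜 := ℝ) (surfaceMeasureOn t V) G] with x h1 h2
  rw [h1, h2, hf, hg]
  simp [mul_comm]

theorem normV_eq_norm_toL2 (hV : MeasurableSet V) {f : Euc d → ℝ} {F : C(V, ℝ)}
    (hf : ∀ x : V, f x = F x) : normV t V f = ‖toL2 t V F‖ := by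
  rw [norm_eq_sqrt_real_inner, inner_toL2 hV hf hf, normV]
  simp only [sq]

theorem ae_eq_iff_toL2_eq (hV : MeasurableSet V) {f g : Euc d → ℝ} {F G : C(V, ℝ)}
    (hf : ∀ x : V, f x = F x) (hg : ∀ x : V, g x = G x) :
    f =ᵐ[surfaceMeasure t V] g ↔ toL2 t V F = toL2 t V G := by
  rw [Filter.EventuallyEq, ae_surfaceMeasure_iff hV, Lp.ext_iff]
  have h1 := ContinuousMap.coeFn_toLp (p := 2) (𝕜 := ℝ) (surfaceMeasureOn t V) F
  have h2 := ContinuousMap.coeFn_toLp (p := 2) (𝕜 := ℝ) (surfaceMeasureOn t V) G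
  constructor
  · intro h
    filter_upwards [h, h1, h2] with x h h1 h2
    rw [h1, h2, ← hf, ← hg, h]
  · intro h
    filter_upwards [h, h1, h2] with x h h1 h2
    rw [hf, hg, ← h1, ← h2, h]

end Transfer

/-! ### Increments of a bilinear expression in parameter and source -/

section BilinearBound

variable {Θ X Y W : Type*} [NormedAddCommGroup Θ] [NormedSpace ℝ Θ] [NormedAddCommGroup X]
  [NormedSpace ℝ X] [NormedAddCommGroup Y] [NormedSpace ℝ Y] [NormedAddCommGroup W]
  [NormedSpace ℝ W]

theorem norm_bilinear_sub_le (Φ : X →L[ℝ] Y →L[ℝ] W) (z z' : X) (a b : Y) :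
    ‖Φ z a - Φ z' b‖ ≤ ‖Φ‖ * (‖z‖ * ‖a - b‖ + ‖z - z'‖ * ‖b‖) := by
  have h : Φ z a - Φ z' b = Φ z (a - b) + Φ (z - z') b := by simp
  rw [h, mul_add, ← mul_assoc, ← mul_assoc]
  exact (norm_add_le _ _).trans (add_le_add (Φ.le_opNorm₂ _ _) (Φ.le_opNorm₂ _ _))

/-- Meant for the kernel and for its `x`-gradient in the role of `Z`: it bounds `sup |f|` and `sup
|∇f|` by the same quantity, linear in the increments. -/
theorem exists_norm_bilinear_sub_le {B : Set Θ} (hB : IsCompact B) {Z : Θ → X}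
    (hZ : ∀ m ∈ B, ∃ D : Θ →L[ℝ] X, HasStrictFDerivAt Z D m) (Φ : X →L[ℝ] Y →L[ℝ] W) :
    ∃ K, 0 ≤ K ∧ ∀ m ∈ B, ∀ m' ∈ B, ∀ a b,
      ‖Φ (Z m) a - Φ (Z m') b‖ ≤ K * (‖a - b‖ + ‖m - m'‖ * ‖b‖) := by
  choose! D hD using hZ
  obtain ⟨L, hL0, hL⟩ := exists_norm_sub_le_of_hasStrictFDerivAt hB hD
  obtain ⟨M, hM⟩ := hB.exists_bound_of_continuousOn (f := Z)
    fun m hm => (hD m hm).continuousAt.continuousWithinAt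
  refine ⟨‖Φ‖ * max M L, by positivity, fun m hm m' hm' a b => ?_⟩
  refine (norm_bilinear_sub_le Φ _ _ _ _).trans ?_
  rw [mul_assoc, mul_add (max M L), ← mul_assoc (max M L) ‖m - m'‖]
  gcongr
  · exact (hM m hm).trans (le_max_left _ _)
  · exact (hL m hm m' hm').trans (by gcongr; exact le_max_right _ _)

end BilinearBound

/-! ### The operators `𝒜ₘ`, their parameter derivatives and surface gradients -/

section Kernel

variable {d p s t : ℕ} {V R : Set (Euc d)} {B B' : Set (Euc p)}
  {H : Euc p → Euc d → Euc d → ℝ}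

/-- The kernel `H m` as a continuous function on `V × R`. -/
def kernelMap (V R : Set (Euc d)) (H : Euc p → Euc d → Euc d → ℝ) (m : Euc p) : C(V × R, ℝ) :=
  toContinuousMap fun k => H m k.1 k.2

/-- The gradient of the kernel `H m` in its first variable, as a continuous function on `V × R`. -/
def gradKernelMap (V R : Set (Euc d)) (H : Euc p → Euc d → Euc d → ℝ) (m : Euc p) :
    C(V × R, Euc d) :=
  toContinuousMap fun k => surfGrad V (fun x' => H m x' k.2) k.1

theorem KernelRegularity.continuous_kernel (hH : KernelRegularity V R B B' H) {m : Euc p}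
    (hm : m ∈ B) : Continuous fun k : V × R => H m k.1 k.2 :=
  hH.cont.comp_continuous (f := fun k : V × R => (m, (k.1 : Euc d), (k.2 : Euc d))) (by fun_prop)
    fun k => ⟨hm, k.1.2, k.2.2⟩

theorem KernelRegularity.continuous_gradKernel (hH : KernelRegularity V R B B' H) {m : Euc p}
    (hm : m ∈ B) : Continuous fun k : V × R => surfGrad V (fun x' => H m x' k.2) k.1 :=
  hH.cont_grad_x.comp_continuous (f := fun k : V × R => (m, (k.1 : Euc d), (k.2 : Euc d)))
    (by fun_prop) fun k => ⟨hm, k.1.2, k.2.2⟩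

variable [CompactSpace V] [CompactSpace R]

theorem KernelRegularity.exists_hasStrictFDerivAt_kernelMap (hH : KernelRegularity V R B B' H)
    {m : Euc p} (hm : m ∈ B) :
    (∀ᶠ m' in 𝓝 m, Continuous fun k : V × R => H m' k.1 k.2) ∧ ∃ D : Euc p →L[ℝ] C(V × R, ℝ),
      HasStrictFDerivAt (kernelMap V R H) D m := by
  have h := exists_hasStrictFDerivAt_toContinuousMap (G := fun m (k : V × R) => H m k.1 k.2)
    (fun m hm k => hH.diff_m m hm k.1 k.1.2 k.2 k.2.2)
    (hH.cont_m.comp (f := fun z : Euc p × V × R => (z.1, (z.2.1 : Euc d), (z.2.2 : Euc d)))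
      (by fun_prop) fun z hz => ⟨hz.1, z.2.1.2, z.2.2.2⟩)
    hH.isOpen (hH.subset hm) (hH.continuous_kernel hm)
  exact ⟨h.1, h.2.imp fun D hD => hD.1⟩

theorem KernelRegularity.exists_hasStrictFDerivAt_gradKernelMap
    (hH : KernelRegularity V R B B' H) {m : Euc p} (hm : m ∈ B) :
    ∃ D : Euc p →L[ℝ] C(V × R, Euc d), HasStrictFDerivAt (gradKernelMap V R H) D m := by
  have h := exists_hasStrictFDerivAt_toContinuousMap
    (G := fun m (k : V × R) => surfGrad V (fun x' => H m x' k.2) k.1)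
    (fun m hm k => hH.diff_m_grad_x m hm k.1 k.1.2 k.2 k.2.2)
    (hH.cont_m_grad_x.comp (f := fun z : Euc p × V × R => (z.1, (z.2.1 : Euc d), (z.2.2 : Euc d)))
      (by fun_prop) fun z hz => ⟨hz.1, z.2.1.2, z.2.2.2⟩)
    hH.isOpen (hH.subset hm) (hH.continuous_gradKernel hm)
  exact h.2.imp fun D hD => hD.1

variable [IsFiniteMeasure (surfaceMeasureOn s R)]

theorem opA_eq_kernelOp (hR : MeasurableSet R) {m : Euc p}
    (hm : Continuous fun k : V × R => H m k.1 k.2) (u : H10 s R) (x : V) :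
    opA H m u x =
      kernelOp V R ℝ (surfaceMeasureOn s R) (kernelMap V R H m) (restrictLp hR u.1.1) x := by
  rw [opA_eq_integral hR, kernelOp_apply]
  refine integral_congr_ae (Eventually.of_forall fun y => ?_)
  exact congrArg (_ * ·) (toContinuousMap_apply hm (x, y)).symm

/-- Evaluating the operator at `x` is a continuous linear functional of the kernel, so
differentiability of the kernel in `C(V × R)` suffices. `hm` guarantees that near `m` the map
`kernelMap` is the true kernel and not its default `0`. -/
theorem opDA_eq_kernelOp (hR : MeasurableSet R) {m : Euc p}
    (hm : ∀ᶠ m' in 𝓝 m, Continuous fun k : V × R => H m' k.1 k.2) {D : Euc p →L[ℝ] C(V × R, ℝ)}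
    (hD : HasFDerivAt (kernelMap V R H) D m) (q : Euc p) (u : H10 s R) (x : V) :
    opDA H q m u x = kernelOp V R ℝ (surfaceMeasureOn s R) (D q) (restrictLp hR u.1.1) x := by
  let ev : C(V × R, ℝ) →L[ℝ] ℝ := (ContinuousMap.evalCLM ℝ x) ∘L
    ((kernelOp V R ℝ (surfaceMeasureOn s R)).flip (restrictLp hR u.1.1))
  have h : HasFDerivAt (fun m' => opA H m' u x) (ev ∘L D) m := by
    refine (ev.hasFDerivAt.comp m hD).congr_of_eventuallyEq ?_
    filter_upwards [hm] with m' hm'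
    rw [opA_eq_kernelOp hR hm']
    rfl
  exact (h.hasLineDerivAt q).lineDeriv

theorem surfGrad_opA (hV : IsCompactManifold t V) (hR : MeasurableSet R)
    (hH : KernelRegularity V R B B' H) {m : Euc p} (hm : m ∈ B) (u : H10 s R) (x : V) :
    DifferentiableWithinAt ℝ (opA H m u) V x ∧ surfGrad V (opA H m u) x =
      kernelOp V R (Euc d) (surfaceMeasureOn s R) (gradKernelMap V R H m) (restrictLp hR u.1.1)
        x := by
  have hk := hH.continuous_kernel hm
  have hg := hH.continuous_gradKernel hm
  have hgy : ∀ (y : R) (x : V), gradKernelMap V R H m (x, y) =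
      surfGrad V (fun x' => H m x' y) x := fun y x => toContinuousMap_apply hg (x, y)
  have e : opA H m u =
      fun x => ∫ y : R, restrictLp hR u.1.1 y * H m x y ∂(surfaceMeasureOn s R) :=
    funext (opA_eq_integral hR H m u)
  rw [e, kernelOp_apply]
  generalize restrictLp hR u.1.1 = w
  have hw : Integrable w (surfaceMeasureOn s R) := (Lp.memLp w).integrable (by norm_num)
  have hint : ∀ x ∈ V, Integrable (fun y : R => w y * H m x y) (surfaceMeasureOn s R) :=
    fun x hx => by
      have hc : Continuous fun y : R => H m x y :=
        hk.comp (by fun_prop : Continuous fun y : R => ((⟨x, hx⟩ : V), y))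
      exact integrable_smul_of_continuous _ w ⟨_, hc⟩
  have hmeas : AEStronglyMeasurable (fun y : R => surfGrad V (fun x' => H m x' y) x)
      (surfaceMeasureOn s R) :=
    (hg.comp (by fun_prop : Continuous fun y : R => (x, y))).aestronglyMeasurable
  have hbd : ∀ y : R, ∀ x ∈ V, ‖surfGrad V (fun x' => H m x' y) x‖ ≤ ‖gradKernelMap V R H m‖ :=
    fun y x hx => by
      rw [← hgy y ⟨x, hx⟩]
      exact ContinuousMap.norm_coe_le_norm _ _
  simp only [hgy]
  exact hV.surfGrad_integral (F := fun x (y : R) => H m x y) hw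
    (fun y x hx => hH.diff_x m (hH.subset hm) x hx y y.2) hbd hint x.2 hmeas

end Kernel

/-! ### Quadrature error for squares -/

section Quadrature

variable {d t : ℕ} {V : Set (Euc d)} [CompactSpace V] {M : ℕ → ℕ}
  {P : (k : ℕ) → Fin (M k) → Euc d} {c : (k : ℕ) → Fin (M k) → ℝ} {h : ℕ → ℝ}

/-- The rule is applied to `f²`, whose gradient is `2 f ∇f`; the error is thus quadratic in `f`. No
sign of `h k` is assumed, hence the absolute value. -/
theorem IsQuadrature.abs_discSq_sub_le (hQ : IsQuadrature t V M P c h) {f : Euc d → ℝ}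
    {F : C(V, ℝ)} {G : C(V, Euc d)} (hF : ∀ x : V, f x = F x)
    (hf : ∀ x : V, DifferentiableWithinAt ℝ f V x) (hG : ∀ x : V, surfGrad V f x = G x) (k : ℕ) :
    |discSq M P c k f - normV t V f ^ 2| ≤ |h k| * (2 * (‖F‖ * ‖G‖)) := by
  have hgrad : ∀ x : V, surfGrad V (fun y => f y ^ 2) x = (2 * F x) • G x := fun x => by
    rw [surfGrad_sq (hf x), hF, hG]
  have hC1 : IsC1On V (fun y => f y ^ 2) := by
    refine ⟨fun x hx => (hf ⟨x, hx⟩).pow 2, continuousOn_iff_continuous_domRestrict.2 ?_⟩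
    have : V.domRestrict (surfGrad V fun y => f y ^ 2) = fun x => (2 * F x) • G x := funext hgrad
    rw [this]
    fun_prop
  have hnorm : normV t V f ^ 2 = ∫ x, f x ^ 2 ∂(surfaceMeasure t V) :=
    Real.sq_sqrt (integral_nonneg fun x => sq_nonneg _)
  have hdisc : discSq M P c k f = ∑ j, c k j * f (P k j) ^ 2 := by simp only [discSq, sq_abs]
  rw [hnorm, hdisc]
  refine (hQ.error_le k _ hC1).trans ?_
  have hsup0 : 0 ≤ ⨆ x : V, ‖surfGrad V (fun y => f y ^ 2) x‖ :=
    Real.iSup_nonneg fun x => norm_nonneg _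
  refine mul_le_mul (le_abs_self _) (Real.iSup_le (fun x => ?_) (by positivity)) hsup0
    (abs_nonneg _)
  rw [hgrad, norm_smul, norm_mul, Real.norm_ofNat, mul_assoc]
  gcongr
  · exact F.norm_coe_le_norm x
  · exact G.norm_coe_le_norm x

end Quadrature

theorem norm_eq_gradNorm {d s : ℕ} {R : Set (Euc d)} {𝓗 : Type*} [NormedAddCommGroup 𝓗]
    [InnerProductSpace ℝ 𝓗] {e : H10 s R → 𝓗}
    (he : ∀ u v, inner ℝ (e u) (e v) = gradInner u v)
    (u : H10 s R) : ‖e u‖ = gradNorm u := by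
  rw [norm_eq_sqrt_real_inner, he, gradInner, ← norm_eq_sqrt_real_inner, gradNorm]

/-! ### The abstract theory applied to `𝒜ₘ` -/

section Model

variable {d p s t : ℕ} {V R : Set (Euc d)} {B B' : Set (Euc p)}
  {H : Euc p → Euc d → Euc d → ℝ} [CompactSpace V] [CompactSpace R]
  [IsFiniteMeasure (surfaceMeasureOn s R)]
  {𝓗 : Type*} [NormedAddCommGroup 𝓗] [InnerProductSpace ℝ 𝓗]

variable {hR : MeasurableSet R} {e : H10 s R ≃ₗ[ℝ] 𝓗}
  {ι : 𝓗 →L[ℝ] Lp ℝ 2 (surfaceMeasureOn s R)}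

/-- The difference and its gradient are both bounded linearly by `gradNorm (u - v) + ‖m - m'‖ *
gradNorm v`, so their product yields the square. -/
theorem exists_abs_discSq_opA_sub_le (hV : IsCompactManifold t V) (hB : IsCompact B)
    (hH : KernelRegularity V R B B' H)
    (he : ∀ u v, inner ℝ (e u) (e v) = gradInner u v) (hι : ∀ u, ι (e u) = restrictLp hR u.1.1)
    {M : ℕ → ℕ} {P : (k : ℕ) → Fin (M k) → Euc d} {c : (k : ℕ) → Fin (M k) → ℝ} {h : ℕ → ℝ}
    (hQ : IsQuadrature t V M P c h) :
    ∃ K, 0 ≤ K ∧ ∀ m ∈ B, ∀ m' ∈ B, ∀ u v : H10 s R, ∀ k,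
      |discSq M P c k (fun x => opA H m u x - opA H m' v x) -
        normV t V (fun x => opA H m u x - opA H m' v x) ^ 2| ≤
          |h k| * (K * (gradNorm (u - v) + ‖m - m'‖ * gradNorm v) ^ 2) := by
  have hnorm := norm_eq_gradNorm he
  let Φ := ((ContinuousLinearMap.compL ℝ 𝓗 (Lp ℝ 2 (surfaceMeasureOn s R)) C(V, ℝ)).flip ι) ∘L
    kernelOp V R ℝ (surfaceMeasureOn s R)
  let Ψ := ((ContinuousLinearMap.compL ℝ 𝓗 (Lp ℝ 2 (surfaceMeasureOn s R)) C(V, Euc d)).flip ι)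
    ∘L kernelOp V R (Euc d) (surfaceMeasureOn s R)
  obtain ⟨K, hK0, hK⟩ := exists_norm_bilinear_sub_le hB
    (fun m hm => (hH.exists_hasStrictFDerivAt_kernelMap hm).2) Φ
  obtain ⟨L, hL0, hL⟩ := exists_norm_bilinear_sub_le hB
    (fun m hm => hH.exists_hasStrictFDerivAt_gradKernelMap hm) Ψ
  have hΦ : ∀ m ∈ B, ∀ u (x : V), opA H m u x = Φ (kernelMap V R H m) (e u) x :=
    fun m hm u x => by
      rw [opA_eq_kernelOp hR (hH.continuous_kernel hm) u x, ← hι]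
      rfl
  have hΨ : ∀ m ∈ B, ∀ u (x : V), DifferentiableWithinAt ℝ (opA H m u) V x ∧
      surfGrad V (opA H m u) x = Ψ (gradKernelMap V R H m) (e u) x := fun m hm u x => by
    have := surfGrad_opA hV hR hH hm u x
    rw [← hι] at this
    exact this
  refine ⟨2 * (K * L), by positivity, fun m hm m' hm' u v k => ?_⟩
  refine (hQ.abs_discSq_sub_le (f := fun x => opA H m u x - opA H m' v x)
    (F := Φ (kernelMap V R H m) (e u) - Φ (kernelMap V R H m') (e v))
    (G := Ψ (gradKernelMap V R H m) (e u) - Ψ (gradKernelMap V R H m') (e v))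
    (fun x => ?_) (fun x => (hΨ m hm u x).1.sub (hΨ m' hm' v x).1) (fun x => ?_) k).trans ?_
  · rw [hΦ m hm, hΦ m' hm', ContinuousMap.sub_apply]
  · rw [ContinuousMap.sub_apply, ← (hΨ m hm u x).2, ← (hΨ m' hm' v x).2]
    exact surfGrad_sub (hΨ m hm u x).1 (hΨ m' hm' v x).1
  · have h1 := hK m hm m' hm' (e u) (e v)
    have h2 := hL m hm m' hm' (e u) (e v)
    rw [← map_sub, hnorm, hnorm] at h1 h2
    refine mul_le_mul_of_nonneg_left ?_ (abs_nonneg _)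
    refine (mul_le_mul_of_nonneg_left (mul_le_mul h1 h2 (norm_nonneg _)
      ((norm_nonneg _).trans h1)) zero_le_two).trans_eq ?_
    ring

variable [IsFiniteMeasure (surfaceMeasureOn t V)]

variable (t V) in
/-- The operator from `𝓗` to `L²(V)` with a given kernel, where `ι` maps `𝓗` to `L²(R)`. -/
def modelOp (ι : 𝓗 →L[ℝ] Lp ℝ 2 (surfaceMeasureOn s R)) :
    C(V × R, ℝ) →L[ℝ] 𝓗 →L[ℝ] Lp ℝ 2 (surfaceMeasureOn t V) :=
  (ContinuousLinearMap.compL ℝ 𝓗 C(V, ℝ) (Lp ℝ 2 (surfaceMeasureOn t V)) (toL2 t V)) ∘L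
    ((ContinuousLinearMap.compL ℝ 𝓗 (Lp ℝ 2 (surfaceMeasureOn s R)) C(V, ℝ)).flip ι) ∘L
      kernelOp V R ℝ (surfaceMeasureOn s R)

theorem modelOp_apply (ι : 𝓗 →L[ℝ] Lp ℝ 2 (surfaceMeasureOn s R)) (κ : C(V × R, ℝ)) (w : 𝓗) :
    modelOp t V ι κ w = toL2 t V (kernelOp V R ℝ (surfaceMeasureOn s R) κ (ι w)) := rfl

theorem isCompactOperator_modelOp (ι : 𝓗 →L[ℝ] Lp ℝ 2 (surfaceMeasureOn s R))
    (κ : C(V × R, ℝ)) : IsCompactOperator (modelOp t V ι κ) :=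
  ((isCompactOperator_kernelOp (surfaceMeasureOn s R) κ).comp_clm ι).clm_comp (toL2 t V)

theorem normV_opA_sub (hV : IsCompactManifold t V) (hH : KernelRegularity V R B B' H)
    (hι : ∀ u, ι (e u) = restrictLp hR u.1.1) {m m' : Euc p} (hm : m ∈ B) (hm' : m' ∈ B)
    (u v : H10 s R) :
    normV t V (fun x => opA H m u x - opA H m' v x) =
      ‖modelOp t V ι (kernelMap V R H m) (e u) - modelOp t V ι (kernelMap V R H m') (e v)‖ := by
  rw [modelOp_apply, modelOp_apply, hι, hι, ← map_sub]
  refine normV_eq_norm_toL2 hV.measurableSet fun x => ?_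
  rw [ContinuousMap.sub_apply, opA_eq_kernelOp hR (hH.continuous_kernel hm) u x,
    opA_eq_kernelOp hR (hH.continuous_kernel hm') v x]

theorem normV_opA (hV : IsCompactManifold t V) (hH : KernelRegularity V R B B' H)
    (hι : ∀ u, ι (e u) = restrictLp hR u.1.1) {m : Euc p} (hm : m ∈ B) (u : H10 s R) :
    normV t V (opA H m u) = ‖modelOp t V ι (kernelMap V R H m) (e u)‖ := by
  rw [modelOp_apply, hι]
  exact normV_eq_norm_toL2 hV.measurableSet (opA_eq_kernelOp hR (hH.continuous_kernel hm) u)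

variable [CompleteSpace 𝓗]

/-- Tested against all `φ`, the weak eigenvector equation is the one for `T† T` in the Hilbert
model. Only this inclusion is needed. -/
theorem mem_highSpan_of_mem_spaceE (hV : IsCompactManifold t V)
    (hH : KernelRegularity V R B B' H)
    (he : ∀ u v, inner ℝ (e u) (e v) = gradInner u v) (hι : ∀ u, ι (e u) = restrictLp hR u.1.1)
    {β : ℝ} {m : Euc p} (hm : m ∈ B) {u : H10 s R} (hu : u ∈ spaceE t s V R H β m) :
    e u ∈ highSpan (modelOp t V ι (kernelMap V R H m)) β := by
  suffices spaceE t s V R H β m ≤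
      (highSpan (modelOp t V ι (kernelMap V R H m)) β).comap e.toLinearMap from this hu
  refine Submodule.span_le.2 ?_
  rintro u ⟨l, hl, -, hu⟩
  refine mem_spectralSpan_of_apply_eq hl (ext_inner_right ℝ fun w => ?_)
  obtain ⟨φ, rfl⟩ := e.surjective w
  have h1 := hu φ
  rw [← he, map_smul] at h1
  refine Eq.trans ?_ h1.symm
  change inner ℝ (normalOp _ (e u)) (e φ) = _
  rw [inner_normalOp, modelOp_apply, modelOp_apply, hι, hι]
  exact inner_toL2 hV.measurableSet (opA_eq_kernelOp hR (hH.continuous_kernel hm) u)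
    (opA_eq_kernelOp hR (hH.continuous_kernel hm) φ)

theorem exists_continuousStability (hV : IsCompactManifold t V) (hB : IsCompact B)
    (hH : KernelRegularity V R B B' H) (hU₁ : UniqueParameter t s V R B H)
    (hU₂ : UniqueDerivative t s V R B H)
    (he : ∀ u v, inner ℝ (e u) (e v) = gradInner u v) (hι : ∀ u, ι (e u) = restrictLp hR u.1.1)
    {A₁ β : ℝ} (hA₁ : 0 < A₁) (hβ : 0 < β) (A₂ : ℝ) :
    ∃ C, 0 < C ∧ ContinuousStability t s V R B H β A₁ A₂ C := by
  have hex : ∀ m ∈ B, ∃ D : Euc p →L[ℝ] C(V × R, ℝ), HasStrictFDerivAt (kernelMap V R H) D m :=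
    fun m hm => (hH.exists_hasStrictFDerivAt_kernelMap hm).2
  choose! D hD using hex
  have hnorm := norm_eq_gradNorm he
  have h₁ : ∀ m₁ ∈ B, ∀ m₂ ∈ B, ∀ u v : 𝓗, modelOp t V ι (kernelMap V R H m₁) u =
      modelOp t V ι (kernelMap V R H m₂) v → (u ≠ 0 ∨ v ≠ 0) → m₁ = m₂ ∧ u = v := by
    intro m₁ hm₁ m₂ hm₂ u v huv hne
    obtain ⟨u, rfl⟩ := e.surjective u
    obtain ⟨v, rfl⟩ := e.surjective v
    rw [modelOp_apply, modelOp_apply, hι, hι] at huv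
    have := hU₁ m₁ hm₁ m₂ hm₂ u v ((ae_eq_iff_toL2_eq hV.measurableSet
      (opA_eq_kernelOp hR (hH.continuous_kernel hm₁) u)
      (opA_eq_kernelOp hR (hH.continuous_kernel hm₂) v)).2 huv) (by simpa using hne)
    exact ⟨this.1, by rw [this.2]⟩
  have h₂ : ∀ q : Euc p, ‖q‖ = 1 → ∀ m ∈ B, ∀ u v : 𝓗, (modelOp t V ι ∘L D m) q u =
      modelOp t V ι (kernelMap V R H m) v → u = 0 ∧ v = 0 := by
    intro q hq m hm u v huv
    obtain ⟨u, rfl⟩ := e.surjective u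
    obtain ⟨v, rfl⟩ := e.surjective v
    change modelOp t V ι (D m q) (e u) = _ at huv
    rw [modelOp_apply, modelOp_apply, hι, hι] at huv
    have := hU₂ q hq m hm u v ((ae_eq_iff_toL2_eq hV.measurableSet
      (opDA_eq_kernelOp hR (hH.exists_hasStrictFDerivAt_kernelMap hm).1
        (hD m hm).hasFDerivAt q u)
      (opA_eq_kernelOp hR (hH.continuous_kernel hm) v)).2 huv)
    simpa using this
  obtain ⟨C, hC, h⟩ := exists_stability_constant hβ hB
    (T := fun m => modelOp t V ι (kernelMap V R H m)) (D := fun m => modelOp t V ι ∘L D m)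
    (fun m => isCompactOperator_modelOp ι _)
    (fun m hm => (modelOp t V ι).hasStrictFDerivAt.comp m (hD m hm)) h₁ h₂ hA₁ A₂
  refine ⟨C, hC, fun m hm m' hm' u hu v hv h1 h2 => ?_⟩
  rw [normV_opA_sub hV hH hι hm hm']
  rw [normV_opA hV hH hι hm'] at h1
  rw [← hnorm] at h2
  exact h m hm m' hm' _ (mem_highSpan_of_mem_spaceE hV hH he hι hm hu) _
    (mem_highSpan_of_mem_spaceE hV hH he hι hm' hv) h1 h2

theorem exists_gradNorm_sub_le (hV : IsCompactManifold t V) (hB : IsCompact B)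
    (hH : KernelRegularity V R B B' H)
    (he : ∀ u v, inner ℝ (e u) (e v) = gradInner u v) (hι : ∀ u, ι (e u) = restrictLp hR u.1.1)
    {β : ℝ} (hβ : 0 < β) :
    ∃ K, 0 ≤ K ∧ ∀ m ∈ B, ∀ m' ∈ B, ∀ u ∈ spaceE t s V R H β m, ∀ v ∈ spaceE t s V R H β m',
      gradNorm (u - v) ≤ K *
        (normV t V (fun x => opA H m u x - opA H m' v x) + ‖m - m'‖ * gradNorm v) := by
  have hex : ∀ m ∈ B, ∃ D : Euc p →L[ℝ] C(V × R, ℝ), HasStrictFDerivAt (kernelMap V R H) D m :=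
    fun m hm => (hH.exists_hasStrictFDerivAt_kernelMap hm).2
  choose! D hD using hex
  have hnorm := norm_eq_gradNorm he
  obtain ⟨K, hK, h⟩ := exists_norm_sub_le_of_mem_highSpan hβ hB
    (T := fun m => modelOp t V ι (kernelMap V R H m)) (D := fun m => modelOp t V ι ∘L D m)
    (fun m => isCompactOperator_modelOp ι _)
    (fun m hm => (modelOp t V ι).hasStrictFDerivAt.comp m (hD m hm))
  refine ⟨K, hK, fun m hm m' hm' u hu v hv => ?_⟩
  have := h m hm m' hm' _ (mem_highSpan_of_mem_spaceE hV hH he hι hm hu) _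
    (mem_highSpan_of_mem_spaceE hV hH he hι hm' hv)
  rwa [← map_sub, hnorm, hnorm, ← normV_opA_sub hV hH hι hm hm'] at this

end Model

theorem opA_zero {d p s : ℕ} {R : Set (Euc d)} (H : Euc p → Euc d → Euc d → ℝ) (m : Euc p)
    (x : Euc d) : opA H m (0 : H10 s R) x = 0 := by
  refine integral_eq_zero_of_ae ?_
  filter_upwards [Lp.coeFn_zero ℝ 2 (surfaceMeasure s R)] with y hy
  have : ((0 : H10 s R).1.1 : Euc d → ℝ) y = 0 := hy
  rw [this, mul_zero, Pi.zero_apply]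

/-! ### Assembling the estimates -/

section Estimates

variable {d p t s : ℕ} {V R : Set (Euc d)} {B B' : Set (Euc p)}
  {H : Euc p → Euc d → Euc d → ℝ} {M : ℕ → ℕ} {P : (k : ℕ) → Fin (M k) → Euc d}
  {c : (k : ℕ) → Fin (M k) → ℝ} {h : ℕ → ℝ}

/-- The estimate with a given constant for the continuous problem, a bound for the quadrature error
in terms of parameters and sources, and a bound for the sources in terms of the measurements. -/
theorem exists_estimates (hV : IsCompactManifold t V) (hR : IsCompactManifold s R)
    (hRb : ComponentsHaveBoundary s R) (hB : IsCompact B) (hH : KernelRegularity V R B B' H)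
    (hU₁ : UniqueParameter t s V R B H) (hU₂ : UniqueDerivative t s V R B H)
    (hQ : IsQuadrature t V M P c h) {A₁ β : ℝ} (hA₁ : 0 < A₁) (hβ : 0 < β) (A₂ : ℝ) :
    (∃ C, 0 < C ∧ ContinuousStability t s V R B H β A₁ A₂ C) ∧
    (∃ K, 0 ≤ K ∧ ∀ m ∈ B, ∀ m' ∈ B, ∀ u v : H10 s R, ∀ k,
      |discSq M P c k (fun x => opA H m u x - opA H m' v x) -
        normV t V (fun x => opA H m u x - opA H m' v x) ^ 2| ≤
          |h k| * (K * (gradNorm (u - v) + ‖m - m'‖ * gradNorm v) ^ 2)) ∧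
    ∃ K, 0 ≤ K ∧ ∀ m ∈ B, ∀ m' ∈ B, ∀ u ∈ spaceE t s V R H β m, ∀ v ∈ spaceE t s V R H β m',
      gradNorm (u - v) ≤ K *
        (normV t V (fun x => opA H m u x - opA H m' v x) + ‖m - m'‖ * gradNorm v) := by
  have := isCompact_iff_compactSpace.1 hV.isCompact
  have := isCompact_iff_compactSpace.1 hR.isCompact
  have := hV.isFiniteMeasureOn
  have := hR.isFiniteMeasureOn
  obtain ⟨_, e, J, he, hJ⟩ := hR.exists_hilbertModel hRb
  have he' : ∀ u v, inner ℝ (e u) (e v) = gradInner u v := fun u v => by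
    rw [gradInner, ← he u, ← he v]
    rfl
  let ι : gradRange s R →L[ℝ] Lp ℝ 2 (surfaceMeasureOn s R) :=
    (restrictLp hR.measurableSet).toContinuousLinearMap ∘L J
  have hι : ∀ u, ι (e u) = restrictLp hR.measurableSet u.1.1 := fun u => by
    rw [← hJ u]
    rfl
  exact ⟨exists_continuousStability hV hB hH hU₁ hU₂ he' hι hA₁ hβ A₂,
    exists_abs_discSq_opA_sub_le hV hB hH he' hι hQ, exists_gradNorm_sub_le hV hB hH he' hι hβ⟩

theorem normV_nonneg (f : Euc d → ℝ) : 0 ≤ normV t V f := Real.sqrt_nonneg _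

/-- A quarter of the square of the norm remains, so the constant is halved. -/
theorem discreteEstimate_of_sq_le {C : ℝ} (hC : 0 < C) {k : ℕ} {m m' : Euc p} {u v : H10 s R}
    {n : ℝ} (hn : C * ‖m - m'‖ ≤ n)
    (hd : n ^ 2 / 4 ≤ discSq M P c k (fun x => opA H m u x - opA H m' v x)) :
    DiscreteEstimate H M P c C k m m' u v := by
  refine ⟨le_trans (by positivity) hd, Real.le_sqrt_of_sq_le (le_trans ?_ hd)⟩
  have h1 : (C * ‖m - m'‖) ^ 2 ≤ n ^ 2 := pow_le_pow_left₀ (by positivity) hn 2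
  calc (C / 2 * ‖m - m'‖) ^ 2 = (C * ‖m - m'‖) ^ 2 / 4 := by ring
    _ ≤ _ := by gcongr

end Estimates

end ParamInverse

end

/-! ### The main theorem -/

open ParamInverse in
theorem mainTheorem1 {d p t s : ℕ} (V R : Set (ParamInverse.Euc d))
    (hV : ParamInverse.IsCompactManifold t V) (hR : ParamInverse.IsCompactManifold s R)
    (hRb : ParamInverse.ComponentsHaveBoundary s R)
    (B B' : Set (ParamInverse.Euc p)) (hB : IsCompact B)
    (H : ParamInverse.Euc p → ParamInverse.Euc d → ParamInverse.Euc d → ℝ)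
    (hH : ParamInverse.KernelRegularity V R B B' H)
    (hU₁ : ParamInverse.UniqueParameter t s V R B H)
    (hU₂ : ParamInverse.UniqueDerivative t s V R B H)
    (M : ℕ → ℕ) (P : (k : ℕ) → Fin (M k) → ParamInverse.Euc d) (c : (k : ℕ) → Fin (M k) → ℝ)
    (h : ℕ → ℝ) (hQ : ParamInverse.IsQuadrature t V M P c h)
    (A₁ A₂ β : ℝ) (hA₁ : 0 < A₁) (hA₂ : 0 < A₂) (hβ : 0 < β) :
    (∃ C : ℝ, 0 < C ∧ ParamInverse.ContinuousStability t s V R B H β A₁ A₂ C ∧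
      ∃ N : ℕ, ∀ k : ℕ, N < k → ∀ m ∈ B, ∀ m' ∈ B,
        ∀ u ∈ ParamInverse.spaceE t s V R H β m, ∀ v ∈ ParamInverse.spaceE t s V R H β m',
          ParamInverse.gradNorm v ≤ A₂ →
          A₁ ^ 2 ≤ ParamInverse.discSq M P c k (ParamInverse.opA H m' v) →
            ParamInverse.DiscreteEstimate H M P c C k m m' u v ∧
            ((∀ j, ParamInverse.opA H m u (P k j) = ParamInverse.opA H m' v (P k j)) → m = m')) ∧
    (∀ C : ℝ, 0 < C → ParamInverse.ContinuousStability t s V R B H β A₁ A₂ C →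
      ∃ N : ℕ, ∀ m ∈ B, ∀ m' ∈ B,
        ∀ u ∈ ParamInverse.spaceE t s V R H β m, ∀ v ∈ ParamInverse.spaceE t s V R H β m',
          ParamInverse.gradNorm v ≤ A₂ →
          (∀ k : ℕ, N < k → A₁ ^ 2 ≤ ParamInverse.discSq M P c k (ParamInverse.opA H m' v)) →
            ∀ k : ℕ, N < k → ParamInverse.DiscreteEstimate H M P c C k m m' u v) := by
  -- The constant is taken for the threshold `A₁ / 2`: it is admissible for `A₁` too, and it
  -- tolerates the error of measuring `‖𝒜_{m'} v‖` at the nodes.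
  obtain ⟨⟨C, hC, hstab⟩, ⟨K, hK0, hK⟩, L, hL0, hL⟩ :=
    exists_estimates hV hR hRb hB hH hU₁ hU₂ hQ (half_pos hA₁) hβ A₂
  have htend : ∀ a : ℝ, Tendsto (fun k => |h k| * a) atTop (𝓝 0) := fun a => by
    simpa using hQ.tendsto.abs.mul_const a
  have hsmall : ∀ a ε : ℝ, 0 < ε → ∃ N : ℕ, ∀ k, N < k → |h k| * a ≤ ε := fun a ε hε => by
    obtain ⟨N, hN⟩ := eventually_atTop.1 ((htend a).eventually (ge_mem_nhds hε))
    exact ⟨N, fun k hk => hN k hk.le⟩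
  have hg : ∀ v : H10 s R, 0 ≤ gradNorm v := fun v => norm_nonneg _
  have hsingle : ∀ m ∈ B, ∀ v : H10 s R, ∀ k,
      |discSq M P c k (opA H m v) - normV t V (opA H m v) ^ 2| ≤ |h k| * (K * gradNorm v ^ 2) :=
    -- The error bound for a single function is the case `m = m'` with second source zero.
    fun m hm v k => by
      have := hK m hm m hm v 0 k
      simpa [opA_zero] using this
  have hcore : ∀ C : ℝ, 0 < C → ∃ N : ℕ, ∀ k, N < k → ∀ m ∈ B, ∀ m' ∈ B,
      ∀ u ∈ spaceE t s V R H β m, ∀ v ∈ spaceE t s V R H β m', gradNorm v ≤ A₂ →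
        C * ‖m - m'‖ ≤ normV t V (fun x => opA H m u x - opA H m' v x) →
          DiscreteEstimate H M P c C k m m' u v := by
    intro C hC
    -- From `δ ‖v‖ ≤ (A₂ / C) n` and `‖u - v‖ ≤ L (n + δ ‖v‖)`, the sum `‖u - v‖ + δ ‖v‖` is at most
    -- `(L + 1) (1 + A₂ / C) n`. An error of at most `3/4 n²` leaves `n² / 4`.
    obtain ⟨N, hN⟩ := hsmall (K * ((L + 1) * (1 + A₂ / C)) ^ 2) (3 / 4) (by norm_num)
    refine ⟨N, fun k hk m hm m' hm' u hu v hv hv2 hn => discreteEstimate_of_sq_le hC hn ?_⟩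
    have h1 := hK m hm m' hm' u v k
    have h2 := hL m hm m' hm' u hu v hv
    have hn0 := normV_nonneg (t := t) (V := V) (fun x => opA H m u x - opA H m' v x)
    set n := normV t V (fun x => opA H m u x - opA H m' v x)
    have h3 : ‖m - m'‖ * gradNorm v ≤ A₂ / C * n := by
      calc ‖m - m'‖ * gradNorm v ≤ n / C * A₂ := by
            gcongr
            · exact hg v
            · rwa [le_div_iff₀' hC]
        _ = _ := by ring
    have h4 : gradNorm (u - v) + ‖m - m'‖ * gradNorm v ≤ (L + 1) * (1 + A₂ / C) * n := by
      have h5 := mul_le_mul_of_nonneg_left h3 hL0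
      linarith
    have h6 : |h k| * (K * (gradNorm (u - v) + ‖m - m'‖ * gradNorm v) ^ 2) ≤ 3 / 4 * n ^ 2 := by
      have h0 : 0 ≤ gradNorm (u - v) + ‖m - m'‖ * gradNorm v :=
        add_nonneg (hg _) (mul_nonneg (norm_nonneg _) (hg _))
      calc _ ≤ |h k| * (K * ((L + 1) * (1 + A₂ / C) * n) ^ 2) := by gcongr
        _ = |h k| * (K * ((L + 1) * (1 + A₂ / C)) ^ 2) * n ^ 2 := by ring
        _ ≤ _ := by gcongr; exact hN k hk
    have h7 := (abs_le.1 (h1.trans h6)).1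
    linarith
  refine ⟨⟨C, hC, fun m hm m' hm' u hu v hv hv1 hv2 =>
    hstab m hm m' hm' u hu v hv (by linarith) hv2, ?_⟩, fun C hC hCs => ?_⟩
  · obtain ⟨N₁, hN₁⟩ := hcore C hC
    -- `A₁² - 3/4 A₁² = (A₁ / 2)²`, the threshold for which `C` was chosen.
    obtain ⟨N₂, hN₂⟩ := hsmall (K * A₂ ^ 2) (3 / 4 * A₁ ^ 2) (by positivity)
    refine ⟨max N₁ N₂, fun k hk m hm m' hm' u hu v hv hv2 hv1 => ?_⟩
    have h1 : A₁ / 2 ≤ normV t V (opA H m' v) := by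
      refine (sq_le_sq₀ (half_pos hA₁).le (normV_nonneg _)).1 ?_
      have h2 : |h k| * (K * gradNorm v ^ 2) ≤ 3 / 4 * A₁ ^ 2 :=
        le_trans (by gcongr; exact hg v) (hN₂ k (lt_of_le_of_lt (le_max_right _ _) hk))
      have h3 := (abs_le.1 ((hsingle m' hm' v k).trans h2)).2
      linarith
    have hest := hN₁ k (lt_of_le_of_lt (le_max_left _ _) hk) m hm m' hm' u hu v hv hv2
      (hstab m hm m' hm' u hu v hv h1 hv2)
    refine ⟨hest, fun heq => ?_⟩
    have h0 : discSq M P c k (fun x => opA H m u x - opA H m' v x) = 0 := by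
      simp [discSq, heq]
    have h2 := hest.2
    rw [h0, Real.sqrt_zero] at h2
    exact sub_eq_zero.1 (norm_le_zero_iff.1 (nonpos_of_mul_nonpos_right h2 (half_pos hC)))
  · obtain ⟨N, hN⟩ := hcore C hC
    refine ⟨N, fun m hm m' hm' u hu v hv hv2 hv1 k hk =>
      hN k hk m hm m' hm' u hu v hv hv2 (hCs m hm m' hm' u hu v hv ?_ hv2)⟩
    refine (sq_le_sq₀ hA₁.le (normV_nonneg _)).1 ?_
    -- The discrete lower bound now holds for every `k > N`, so letting `k → ∞` recovers the full
    -- threshold `A₁` and any admissible `C` can be used.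
    have h1 : Tendsto (fun k => normV t V (opA H m' v) ^ 2 + |h k| * (K * gradNorm v ^ 2)) atTop
        (𝓝 (normV t V (opA H m' v) ^ 2)) := by
      simpa using (htend (K * gradNorm v ^ 2)).const_add (normV t V (opA H m' v) ^ 2)
    refine ge_of_tendsto h1 ((eventually_gt_atTop N).mono fun j hj => ?_)
    have h2 := (abs_le.1 (hsingle m' hm' v j)).2
    have h3 := hv1 j hj
    linarith
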